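/- **Definitions.** A region is a non-empty open connected subset of $\mathbb C$. A Jordan region is the bounded component of the complement of a Jordan curve in $\mathbb C$. If $\Gamma$ is a family of curves in $\mathbb C$, its modulus is $$\operatorname{mod}(\Gamma)=\inf_\rho\int_{\mathbb C}\rho(z)^2\,dm_2(z)\in[0,\infty],$$ where $m_2$ is the two-dimensional Lebesgue measure and the infimum is over all Borel functions $\rho:\mathbb C\to[0,\infty]$ with $\int_\gamma\rho\,ds\ge 1$ for all rectifiable curves $\gamma\in\Gamma$. If $U$ is a simply connected region and $V\subset U$ is a non-empty connected set with $\overline V\subset U$, then $\operatorname{mod}(U\setminus\overline V)$ denotes the modulus of the family of all curves $\gamma:[0,1]\to U\setminus\overline V$ that separate $V$ from the complement of $U$ in the Riemann sphere $\widehat{\mathbb C}=\mathbb C\cup\{\infty\}$ (that is, the component of $\mathbb C\setminus\gamma([0,1])$ containing $V$ is bounded and contained in $U$). **Lemma.** Let $U,U'\subset\mathbb C$ be simply connected regions, and let $g:U\to U'$ be a proper holomorphic map of degree $D$ (every point of $U'$ has exactly $D$ preimages in $U$, counted with multiplicity). (a) If $V'$ is a Jordan region with $\overline{V'}\subset U'$,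 and $V$ is a connected component of $g^{-1}(V')$, then $$\operatorname{mod}(U'\setminus\overline{V'})\le D\cdot\operatorname{mod}(U\setminus\overline V).$$ (b) If $V$ is a Jordan region with $\overline V\subset U$, and $V'=g(V)$, then $$\operatorname{mod}(U\setminus\overline V)\le\operatorname{mod}(U'\setminus\overline{V'}).$$ -/

import Mathlib

open Set MeasureTheory
open scoped ENNReal

/-- A Jordan region: the bounded component of the complement of a Jordan curve, that is, of the
image of the circle under a continuous injective map into the plane. -/
def IsJordanRegion (V : Set ℂ) : Prop :=
  ∃ c : Circle → ℂ, Continuous c ∧ Function.Injective c ∧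
    ∃ z ∈ (range c)ᶜ, V = connectedComponentIn (range c)ᶜ z ∧ Bornology.IsBounded V

/-- `V` is a connected component of the set `A`. -/
def IsComponentOf (V A : Set ℂ) : Prop :=
  ∃ z ∈ A, V = connectedComponentIn A z

/-- The map `g : U → U'` has degree `D`: every point of `U'` has exactly `D` preimages in `U`,
counted with multiplicity. -/
def HasDegree (g : ℂ → ℂ) (U U' : Set ℂ) (D : ℕ) : Prop :=
  ∀ w ∈ U', (U ∩ g ⁻¹' {w}).Finite ∧
    ∑ᶠ z ∈ U ∩ g ⁻¹' {w}, analyticOrderNatAt (fun ζ => g ζ - w) z = D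

/-- The integral `∫_γ ρ ds` with respect to arc length along the rectifiable curve
`γ : [0, 1] → ℂ`, computed in the arc length parametrization, which is defined on `[0, L]`, where
`L` is the length of `γ`. -/
noncomputable def arcLengthIntegral (ρ : ℂ → ℝ≥0∞) (γ : ℝ → ℂ) : ℝ≥0∞ :=
  ∫⁻ s in Icc 0 (eVariationOn γ (Icc 0 1)).toReal, ρ (naturalParameterization γ (Icc 0 1) 0 s)

/-- A Borel function `ρ : ℂ → [0, ∞]` is admissible for the family `Γ` of curves parametrized by
`[0, 1]` if `∫_γ ρ ds ≥ 1` for all (rectifiable) curves `γ` in `Γ`. -/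
def IsAdmissible (ρ : ℂ → ℝ≥0∞) (Γ : Set (ℝ → ℂ)) : Prop :=
  Measurable ρ ∧
    ∀ γ ∈ Γ, BoundedVariationOn γ (Icc 0 1) → 1 ≤ arcLengthIntegral ρ γ

/-- The modulus of a family of curves. -/
noncomputable def curveModulus (Γ : Set (ℝ → ℂ)) : ℝ≥0∞ :=
  ⨅ (ρ : ℂ → ℝ≥0∞) (_ : IsAdmissible ρ Γ), ∫⁻ z, ρ z ^ 2

/-- The curves `γ : [0, 1] → U \ closure V` that separate `V` from the complement of `U` in the
Riemann sphere: each component of the complement of `γ` in the plane which meets `V` is bounded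
(so that `γ` separates it from `∞`) and contains no point of the plane outside `U`. -/
def separatingCurves (U V : Set ℂ) : Set (ℝ → ℂ) :=
  {γ | ContinuousOn γ (Icc 0 1) ∧ MapsTo γ (Icc 0 1) (U \ closure V) ∧
    ∀ z ∈ V, Bornology.IsBounded (connectedComponentIn (γ '' Icc 0 1)ᶜ z) ∧
      connectedComponentIn (γ '' Icc 0 1)ᶜ z ⊆ U}

/-- `mod (U \ closure V)`: the modulus of the family of curves in `U \ closure V` that separate
`V` from the complement of `U`. -/
noncomputable def ringModulus (U V : Set ℂ) : ℝ≥0∞ :=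
  curveModulus (separatingCurves U V)

/-!
The modulus of the ring `U \ closure V` is compared with the reciprocal of its capacity, the infimum
of the Dirichlet energy `∫ ‖∇u‖²` over the potentials `u` that are one near `closure V` and vanish
off a compact subset of `U`. Potentials are easy to transport by holomorphic maps, while curves are
not: no lifting of curves is needed.

Modulus at least reciprocal energy (`IsPotential.one_le_mul`). Let `ρ` be admissible, `u` a
potential with pointwise Lipschitz constant `η`. In the coordinate `ζ = log (z - z₀)` with `z₀ ∈ V`,
a path from `p` to `p + 2πi` over the ring gives a closed curve around `z₀`, which is separating
(`mem_separatingCurves_of_winding`), hence has `ρ`-length at least one. A shortest-path function for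
the (mollified) `ρ`, made to increase by one under the period by an infimum over the translates of a
base point (`exists_calibration`), is a function `b` with `b (ζ + 2πi) = b ζ + 1` whose gradient is
at most the pulled-back density. That this infimum is finite rests on the fact that a path with
displacement `2πi n` has length at least `n` (`natCast_le_of_reach`), which comes from plane
topology: a path with displacement `2 b` has a chord equal to `b` (`exists_chord`). Stokes' theorem
for `du ∧ db` in a period strip (`stokes_strip`) gives `1 ≤ ∫ η ρ`, and the Cauchy-Schwarz
inequality gives `1 ≤ ∫ ρ² ∫ η²`.

Potentials of energy at most `1 / T` exist for `T` below the modulus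
(`exists_isSmoothPotential_energy_le`). For a rectifiable separating curve, the mollified indicator
function of the component that it encloses is a potential whose gradient is at most the mollified
arc length (`norm_fderiv_moll_indicator_le`). If all potentials had energy above `1 / T`, the
element of least norm in the closure of the convex set of their upper gradients would, after
normalization, be a density of energy at most `T` whose mollifications have integral at least one
along every separating curve (`exists_dual_density`). A supremum of a fast converging sequence of
these mollifications is admissible with energy below the modulus, which is absurd.

Transport. If `u` is a potential on the target, `u ∘ g` is one on the source, with energy multiplied
at most by the degree (`IsSmoothPotential.pullback`, `energy_pullback_le`). If `u` is a potential on
the source, the supremum of `u` over the fibres of `g` is one on the target, with no larger energy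
(`IsSmoothPotential.pushforward`, `energy_pushforward_le`); it is only Lipschitz, and controlled off
the countable set of critical values, which is why `IsPotential` is phrased with pointwise Lipschitz
constants and an exceptional set. Both energy bounds come from the change of variables formula with
multiplicity (`lintegral_tsum_fibre`).
-/

/-! ### Mollification -/

/-- Mollification of a real function by the normalized bump function of `φ`. -/
noncomputable def moll (φ : ContDiffBump (0 : ℂ)) (f : ℂ → ℝ) (x : ℂ) : ℝ :=
  ∫ t, φ.normed volume t * f (x - t)

/-- The normalized bump function of `φ`, with values in `[0, ∞]`. -/
noncomputable def bumpWeight (φ : ContDiffBump (0 : ℂ)) (t : ℂ) : ℝ≥0∞ :=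
  ENNReal.ofReal (φ.normed volume t)

/-- Mollification of a function with values in `[0, ∞]`. -/
noncomputable def lmoll (φ : ContDiffBump (0 : ℂ)) (f : ℂ → ℝ≥0∞) (x : ℂ) : ℝ≥0∞ :=
  ∫⁻ t, bumpWeight φ t * f (x - t)

section Mollification

open Filter Topology

variable (φ : ContDiffBump (0 : ℂ))

@[fun_prop]
lemma measurable_bumpWeight : Measurable (bumpWeight φ) :=
  (φ.continuous_normed.measurable).ennreal_ofReal

lemma moll_eq_convolution (f : ℂ → ℝ) :
    moll φ f = convolution (φ.normed volume) f (ContinuousLinearMap.lsmul ℝ ℝ) volume := by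
  ext x
  simp [moll, convolution_def]

lemma integrable_moll_integrand {f : ℂ → ℝ} (hf : LocallyIntegrable f) (x : ℂ) :
    Integrable (fun t => φ.normed volume t * f (x - t)) := by
  have h := (HasCompactSupport.convolutionExists_left (ContinuousLinearMap.lsmul ℝ ℝ)
    (φ.hasCompactSupport_normed (μ := volume)) φ.continuous_normed hf) x
  simpa [ConvolutionExistsAt] using h

lemma contDiff_moll {f : ℂ → ℝ} (hf : LocallyIntegrable f) (n : ℕ∞) :
    ContDiff ℝ n (moll φ f) := by
  rw [moll_eq_convolution]
  exact (φ.hasCompactSupport_normed).contDiff_convolution_left _ φ.contDiff_normed hf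

lemma lintegral_bumpWeight : ∫⁻ t, bumpWeight φ t = 1 := by
  unfold bumpWeight
  rw [← ofReal_integral_eq_lintegral_ofReal φ.integrable_normed
    (Eventually.of_forall φ.nonneg_normed), φ.integral_normed, ENNReal.ofReal_one]

lemma ofReal_moll {f : ℂ → ℝ} (hf : LocallyIntegrable f) (h0 : ∀ x, 0 ≤ f x) (x : ℂ) :
    ENNReal.ofReal (moll φ f x) = lmoll φ (fun y => ENNReal.ofReal (f y)) x := by
  rw [moll, lmoll, ofReal_integral_eq_lintegral_ofReal (integrable_moll_integrand φ hf x)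
    (Eventually.of_forall fun t => mul_nonneg (φ.nonneg_normed t) (h0 _))]
  simp_rw [ENNReal.ofReal_mul (φ.nonneg_normed _), bumpWeight]

lemma moll_nonneg {f : ℂ → ℝ} (h0 : ∀ x, 0 ≤ f x) (x : ℂ) : 0 ≤ moll φ f x :=
  integral_nonneg fun t => mul_nonneg (φ.nonneg_normed t) (h0 _)

lemma normed_eq_zero_of_rOut_le {t : ℂ} (ht : φ.rOut ≤ ‖t‖) : φ.normed volume t = 0 := by
  have : t ∉ Function.support (φ.normed volume) := by
    rw [φ.support_normed_eq]; simpa using ht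
  simpa using this

/-- On a ball of the bump's radius only the values of `f` matter. -/
lemma moll_congr {f g : ℂ → ℝ} {x : ℂ} (h : ∀ y, ‖x - y‖ < φ.rOut → f y = g y) :
    moll φ f x = moll φ g x := by
  refine integral_congr_ae (Eventually.of_forall fun t => ?_)
  rcases le_or_gt φ.rOut ‖t‖ with ht | ht
  · simp [normed_eq_zero_of_rOut_le φ ht]
  · simp only
    rw [h (x - t) (by simpa using ht)]

lemma moll_const (c : ℝ) (x : ℂ) : moll φ (fun _ => c) x = c := by
  rw [moll, integral_mul_const, φ.integral_normed, one_mul]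

lemma measurable_lmoll {f : ℂ → ℝ≥0∞} (hf : Measurable f) : Measurable (lmoll φ f) := by
  unfold lmoll
  apply Measurable.lintegral_prod_right
  fun_prop

/-- Jensen's inequality for mollification. -/
lemma lmoll_sq_le {f : ℂ → ℝ≥0∞} (hf : Measurable f) (x : ℂ) :
    lmoll φ f x ^ 2 ≤ lmoll φ (fun y => f y ^ 2) x := by
  have h := ENNReal.lintegral_mul_le_Lp_mul_Lq (volume : Measure ℂ)
    (p := 2) (q := 2) (by constructor <;> norm_num)
    (f := fun t => bumpWeight φ t ^ (1 / 2 : ℝ))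
    (g := fun t => bumpWeight φ t ^ (1 / 2 : ℝ) * f (x - t))
    (by fun_prop) (by fun_prop)
  have e1 : ∀ a : ℝ≥0∞, (a ^ (1 / 2 : ℝ)) ^ (2 : ℝ) = a := fun a => by
    rw [← ENNReal.rpow_mul]; norm_num
  have e2 : ∀ a : ℝ≥0∞, a ^ (1 / 2 : ℝ) * a ^ (1 / 2 : ℝ) = a := fun a => by
    rw [← ENNReal.rpow_add_of_nonneg _ _ (by norm_num) (by norm_num)]; norm_num
  simp only [Pi.mul_apply, ENNReal.mul_rpow_of_nonneg _ _ (zero_le_two : (0 : ℝ) ≤ 2), e1,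
    ← mul_assoc, e2, lintegral_bumpWeight, ENNReal.one_rpow, one_mul] at h
  calc lmoll φ f x ^ 2 ≤ ((∫⁻ t, bumpWeight φ t * f (x - t) ^ (2 : ℝ))
        ^ (1 / 2 : ℝ)) ^ 2 := by
        gcongr
        exact h
    _ = _ := by
        rw [← ENNReal.rpow_natCast, Nat.cast_ofNat, e1]
        simp [lmoll]

/-- Mollification does not increase the `L²` norm over a set `s` by more than translations do. -/
lemma lintegral_lmoll_sq_le {f : ℂ → ℝ≥0∞} (hf : Measurable f) {s : Set ℂ} {c : ℝ≥0∞}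
    (hc : ∀ t, ∫⁻ x in s, f (x - t) ^ 2 ≤ c) : ∫⁻ x in s, lmoll φ f x ^ 2 ≤ c := by
  calc ∫⁻ x in s, lmoll φ f x ^ 2 ≤ ∫⁻ x in s, lmoll φ (fun y => f y ^ 2) x :=
        lintegral_mono fun x => lmoll_sq_le φ hf x
    _ = ∫⁻ t, ∫⁻ x in s, bumpWeight φ t * f (x - t) ^ 2 := by
        unfold lmoll
        rw [lintegral_lintegral_swap]
        fun_prop
    _ ≤ ∫⁻ t, bumpWeight φ t * c := by
        refine lintegral_mono fun t => ?_
        simp only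
        rw [lintegral_const_mul _ (by fun_prop)]
        gcongr
        exact hc t
    _ = c := by rw [lintegral_mul_const _ (measurable_bumpWeight φ), lintegral_bumpWeight, one_mul]

lemma lintegral_lmoll_sq_le_univ {f : ℂ → ℝ≥0∞} (hf : Measurable f) :
    ∫⁻ x, lmoll φ f x ^ 2 ≤ ∫⁻ x, f x ^ 2 := by
  have := lintegral_lmoll_sq_le φ hf (s := univ) (c := ∫⁻ x, f x ^ 2) (fun t => by
    rw [Measure.restrict_univ, lintegral_sub_right_eq_self (fun x => f x ^ 2) t])
  simpa using this

/-- If `G` bounds the increments of `f` along almost every translate of each segment, then the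
mollification of `G` bounds the gradient of the mollification of `f`. -/
lemma norm_fderiv_moll_le {f G : ℂ → ℝ} (hf : LocallyIntegrable f) (hG : LocallyIntegrable G)
    (hGm : Measurable G) (hG0 : ∀ x, 0 ≤ G x)
    (h : ∀ v : ℂ, ∀ᵐ p, ENNReal.ofReal |f (p + v) - f p| ≤
      ENNReal.ofReal ‖v‖ * ∫⁻ s in Icc (0 : ℝ) 1, ENNReal.ofReal (G (p + s * v))) (x : ℂ) :
    ‖fderiv ℝ (moll φ f) x‖ ≤ moll φ G x := by
  have hcont : Continuous (moll φ G) := (contDiff_moll φ hG 0).continuous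
  have hd : DifferentiableAt ℝ (moll φ f) x :=
    ((contDiff_moll φ hf 1).differentiable (by simp)) x
  have key : ∀ v : ℂ, ENNReal.ofReal |moll φ f (x + v) - moll φ f x| ≤
      ENNReal.ofReal ‖v‖ * ∫⁻ s in Icc (0 : ℝ) 1, ENNReal.ofReal (moll φ G (x + s * v)) := by
    intro v
    have e : moll φ f (x + v) - moll φ f x =
        ∫ t, φ.normed volume t * (f (x - t + v) - f (x - t)) := by
      rw [moll, moll, ← integral_sub (integrable_moll_integrand φ hf _)
        (integrable_moll_integrand φ hf _)]
      congr 1; ext t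
      rw [show x + v - t = x - t + v by ring]; ring
    calc ENNReal.ofReal |moll φ f (x + v) - moll φ f x|
        ≤ ∫⁻ t, bumpWeight φ t * ENNReal.ofReal |f (x - t + v) - f (x - t)| := by
          rw [e, ← Real.norm_eq_abs, ofReal_norm]
          refine (enorm_integral_le_lintegral_enorm _).trans_eq ?_
          congr 1; ext t
          rw [enorm_mul, Real.enorm_eq_ofReal (φ.nonneg_normed t), Real.enorm_eq_ofReal_abs,
            bumpWeight]
      _ ≤ ∫⁻ t, bumpWeight φ t * (ENNReal.ofReal ‖v‖ *
            ∫⁻ s in Icc (0 : ℝ) 1, ENNReal.ofReal (G (x - t + s * v))) := by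
          refine lintegral_mono_ae ?_
          have h' := (Measure.measurePreserving_sub_left (volume : Measure ℂ) x).quasiMeasurePreserving.ae (h v)
          filter_upwards [h'] with t ht
          gcongr
      _ = ENNReal.ofReal ‖v‖ * ∫⁻ t, ∫⁻ s in Icc (0 : ℝ) 1,
            bumpWeight φ t * ENNReal.ofReal (G (x - t + s * v)) := by
          rw [← lintegral_const_mul' _ _ ENNReal.ofReal_ne_top]
          congr 1; ext t
          rw [lintegral_const_mul' (bumpWeight φ t) _ ENNReal.ofReal_ne_top]; ring
      _ = ENNReal.ofReal ‖v‖ * ∫⁻ s in Icc (0 : ℝ) 1, ENNReal.ofReal (moll φ G (x + s * v)) := by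
          rw [lintegral_lintegral_swap (by fun_prop)]
          congr 2; ext s
          rw [ofReal_moll φ hG hG0, lmoll]
          congr 1; ext t
          rw [show x + s * v - t = x - t + s * v by ring]
  refine le_of_forall_gt_imp_ge_of_dense fun c hc => ?_
  have hc0 : 0 ≤ c := (moll_nonneg φ hG0 x).trans hc.le
  refine hd.hasFDerivAt.le_of_lip' hc0 ?_
  obtain ⟨r, hr, hball⟩ := Metric.eventually_nhds_iff_ball.1
    (hcont.continuousAt.eventually_lt continuousAt_const hc)
  filter_upwards [Metric.ball_mem_nhds x hr] with y hy
  have hk := key (y - x)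
  rw [add_sub_cancel] at hk
  rw [Real.norm_eq_abs, ← ENNReal.ofReal_le_ofReal_iff (by positivity)]
  refine hk.trans ?_
  rw [mul_comm c, ENNReal.ofReal_mul (norm_nonneg _)]
  gcongr
  calc ∫⁻ s in Icc (0 : ℝ) 1, ENNReal.ofReal (moll φ G (x + s * (y - x)))
      ≤ ∫⁻ s in Icc (0 : ℝ) 1, ENNReal.ofReal c := by
        refine setLIntegral_mono measurable_const fun s hs => ENNReal.ofReal_le_ofReal (hball _ ?_).le
        rw [Metric.mem_ball, dist_eq_norm, add_sub_cancel_left, norm_mul, Complex.norm_real,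
          Real.norm_eq_abs, abs_of_nonneg hs.1]
        refine lt_of_le_of_lt (mul_le_of_le_one_left (norm_nonneg _) hs.2) ?_
        simpa [dist_eq_norm] using hy
    _ = ENNReal.ofReal c := by simp

lemma moll_sub {f g : ℂ → ℝ} (hf : LocallyIntegrable f) (hg : LocallyIntegrable g) (x : ℂ) :
    moll φ (fun y => f y - g y) x = moll φ f x - moll φ g x := by
  rw [moll, moll, moll, ← integral_sub (integrable_moll_integrand φ hf _)
    (integrable_moll_integrand φ hg _)]
  congr 1; ext t; ring

lemma enorm_moll_le (f : ℂ → ℝ) (x : ℂ) : ‖moll φ f x‖ₑ ≤ lmoll φ (fun y => ‖f y‖ₑ) x := by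
  refine (enorm_integral_le_lintegral_enorm _).trans_eq ?_
  unfold lmoll
  congr 1; ext t
  rw [enorm_mul, Real.enorm_eq_ofReal (φ.nonneg_normed t), bumpWeight]

lemma eLpNorm_two_sq {f : ℂ → ℝ} : eLpNorm f 2 volume ^ 2 = ∫⁻ x, ‖f x‖ₑ ^ 2 := by
  rw [eLpNorm_eq_lintegral_rpow_enorm_toReal (by norm_num) (by norm_num), ← ENNReal.rpow_natCast,
    ← ENNReal.rpow_mul]
  norm_num

lemma eLpNorm_moll_le {f : ℂ → ℝ} (hf : Measurable f) :
    eLpNorm (moll φ f) 2 volume ≤ eLpNorm f 2 volume := by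
  rw [← ENNReal.pow_le_pow_left_iff (n := 2) (by norm_num), eLpNorm_two_sq, eLpNorm_two_sq]
  refine le_trans ?_ (lintegral_lmoll_sq_le_univ φ (f := fun y => ‖f y‖ₑ) (by fun_prop))
  gcongr with x
  exact enorm_moll_le φ f x

/-- Mollification is an approximate identity in `L²`. -/
lemma exists_eLpNorm_moll_sub_le {f : ℂ → ℝ} (hfm : Measurable f) (hf : MemLp f 2) {ε : ℝ≥0∞}
    (hε : ε ≠ 0) : ∃ r > 0, ∀ φ : ContDiffBump (0 : ℂ), φ.rOut ≤ r →
      eLpNorm (fun x => moll φ f x - f x) 2 volume ≤ ε := by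
  have hε3 : ε / 3 ≠ 0 := by simp [hε]
  obtain ⟨g, hgs, hfg, hgc, hg2⟩ := hf.exists_hasCompactSupport_eLpNorm_sub_le (by norm_num) hε3
  have hfl : LocallyIntegrable f := hf.locallyIntegrable (by norm_num)
  have hgl : LocallyIntegrable g := hg2.locallyIntegrable (by norm_num)
  -- the mollifications of `g` converge uniformly, and their supports stay in a compact set
  set K := Metric.cthickening 1 (tsupport g)
  have hK : IsCompact K := hgs.isCompact.cthickening
  obtain ⟨c, hc0, hc⟩ : ∃ c : ℝ, 0 < c ∧ ENNReal.ofReal c ^ 2 * volume K ≤ (ε / 3) ^ 2 := by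
    have hlim : Tendsto (fun c : ℝ => ENNReal.ofReal c ^ 2 * volume K) (𝓝[>] 0) (𝓝 0) := by
      have h1 : Tendsto (fun c : ℝ => ENNReal.ofReal c ^ 2) (𝓝[>] 0) (𝓝 0) := by
        have : Continuous fun c : ℝ => ENNReal.ofReal c ^ 2 :=
          (ENNReal.continuous_pow 2).comp ENNReal.continuous_ofReal
        simpa using (this.tendsto 0).mono_left nhdsWithin_le_nhds
      simpa using ENNReal.Tendsto.mul_const h1 (Or.inr hK.measure_lt_top.ne)
    have hpos : (0 : ℝ≥0∞) < (ε / 3) ^ 2 := by positivity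
    obtain ⟨c, h1, h2⟩ := ((hlim.eventually_le_const hpos).and
      self_mem_nhdsWithin).exists
    exact ⟨c, h2, h1⟩
  obtain ⟨r, hr, hunif⟩ := Metric.uniformContinuous_iff.1
    (hgs.uniformContinuous_of_continuous hgc) c hc0
  refine ⟨min (r / 2) 1, by positivity, fun φ hφ => ?_⟩
  have hφr : φ.rOut < r := by
    have := hφ.trans (min_le_left _ _); linarith
  have hφ1 : φ.rOut ≤ 1 := hφ.trans (min_le_right _ _)
  have h1 : ∀ x, |moll φ g x - g x| ≤ c := by
    intro x
    have : moll φ g x - g x = moll φ (fun y => g y - g x) x := by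
      rw [moll_sub φ hgl (locallyIntegrable_const _), moll_const]
    rw [this, moll, ← Real.norm_eq_abs]
    calc ‖∫ t, φ.normed volume t * (g (x - t) - g x)‖ ≤ ∫ t, φ.normed volume t * c := by
          refine norm_integral_le_of_norm_le (φ.integrable_normed.mul_const c)
            (Eventually.of_forall fun t => ?_)
          rcases le_or_gt φ.rOut ‖t‖ with ht | ht
          · simp [normed_eq_zero_of_rOut_le φ ht]
          · rw [norm_mul, Real.norm_eq_abs, abs_of_nonneg (φ.nonneg_normed t)]
            refine mul_le_mul_of_nonneg_left ?_ (φ.nonneg_normed t)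
            have := hunif (a := x - t) (b := x) (by simpa using ht.trans hφr)
            exact (by simpa [Real.dist_eq] using this.le)
      _ = c := by rw [integral_mul_const, φ.integral_normed, one_mul]
  have h2 : ∀ x, x ∉ K → moll φ g x - g x = 0 := by
    intro x hx
    have hz : ∀ y, ‖x - y‖ ≤ 1 → g y = 0 := by
      intro y hy
      by_contra hne
      exact hx (Metric.mem_cthickening_of_dist_le x y 1 _ (subset_tsupport g hne)
        (by simpa [dist_eq_norm] using hy))
    rw [moll_congr φ (g := fun _ => 0) fun y hy => hz y (hy.le.trans hφ1), moll_const,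
      hz x (by simp), sub_zero]
  have h3 : eLpNorm (fun x => moll φ g x - g x) 2 volume ≤ ε / 3 := by
    rw [← ENNReal.pow_le_pow_left_iff (n := 2) (by norm_num), eLpNorm_two_sq]
    refine le_trans ?_ hc
    calc ∫⁻ x, ‖moll φ g x - g x‖ₑ ^ 2 ≤ ∫⁻ x, K.indicator (fun _ => ENNReal.ofReal c ^ 2) x := by
          refine lintegral_mono fun x => ?_
          by_cases hx : x ∈ K
          · rw [indicator_of_mem hx]
            gcongr
            rw [Real.enorm_eq_ofReal_abs]
            exact ENNReal.ofReal_le_ofReal (h1 x)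
          · simp [h2 x hx]
      _ = _ := by rw [lintegral_indicator hK.measurableSet]; simp
  have h4 : eLpNorm (fun x => moll φ (fun y => f y - g y) x) 2 volume ≤ ε / 3 :=
    (eLpNorm_moll_le φ (by fun_prop)).trans hfg
  have h5 : eLpNorm (fun x => g x - f x) 2 volume ≤ ε / 3 := by
    rw [← eLpNorm_neg]; convert hfg using 2; ext x; simp
  have hdec : (fun x => moll φ f x - f x) = (fun x => moll φ (fun y => f y - g y) x) +
      ((fun x => moll φ g x - g x) + fun x => g x - f x) := by
    ext x
    simp only [Pi.add_apply]
    rw [moll_sub φ hfl hgl]; ring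
  have c1 : Continuous (moll φ (fun y => f y - g y)) :=
    (contDiff_moll φ (hfl.sub hgl) 0).continuous
  have c2 : Continuous (moll φ g) := (contDiff_moll φ hgl 0).continuous
  have hgm : Measurable g := hgc.measurable
  have m2 : Measurable (moll φ g) := c2.measurable
  rw [hdec]
  refine (eLpNorm_add_le c1.aestronglyMeasurable (by fun_prop) (by norm_num)).trans ?_
  refine (add_le_add h4 ((eLpNorm_add_le (by fun_prop) (by fun_prop) (by norm_num)).trans
    (add_le_add h3 h5))).trans_eq ?_
  rw [← add_assoc, ENNReal.add_thirds]

end Mollification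

/-! ### Continuous logarithms, chords of plane paths and winding loops -/

section Logarithms

open Filter Topology

lemma sub_eq_sub_of_exp_eq {X : Type*} [TopologicalSpace X] {s : Set X} (hs : IsPreconnected s)
    {a b : X → ℂ} (ha : ContinuousOn a s) (hb : ContinuousOn b s)
    (h : ∀ x ∈ s, Complex.exp (a x) = Complex.exp (b x)) {x y : X} (hx : x ∈ s) (hy : y ∈ s) :
    a x - b x = a y - b y := by
  have hd : IsDiscrete (Complex.exp ⁻¹' {1}) :=
    ⟨(Complex.isCoveringMapOn_exp 1 (by simp)).discreteTopology_fiber⟩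
  refine hs.constant_of_mapsTo hd (ha.sub hb) (fun z hz => ?_) hx hy
  simp [Complex.exp_sub, h z hz]

lemma isSimplyConnected_of_convex {E : Type*} [NormedAddCommGroup E] [NormedSpace ℝ E] {s : Set E}
    (hs : Convex ℝ s) (hne : s.Nonempty) : IsSimplyConnected s := by
  have := hs.contractibleSpace hne
  exact (inferInstance : SimplyConnectedSpace s)

lemma exists_continuous_log_plane {F : ℝ × ℝ → ℂ} (hF : Continuous F) (h0 : ∀ x, F x ≠ 0) :
    ∃ G : ℝ × ℝ → ℂ, Continuous G ∧ ∀ x, Complex.exp (G x) = F x := by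
  obtain ⟨G, hG, h⟩ := Complex.exists_continuousOn_eqOn_exp_comp
    (isSimplyConnected_of_convex convex_univ univ_nonempty) isOpen_univ
    hF.continuousOn (by simpa using fun a b => h0 (a, b))
  exact ⟨G, continuousOn_univ.1 hG, fun x => h (mem_univ x)⟩

/-- A plane path whose total displacement is `2 b` has a chord equal to `b`. If it had none, then
`α (max x y) - α (min x y) - b` would have a continuous logarithm; along the two halves of the
boundary of the triangle `x ≤ y` the argument grows by the same odd multiple of `π`, although the
function is constant on the diagonal. -/
lemma exists_chord {α : ℝ → ℂ} (hα : Continuous α) {L : ℝ} (hL : 0 ≤ L) {b : ℂ} (hb : b ≠ 0)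
    (h : α L = α 0 + 2 * b) : ∃ s t, 0 ≤ s ∧ s ≤ t ∧ t ≤ L ∧ α t = α s + b := by
  by_contra! hne
  let c : ℝ → ℝ := fun x => max 0 (min x L)
  have hc : Continuous c := by fun_prop
  have hc0 : ∀ x, 0 ≤ c x := fun x => le_max_left _ _
  have hcL : ∀ x, c x ≤ L := fun x => max_le hL (min_le_right _ _)
  have hci : ∀ x ∈ Icc 0 L, c x = x := fun x hx => by simp [c, hx.1, hx.2]
  obtain ⟨G, hG, hGF⟩ := exists_continuous_log_plane
    (F := fun p => (α (max (c p.1) (c p.2)) - α (min (c p.1) (c p.2)) - b) / b)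
    (by fun_prop) (fun p => by
      refine div_ne_zero (fun h0 => ?_) hb
      exact hne (min (c p.1) (c p.2)) (max (c p.1) (c p.2)) (le_min (hc0 _) (hc0 _))
        min_le_max (max_le (hcL _) (hcL _)) (by linear_combination h0))
  have h0m : (0 : ℝ) ∈ Icc 0 L := ⟨le_rfl, hL⟩
  have hLm : L ∈ Icc 0 L := ⟨hL, le_rfl⟩
  have hpre : IsPreconnected (Icc 0 L) := isPreconnected_Icc
  -- constant on the diagonal
  have hdiag := sub_eq_sub_of_exp_eq hpre (a := fun t => G (t, t)) (b := fun _ => G (0, 0))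
    (by fun_prop) (by fun_prop) (fun t _ => by simp only [hGF]; simp) hLm h0m
  -- the two legs differ by the factor `-1`
  have hlegs := sub_eq_sub_of_exp_eq hpre (a := fun t => G (t, L))
    (b := fun t => G (0, t) + Real.pi * Complex.I)
    (by fun_prop) (by fun_prop) (fun t ht => by
      simp only [Complex.exp_add, Complex.exp_pi_mul_I, hGF]
      rw [hci t ht, hci L hLm, hci 0 h0m, max_eq_right ht.2, min_eq_left ht.2,
        max_eq_right ht.1, min_eq_left ht.1, h]
      field_simp
      ring) h0m hLm
  have h2 : 2 * (G (0, L) - G (0, 0) - Real.pi * Complex.I) = - 2 * (Real.pi * Complex.I) := by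
    linear_combination hlegs + hdiag
  have h3 : G (0, L) = G (0, 0) := by linear_combination h2 / 2
  have h4 := hGF (0, L)
  rw [h3, hGF] at h4
  simp only [hci L hLm, hci 0 h0m, max_eq_right hL, min_eq_left hL, max_self, min_self, h] at h4
  field_simp at h4
  have h5 : b = 0 := by linear_combination -h4 / 2
  exact hb h5

/-- A loop in a simply connected open set `B` that winds around `z₀` encloses, together with `z₀`,
only points of `B`. -/
lemma connectedComponentIn_subset_of_winding {B : Set ℂ} (hB : IsOpen B) (hBc : IsSimplyConnected B)
    {α : ℝ → ℂ} (hα : Continuous α) {z₀ : ℂ}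
    (hmaps : ∀ t ∈ Icc (0 : ℝ) 1, z₀ + Complex.exp (α t) ∈ B)
    (hclosed : Complex.exp (α 1) = Complex.exp (α 0)) (hne : α 1 ≠ α 0) :
    connectedComponentIn ((fun t => z₀ + Complex.exp (α t)) '' Icc 0 1)ᶜ z₀ ⊆ B := by
  set γ : ℝ → ℂ := fun t => z₀ + Complex.exp (α t) with hγ
  have hγc : Continuous γ := by fun_prop
  have hK : IsCompact (γ '' Icc 0 1) := isCompact_Icc.image hγc
  have hz₀ : z₀ ∈ (γ '' Icc 0 1)ᶜ := by
    rintro ⟨t, -, ht⟩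
    simp [hγ] at ht
  intro p hp
  by_contra hpB
  have hWo : IsOpen (connectedComponentIn (γ '' Icc 0 1)ᶜ z₀) :=
    hK.isClosed.isOpen_compl.connectedComponentIn
  have hWp := (hWo.isConnected_iff_isPathConnected).1
    (isConnected_connectedComponentIn_iff.2 hz₀)
  obtain ⟨P, hP⟩ := hWp.joinedIn z₀ (mem_connectedComponentIn hz₀) p hp
  let c : ℝ → ℝ := fun x => max 0 (min x 1)
  have hc : Continuous c := by fun_prop
  have hcm : ∀ x, c x ∈ Icc (0 : ℝ) 1 := fun x =>
    ⟨le_max_left _ _, max_le zero_le_one (min_le_right _ _)⟩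
  have hci : ∀ x ∈ Icc (0 : ℝ) 1, c x = x := fun x hx => by simp [c, hx.1, hx.2]
  have hPW : ∀ s, P.extend s ∈ (γ '' Icc 0 1)ᶜ := fun s => by
    have : P.extend s ∈ range P := by rw [← P.extend_range]; exact mem_range_self s
    obtain ⟨u, hu⟩ := this
    rw [← hu]
    exact connectedComponentIn_subset _ _ (hP u)
  obtain ⟨G, hG, hGF⟩ := exists_continuous_log_plane
    (F := fun q => γ (c q.2) - P.extend q.1)
    (by have := P.continuous_extend; fun_prop)
    (fun q h0 => hPW q.1 ⟨c q.2, hcm _, sub_eq_zero.1 h0⟩)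
  have h0m : (0 : ℝ) ∈ Icc (0 : ℝ) 1 := by simp
  have h1m : (1 : ℝ) ∈ Icc (0 : ℝ) 1 := by simp
  have hpre : IsPreconnected (Icc (0 : ℝ) 1) := isPreconnected_Icc
  have hγ01 : γ 1 = γ 0 := by simp [hγ, hclosed]
  -- the increment of the logarithm along the loop does not depend on the point of the path
  have e1 := sub_eq_sub_of_exp_eq hpre (a := fun s => G (s, 1)) (b := fun s => G (s, 0))
    (by fun_prop) (by fun_prop) (fun s _ => by simp [hGF, hci, hγ01]) h0m h1m
  have e2 := sub_eq_sub_of_exp_eq hpre (a := fun t => G (0, t)) (b := α)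
    (by fun_prop) (by fun_prop) (fun t ht => by simp [hGF, hci t ht, hγ]) h0m h1m
  -- at the end of the path there is a logarithm on all of `B`
  obtain ⟨l, hl, hle⟩ := Complex.exists_continuousOn_eqOn_exp_comp hBc hB
    (g := fun w => w - p) (by fun_prop) (by
      rintro ⟨w, hw, hw0⟩
      exact hpB (by rwa [sub_eq_zero.1 hw0] at hw))
  have e3 := sub_eq_sub_of_exp_eq hpre (a := fun t => G (1, t)) (b := fun t => l (γ t))
    (by fun_prop) (hl.comp hγc.continuousOn hmaps)
    (fun t ht => by
      have := hle (hmaps t ht)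
      simp only [Function.comp] at this
      simp [hGF, hci t ht, hγ, this]) h0m h1m
  simp only [hγ01] at e1 e2 e3
  exact hne (by linear_combination e1 + e2 - e3)

/-- In a simply connected region, a loop around a point of `V` that avoids `closure V` separates `V`
from the complement of the region. -/
lemma mem_separatingCurves_of_winding {U V : Set ℂ} (hU : IsOpen U) (hUc : IsSimplyConnected U)
    (hV : IsPreconnected V) {z₀ : ℂ} (hz₀ : z₀ ∈ V) {α : ℝ → ℂ} (hα : Continuous α)
    (hmaps : ∀ t ∈ Icc (0 : ℝ) 1, z₀ + Complex.exp (α t) ∈ U \ closure V)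
    (hclosed : Complex.exp (α 1) = Complex.exp (α 0)) (hne : α 1 ≠ α 0) :
    (fun t => z₀ + Complex.exp (α t)) ∈ separatingCurves U V := by
  have hγc : Continuous fun t => z₀ + Complex.exp (α t) := by fun_prop
  have hK : IsCompact ((fun t => z₀ + Complex.exp (α t)) '' Icc 0 1) := isCompact_Icc.image hγc
  refine ⟨hγc.continuousOn, hmaps, fun z hz => ?_⟩
  have hVK : V ⊆ ((fun t => z₀ + Complex.exp (α t)) '' Icc 0 1)ᶜ := by
    rintro x hx ⟨t, ht, rfl⟩
    exact (hmaps t ht).2 (subset_closure hx)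
  rw [← connectedComponentIn_eq (hV.subset_connectedComponentIn hz₀ hVK hz)]
  refine ⟨?_, connectedComponentIn_subset_of_winding hU hUc hα (fun t ht => (hmaps t ht).1)
    hclosed hne⟩
  obtain ⟨R, hR⟩ := hK.isBounded.subset_ball 0
  refine Metric.isBounded_ball.subset (connectedComponentIn_subset_of_winding (B := Metric.ball 0 R)
    Metric.isOpen_ball (isSimplyConnected_of_convex (convex_ball _ _) ?_) hα
    (fun t ht => hR ⟨t, ht, rfl⟩) hclosed hne)
  exact ⟨_, hR ⟨0, by simp, rfl⟩⟩

end Logarithms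

/-! ### Arc length -/

section ArcLength

open Filter Topology
open scoped NNReal

/-- The arc length of `γ` on `[0, t]`. -/
noncomputable def arcLen (γ : ℝ → ℂ) (t : ℝ) : ℝ := variationOnFromTo γ (Icc 0 1) 0 t

variable {γ : ℝ → ℂ}

lemma arcLen_zero : arcLen γ 0 = 0 := variationOnFromTo.self _ _ _

lemma arcLen_one : arcLen γ 1 = (eVariationOn γ (Icc 0 1)).toReal := by
  rw [arcLen, variationOnFromTo.eq_of_le _ _ zero_le_one, inter_self]

lemma arcLen_sub (hγ : BoundedVariationOn γ (Icc 0 1)) {a b : ℝ} (ha : 0 ≤ a) (hab : a ≤ b)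
    (hb : b ≤ 1) : arcLen γ b - arcLen γ a = (eVariationOn γ (Icc a b)).toReal := by
  rw [arcLen, arcLen, variationOnFromTo.sub_right hγ.locallyBoundedVariationOn
    ⟨le_rfl, zero_le_one⟩ ⟨ha.trans hab, hb⟩ ⟨ha, hab.trans hb⟩, variationOnFromTo.eq_of_le _ _ hab,
    inter_eq_right.2 (Icc_subset_Icc ha hb)]

lemma monotoneOn_arcLen (hγ : BoundedVariationOn γ (Icc 0 1)) :
    MonotoneOn (arcLen γ) (Icc 0 1) :=
  variationOnFromTo.monotoneOn hγ.locallyBoundedVariationOn ⟨le_rfl, zero_le_one⟩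

lemma naturalParameterization_arcLen (hγ : BoundedVariationOn γ (Icc 0 1)) {t : ℝ}
    (ht : t ∈ Icc (0 : ℝ) 1) : naturalParameterization γ (Icc 0 1) 0 (arcLen γ t) = γ t :=
  edist_eq_zero.1 (edist_naturalParameterization_eq_zero hγ.locallyBoundedVariationOn
    ⟨le_rfl, zero_le_one⟩ ht)

lemma continuousOn_arcLen (hγ : BoundedVariationOn γ (Icc 0 1)) (hc : ContinuousOn γ (Icc 0 1)) :
    ContinuousOn (arcLen γ) (Icc 0 1) := by
  intro x hx
  have h1 := hγ.tendsto_eVariationOn_Icc_zero_left ((hc x hx).mono inter_subset_left)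
  have h2 := hγ.tendsto_eVariationOn_Icc_zero_right x ((hc x hx).mono inter_subset_left)
  have h1' := (ENNReal.tendsto_toReal ENNReal.zero_ne_top).comp h1
  have h2' := (ENNReal.tendsto_toReal ENNReal.zero_ne_top).comp h2
  have h3 := h1'.add h2'
  rw [ContinuousWithinAt, tendsto_iff_dist_tendsto_zero]
  simp only [ENNReal.toReal_zero, add_zero] at h3
  refine squeeze_zero' (Eventually.of_forall fun _ => dist_nonneg) ?_ h3
  filter_upwards [self_mem_nhdsWithin] with y hy
  simp only [Function.comp_apply]
  rcases le_total y x with h | h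
  · rw [dist_comm, Real.dist_eq, arcLen_sub hγ hy.1 h hx.2, abs_of_nonneg ENNReal.toReal_nonneg,
      inter_eq_right.2 (Icc_subset_Icc hy.1 hx.2)]
    exact le_add_of_nonneg_right ENNReal.toReal_nonneg
  · rw [Real.dist_eq, arcLen_sub hγ hx.1 h hy.2, abs_of_nonneg ENNReal.toReal_nonneg,
      inter_eq_right.2 (Icc_subset_Icc hx.1 hy.2)]
    exact le_add_of_nonneg_left ENNReal.toReal_nonneg

lemma arcLen_image (hγ : BoundedVariationOn γ (Icc 0 1)) (hc : ContinuousOn γ (Icc 0 1)) :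
    arcLen γ '' Icc 0 1 = Icc 0 (eVariationOn γ (Icc 0 1)).toReal := by
  refine Subset.antisymm ?_ ?_
  · rintro _ ⟨t, ht, rfl⟩
    rw [← arcLen_one, ← arcLen_zero (γ := γ)]
    exact ⟨monotoneOn_arcLen hγ (by simp) ht ht.1, monotoneOn_arcLen hγ ht (by simp) ht.2⟩
  · have := intermediate_value_Icc zero_le_one (continuousOn_arcLen hγ hc)
    rwa [arcLen_zero, arcLen_one] at this

lemma naturalParameterization_image (hγ : BoundedVariationOn γ (Icc 0 1))
    (hc : ContinuousOn γ (Icc 0 1)) :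
    naturalParameterization γ (Icc 0 1) 0 '' Icc 0 (eVariationOn γ (Icc 0 1)).toReal =
      γ '' Icc 0 1 := by
  rw [← arcLen_image hγ hc, image_image]
  exact image_congr fun t ht => naturalParameterization_arcLen hγ ht

lemma lipschitzOnWith_naturalParameterization (hγ : BoundedVariationOn γ (Icc 0 1))
    (hc : ContinuousOn γ (Icc 0 1)) :
    LipschitzOnWith 1 (naturalParameterization γ (Icc 0 1) 0)
      (Icc 0 (eVariationOn γ (Icc 0 1)).toReal) := by
  rw [← arcLen_image hγ hc]
  refine LipschitzOnWith.of_dist_le_mul ?_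
  rintro _ ⟨s, hs, rfl⟩ _ ⟨t, ht, rfl⟩
  wlog hst : s ≤ t generalizing s t
  · rw [dist_comm, dist_comm (arcLen γ s)]
    exact this t ht s hs (le_of_not_ge hst)
  rw [naturalParameterization_arcLen hγ hs, naturalParameterization_arcLen hγ ht, NNReal.coe_one,
    one_mul, dist_comm (arcLen γ s), Real.dist_eq, arcLen_sub hγ hs.1 hst ht.2,
    abs_of_nonneg ENNReal.toReal_nonneg, dist_edist]
  refine ENNReal.toReal_mono (ne_top_of_le_ne_top hγ (eVariationOn.mono _
    (Icc_subset_Icc hs.1 ht.2))) (eVariationOn.edist_le _ ⟨le_rfl, hst⟩ ⟨hst, le_rfl⟩)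

/-- If the speed of `γ` is at most the continuous function `m`, then `∫_γ ρ ds` is at most
`∫ m (t) ρ (γ (t)) dt`. -/
lemma arcLengthIntegral_le {m : ℝ → ℝ} (hm : Continuous m) (hm0 : ∀ t, 0 ≤ m t)
    (hlip : ∀ a b C, 0 ≤ a → b ≤ 1 → (∀ t ∈ Icc a b, m t ≤ C) → ∀ x ∈ Icc a b, ∀ y ∈ Icc a b,
      dist (γ x) (γ y) ≤ C * dist x y) (ρ : ℂ → ℝ≥0∞) :
    BoundedVariationOn γ (Icc 0 1) ∧
      arcLengthIntegral ρ γ ≤ ∫⁻ t in Icc (0 : ℝ) 1, ENNReal.ofReal (m t) * ρ (γ t) := by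
  have hvar : ∀ a b C, 0 ≤ a → a ≤ b → b ≤ 1 → (∀ t ∈ Icc a b, m t ≤ C) →
      eVariationOn γ (Icc a b) ≤ ENNReal.ofReal (C * (b - a)) := by
    intro a b C ha hab hb hC
    have hC0 : 0 ≤ C := (hm0 a).trans (hC a ⟨le_rfl, hab⟩)
    have hL : LipschitzOnWith C.toNNReal γ (Icc a b) := by
      refine LipschitzOnWith.of_dist_le_mul fun x hx y hy => ?_
      rw [Real.coe_toNNReal C hC0]
      exact hlip a b C ha hb hC x hx y hy
    have := hL.comp_eVariationOn_le (g := id) (s := Icc a b) (fun x hx => hx)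
    rw [Function.comp_id, eVariationOn_id_Icc] at this
    rw [ENNReal.ofReal_mul hC0]
    exact this
  obtain ⟨M, hM⟩ := (isCompact_Icc (a := (0 : ℝ)) (b := 1)).exists_bound_of_continuousOn
    hm.continuousOn
  have hM' : ∀ t ∈ Icc (0 : ℝ) 1, m t ≤ M := fun t ht => (le_abs_self _).trans (hM t ht)
  have hM0 : 0 ≤ M := (hm0 0).trans (hM' 0 (by simp))
  have hγ : BoundedVariationOn γ (Icc 0 1) :=
    ne_top_of_le_ne_top ENNReal.ofReal_ne_top (hvar 0 1 M le_rfl zero_le_one le_rfl hM')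
  refine ⟨hγ, ?_⟩
  have hdiff : ∀ a b C, 0 ≤ a → a ≤ b → b ≤ 1 → (∀ t ∈ Icc a b, m t ≤ C) →
      arcLen γ b - arcLen γ a ≤ C * (b - a) := by
    intro a b C ha hab hb hC
    have hC0 : 0 ≤ C := (hm0 a).trans (hC a ⟨le_rfl, hab⟩)
    rw [arcLen_sub hγ ha hab hb]
    exact ENNReal.toReal_le_of_le_ofReal (mul_nonneg hC0 (by linarith)) (hvar a b C ha hab hb hC)
  have hℓL : LipschitzOnWith M.toNNReal (arcLen γ) (Icc 0 1) := by
    refine LipschitzOnWith.of_dist_le_mul fun x hx y hy => ?_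
    rw [Real.coe_toNNReal M hM0]
    wlog hxy : y ≤ x generalizing x y
    · rw [dist_comm, dist_comm x]; exact this y hy x hx (le_of_not_ge hxy)
    rw [Real.dist_eq, Real.dist_eq, abs_of_nonneg (sub_nonneg.2 hxy),
      abs_of_nonneg (sub_nonneg.2 (monotoneOn_arcLen hγ hy hx hxy))]
    exact hdiff y x M hy.1 hxy hx.2 fun t ht => hM' t ⟨hy.1.trans ht.1, ht.2.trans hx.2⟩
  have hc : ContinuousOn γ (Icc 0 1) := by
    have hL : LipschitzOnWith M.toNNReal γ (Icc 0 1) := by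
      refine LipschitzOnWith.of_dist_le_mul fun x hx y hy => ?_
      rw [Real.coe_toNNReal M hM0]
      exact hlip 0 1 M le_rfl le_rfl hM' x hx y hy
    exact hL.continuousOn
  set D : Set ℝ := {t | DifferentiableAt ℝ (arcLen γ) t} ∩ Ioo 0 1 with hD
  have hDm : MeasurableSet D := (measurableSet_of_differentiableAt ℝ _).inter measurableSet_Ioo
  have hDsub : D ⊆ Icc 0 1 := inter_subset_right.trans Ioo_subset_Icc_self
  have hnull : volume (Icc (0 : ℝ) 1 \ D) = 0 := by
    have h1 := hℓL.ae_differentiableWithinAt (μ := volume) measurableSet_Icc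
    have h2 : ∀ᵐ t ∂(volume.restrict (Icc (0 : ℝ) 1)), t ∈ Ioo (0 : ℝ) 1 := by
      rw [← restrict_Ioo_eq_restrict_Icc]; exact ae_restrict_mem measurableSet_Ioo
    have h3 : ∀ᵐ t ∂(volume.restrict (Icc (0 : ℝ) 1)), t ∈ D := by
      filter_upwards [h1, h2] with t ht ht'
      exact ⟨ht.differentiableAt (Icc_mem_nhds ht'.1 ht'.2), ht'⟩
    rw [ae_restrict_iff' measurableSet_Icc] at h3
    refine measure_mono_null ?_ h3
    intro t ht
    simp only [mem_compl_iff, mem_ofPred_eq, not_forall]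
    exact ⟨ht.1, ht.2⟩
  have himnull : volume (arcLen γ '' (Icc 0 1 \ D)) = 0 := by
    have h := (hℓL.mono (sdiff_subset (t := D))).hausdorffMeasure_image_le (d := 1) zero_le_one
    rw [hausdorffMeasure_real, hnull, mul_zero] at h
    exact le_antisymm h zero_le
  unfold arcLengthIntegral
  calc ∫⁻ s in Icc 0 (eVariationOn γ (Icc 0 1)).toReal, ρ (naturalParameterization γ (Icc 0 1) 0 s)
      ≤ ∫⁻ s in arcLen γ '' D, ρ (naturalParameterization γ (Icc 0 1) 0 s) := by
        rw [← arcLen_image hγ hc]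
        have e : arcLen γ '' Icc 0 1 = arcLen γ '' D ∪ arcLen γ '' (Icc 0 1 \ D) := by
          rw [← image_union, union_sdiff_cancel hDsub]
        rw [e]
        refine (lintegral_union_le _ _ _).trans ?_
        rw [setLIntegral_measure_zero _ _ himnull, add_zero]
    _ = ∫⁻ t in D, ENNReal.ofReal (deriv (arcLen γ) t) *
          ρ (naturalParameterization γ (Icc 0 1) 0 (arcLen γ t)) :=
        lintegral_image_eq_lintegral_deriv_mul_of_monotoneOn hDm
          (fun t ht => ht.1.hasDerivAt.hasDerivWithinAt) ((monotoneOn_arcLen hγ).mono hDsub) _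
    _ ≤ ∫⁻ t in D, ENNReal.ofReal (m t) * ρ (γ t) := by
        refine setLIntegral_mono_ae' hDm (Eventually.of_forall fun t ht => ?_)
        rw [naturalParameterization_arcLen hγ (hDsub ht)]
        gcongr
        -- the derivative of the arc length is a limit of slopes at most `C`, for each `C > m t`
        refine le_of_forall_gt_imp_ge_of_dense fun C hC => ?_
        have hev : ∀ᶠ x in 𝓝 t, m x < C := hm.continuousAt.eventually_lt continuousAt_const hC
        obtain ⟨r, hr, hball⟩ := Metric.eventually_nhds_iff_ball.1 hev
        have hslope := hasDerivAt_iff_tendsto_slope.1 ht.1.hasDerivAt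
        have hslope' := hslope.mono_left (nhdsGT_le_nhdsNE t)
        refine le_of_tendsto hslope' ?_
        have h1 : ∀ᶠ x in 𝓝[>] t, x < 1 :=
          nhdsWithin_le_nhds (Iio_mem_nhds ht.2.2)
        have h2 : ∀ᶠ x in 𝓝[>] t, x < t + r :=
          nhdsWithin_le_nhds (Iio_mem_nhds (by linarith))
        filter_upwards [h1, h2, self_mem_nhdsWithin] with x hx1 hx2 hx3
        have hx3' : 0 < x - t := sub_pos.2 hx3
        rw [slope_def_field, div_le_iff₀ hx3']
        refine hdiff t x C ht.2.1.le (le_of_lt hx3) hx1.le fun u hu => (hball u ?_).le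
        rw [Metric.mem_ball, Real.dist_eq, abs_of_nonneg (by linarith [hu.1])]
        linarith [hu.2]
    _ ≤ ∫⁻ t in Icc (0 : ℝ) 1, ENNReal.ofReal (m t) * ρ (γ t) :=
        lintegral_mono_set hDsub

end ArcLength

/-! ### Calibrations of periodic metrics -/

section Calibration

open Filter Topology

/-- There is a path from `p` to `q`, parametrized with speed at most one, along which the integral
of `σ` is `c`. -/
def Reach (σ : ℂ → ℝ) (p q : ℂ) (c : ℝ) : Prop :=
  ∃ (α : ℝ → ℂ) (L : ℝ), LipschitzWith 1 α ∧ 0 ≤ L ∧ α 0 = p ∧ α L = q ∧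
    ∫ t in (0 : ℝ)..L, σ (α t) = c

lemma LipschitzWith.glue {α β : ℝ → ℂ} (hα : LipschitzWith 1 α) (hβ : LipschitzWith 1 β) {s : ℝ}
    (h : α s = β s) : LipschitzWith 1 (fun t => if t ≤ s then α t else β t) := by
  refine LipschitzWith.of_dist_le_mul fun x y => ?_
  wlog hxy : x ≤ y generalizing x y
  · rw [dist_comm, dist_comm x]; exact this y x (le_of_not_ge hxy)
  have ha : ∀ x y, dist (α x) (α y) ≤ dist x y := fun x y => by simpa using hα.dist_le_mul x y
  have hb : ∀ x y, dist (β x) (β y) ≤ dist x y := fun x y => by simpa using hβ.dist_le_mul x y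
  simp only [NNReal.coe_one, one_mul]
  split_ifs with h1 h2 h2
  · exact ha _ _
  · calc dist (α x) (β y) ≤ dist (α x) (α s) + dist (β s) (β y) := by
          rw [h]; exact dist_triangle _ _ _
      _ ≤ dist x s + dist s y := add_le_add (ha _ _) (hb _ _)
      _ = dist x y := by
          rw [Real.dist_eq, Real.dist_eq, Real.dist_eq, abs_of_nonpos (by linarith),
            abs_of_nonpos (by linarith), abs_of_nonpos (by linarith)]
          ring
  · exact absurd (hxy.trans h2) h1
  · exact hb _ _

variable {σ : ℂ → ℝ}

lemma Reach.trans (hσ : Continuous σ) {p q r : ℂ} {c c' : ℝ} (h : Reach σ p q c)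
    (h' : Reach σ q r c') : Reach σ p r (c + c') := by
  obtain ⟨α, L, hα, hL, h0, h1, rfl⟩ := h
  obtain ⟨β, M, hβ, hM, k0, k1, rfl⟩ := h'
  have hβ' : LipschitzWith 1 fun t => β (t - L) := by
    have := hβ.comp (LipschitzWith.id.sub (LipschitzWith.const L))
    simpa [Function.comp_def] using this
  have hg := hα.glue hβ' (s := L) (by simp [h1, k0])
  refine ⟨_, L + M, hg, by positivity, by simp [hL, h0], ?_, ?_⟩
  · rcases hM.eq_or_lt with rfl | hM'
    · simp [h1, ← k1, k0]
    · simp [hM', k1]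
  · have hc : Continuous fun t => σ (if t ≤ L then α t else β (t - L)) := hσ.comp hg.continuous
    rw [← intervalIntegral.integral_add_adjacent_intervals (hc.intervalIntegrable 0 L)
      (hc.intervalIntegrable L (L + M))]
    congr 1
    · refine intervalIntegral.integral_congr fun t ht => ?_
      rw [uIcc_of_le hL] at ht
      simp [ht.2]
    · have : ∫ t in L..(L + M), σ (if t ≤ L then α t else β (t - L)) =
          ∫ t in L..(L + M), σ (β (t - L)) := by
        refine intervalIntegral.integral_congr fun t ht => ?_
        rw [uIcc_of_le (by linarith)] at ht
        rcases ht.1.eq_or_lt with hlt | hlt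
        · simp [← hlt, h1, k0]
        · simp only [if_neg (not_le.2 hlt)]
      rw [this, intervalIntegral.integral_comp_sub_right (fun t => σ (β t)), sub_self,
        add_sub_cancel_left]

lemma Reach.shift {b : ℂ} (hb : ∀ x, σ (x + b) = σ x) {p q : ℂ} {c : ℝ} (h : Reach σ p q c) :
    Reach σ (p + b) (q + b) c := by
  obtain ⟨α, L, hα, hL, h0, h1, rfl⟩ := h
  refine ⟨fun t => α t + b, L, ?_, hL, by simp [h0], by simp [h1], by simp [hb]⟩
  simpa using hα.add (LipschitzWith.const b)

lemma Reach.nonneg (h0 : ∀ x, 0 ≤ σ x) {p q : ℂ} {c : ℝ} (h : Reach σ p q c) : 0 ≤ c := by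
  obtain ⟨α, L, hα, hL, -, -, rfl⟩ := h
  exact intervalIntegral.integral_nonneg hL fun t _ => h0 _

/-- The segment from `p` to `p + h`. -/
lemma reach_segment (p h : ℂ) :
    Reach σ p (p + h) (‖h‖ * ∫ s in (0 : ℝ)..1, σ (p + s * h)) := by
  rcases eq_or_ne h 0 with rfl | hh
  · exact ⟨fun _ => p, 0, LipschitzWith.const' p, le_rfl, rfl, by simp, by simp⟩
  have hn : ‖h‖ ≠ 0 := norm_ne_zero_iff.2 hh
  refine ⟨fun t => p + (t / ‖h‖ : ℝ) * h, ‖h‖, ?_, norm_nonneg _, by simp, by simp [hn], ?_⟩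
  · refine LipschitzWith.of_dist_le_mul fun x y => ?_
    rw [dist_add_left, dist_eq_norm, ← sub_mul, norm_mul, ← Complex.ofReal_sub, Complex.norm_real,
      ← sub_div, norm_div, norm_norm, div_mul_cancel₀ _ hn]
    simp [dist_eq_norm]
  · have := intervalIntegral.integral_comp_div (a := 0) (b := ‖h‖)
      (fun s : ℝ => σ (p + s * h)) hn
    rw [this]
    simp [hn]

/-- Cutting a path at two times. -/
lemma Reach.exists_split (hσ : Continuous σ) {α : ℝ → ℂ} (hα : LipschitzWith 1 α) {L s t : ℝ}
    (hs : 0 ≤ s) (hst : s ≤ t) (htL : t ≤ L) :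
    ∃ c₁ c₂ c₃, Reach σ (α 0) (α s) c₁ ∧ Reach σ (α s) (α t) c₂ ∧ Reach σ (α t) (α L) c₃ ∧
      c₁ + c₂ + c₃ = ∫ t in (0 : ℝ)..L, σ (α t) := by
  have hc : Continuous fun t => σ (α t) := hσ.comp hα.continuous
  have key : ∀ a b, a ≤ b → Reach σ (α a) (α b) (∫ t in a..b, σ (α t)) := by
    intro a b hab
    refine ⟨fun u => α (u + a), b - a, ?_, sub_nonneg.2 hab, by simp, by simp, ?_⟩
    · have := hα.comp (LipschitzWith.id.add (LipschitzWith.const a))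
      simpa [Function.comp_def] using this
    · rw [intervalIntegral.integral_comp_add_right (fun t => σ (α t))]; simp
  refine ⟨_, _, _, key 0 s hs, key s t hst, key t L htL, ?_⟩
  rw [intervalIntegral.integral_add_adjacent_intervals (hc.intervalIntegrable _ _)
    (hc.intervalIntegrable _ _), intervalIntegral.integral_add_adjacent_intervals
    (hc.intervalIntegrable _ _) (hc.intervalIntegrable _ _)]

/-- A path with displacement `2 b` contains a path with displacement `b`, and closing the gap
leaves another one. -/
lemma Reach.exists_halves (hσ : Continuous σ) {b : ℂ} (hb0 : b ≠ 0) (hb : ∀ x, σ (x + b) = σ x)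
    {p : ℂ} {c : ℝ} (h : Reach σ p (p + 2 * b) c) :
    ∃ x c₁ c₂, Reach σ x (x + b) c₁ ∧ Reach σ p (p + b) c₂ ∧ c₁ + c₂ = c := by
  obtain ⟨α, L, hα, hL, h0, h1, rfl⟩ := h
  obtain ⟨s, t, hs, hst, htL, hst'⟩ := exists_chord hα.continuous hL hb0 (by rw [h1, h0])
  obtain ⟨c₁, c₂, c₃, r₁, r₂, r₃, hsum⟩ := Reach.exists_split hσ hα hs hst htL
  refine ⟨α s, c₂, c₁ + c₃, by rwa [hst'] at r₂, ?_, by linarith⟩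
  have hb' : ∀ x, σ (x + -b) = σ x := fun x => by rw [← hb (x + -b), neg_add_cancel_right]
  have r₃' := r₃.shift hb'
  rw [hst', add_neg_cancel_right, h1] at r₃'
  rw [h0] at r₁
  convert r₁.trans hσ r₃' using 1
  ring

section Periodic

variable {τ : ℂ} (hτ : τ ≠ 0) (hσ : Continuous σ) (h0 : ∀ x, 0 ≤ σ x)
  (hper : ∀ x, σ (x + τ) = σ x) (hloop : ∀ p c, Reach σ p (p + τ) c → 1 ≤ c)

include hper in
lemma periodic_nsmul (n : ℕ) (x : ℂ) : σ (x + n * τ) = σ x := by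
  induction n with
  | zero => simp
  | succ k ih => rw [show x + (k + 1 : ℕ) * τ = x + k * τ + τ by push_cast; ring, hper, ih]

include hper in
lemma periodic_zsmul (n : ℤ) (x : ℂ) : σ (x + n * τ) = σ x := by
  obtain ⟨k, rfl | rfl⟩ := n.eq_nat_or_neg
  · simpa using periodic_nsmul hper k x
  · rw [← periodic_nsmul hper k]; congr 1; push_cast; ring

include hτ hσ hper hloop in
lemma two_pow_le_of_reach (m : ℕ) : ∀ p c, Reach σ p (p + (2 ^ m : ℕ) * τ) c → (2 : ℝ) ^ m ≤ c := by
  induction m with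
  | zero => intro p c h; simpa using hloop p c (by simpa using h)
  | succ k ih =>
    intro p c h
    obtain ⟨x, c₁, c₂, r₁, r₂, rfl⟩ := Reach.exists_halves hσ (b := (2 ^ k : ℕ) * τ)
      (by simp [hτ]) (periodic_nsmul hper _) (p := p) (c := c) (by
        convert h using 1; push_cast; ring)
    have := ih _ _ r₁
    have := ih _ _ r₂
    rw [pow_succ]; linarith

include hσ hper in
lemma Reach.iterate {p : ℂ} {c : ℝ} {k : ℕ} (h : Reach σ p (p + k * τ) c) (q : ℕ) :
    Reach σ p (p + (q * k : ℕ) * τ) (q * c) := by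
  induction q with
  | zero => simpa using reach_segment (σ := σ) p 0
  | succ j ih =>
    have h' := h.shift (periodic_nsmul hper (j * k))
    convert ih.trans hσ (q := p + (j * k : ℕ) * τ) (c' := c) (by
      convert h' using 1) using 1
    · push_cast; ring
    · push_cast; ring

include hτ hσ h0 hper hloop in
/-- Every path with displacement `n τ` costs at least `n`. For powers of two this follows by
halving; in general, `n`-fold displacements are repeated and filled up to a power of two. -/
lemma natCast_le_of_reach {n : ℕ} {p : ℂ} {c : ℝ} (h : Reach σ p (p + n * τ) c) : (n : ℝ) ≤ c := by
  rcases Nat.eq_zero_or_pos n with rfl | hn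
  · simpa using h.nonneg h0
  have hn' : (0 : ℝ) < n := by exact_mod_cast hn
  have h1 := reach_segment (σ := σ) p τ
  set c₁ := ‖τ‖ * ∫ s in (0 : ℝ)..1, σ (p + s * τ)
  have hc₁ : 0 ≤ c₁ := h1.nonneg h0
  have hc : 0 ≤ c := h.nonneg h0
  have key : ∀ m : ℕ, (2 : ℝ) ^ m * n ≤ 2 ^ m * c + n * (n * c₁) := by
    intro m
    set q := 2 ^ m / n
    set r := 2 ^ m % n
    have hqr : n * q + r = 2 ^ m := Nat.div_add_mod _ _
    have hr : r < n := Nat.mod_lt _ hn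
    have e1 := h.iterate hσ hper q
    have e2 := (Reach.iterate hσ hper (k := 1) (by simpa using h1) r).shift
      (periodic_nsmul hper (q * n))
    have e3 := e1.trans hσ e2
    have e4 := two_pow_le_of_reach hτ hσ hper hloop m p _ (by
      convert e3 using 1
      rw [← hqr]; push_cast; ring)
    have hq : (q : ℝ) * n ≤ 2 ^ m := by
      have : q * n ≤ 2 ^ m := by rw [← hqr, mul_comm]; exact Nat.le_add_right _ _
      exact_mod_cast this
    have hr' : (r : ℝ) ≤ n := by exact_mod_cast hr.le
    calc (2 : ℝ) ^ m * n ≤ (q * c + r * c₁) * n := by gcongr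
      _ = (q * n) * c + n * (r * c₁) := by ring
      _ ≤ 2 ^ m * c + n * (n * c₁) := by gcongr
  by_contra! hlt
  obtain ⟨m, hm⟩ := pow_unbounded_of_one_lt (n * (n * c₁) / (n - c)) (one_lt_two (α := ℝ))
  rw [div_lt_iff₀ (by linarith)] at hm
  have := key m
  nlinarith

include hτ hσ h0 hper hloop in
/-- A continuous `τ`-periodic metric for which all loops `p → p + τ` have length at least one is
calibrated by a function that increases by one under the period. -/
lemma exists_calibration : ∃ v : ℂ → ℝ, (∀ x, v (x + τ) = v x + 1) ∧
    ∀ x h, |v (x + h) - v x| ≤ ‖h‖ * ∫ s in (0 : ℝ)..1, σ (x + s * h) := by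
  let S : ℂ → Set ℝ := fun x => {y | ∃ (n : ℤ) (c : ℝ), Reach σ (n * τ) x c ∧ y = c + n}
  have hne : ∀ x, (S x).Nonempty := fun x =>
    ⟨_, 0, _, by simpa using reach_segment (σ := σ) 0 x, rfl⟩
  have hbdd : ∀ x, BddBelow (S x) := by
    intro x
    have hseg := reach_segment (σ := σ) x (-x)
    rw [add_neg_cancel] at hseg
    set c₀ := ‖-x‖ * ∫ s in (0 : ℝ)..1, σ (x + s * -x)
    refine ⟨-c₀, ?_⟩
    rintro _ ⟨n, c, hr, rfl⟩
    have hc := hr.nonneg h0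
    have hc₀ := hseg.nonneg h0
    obtain ⟨k, rfl | rfl⟩ := n.eq_nat_or_neg
    · have : (0 : ℝ) ≤ ((k : ℤ) : ℝ) := by simp
      linarith
    · have e := (hr.trans hσ hseg).shift (periodic_nsmul hper k)
      have := natCast_le_of_reach hτ hσ h0 hper hloop (n := k) (p := 0) (by
        convert e using 1
        · push_cast; ring)
      push_cast; linarith
  have hle : ∀ x h, sInf (S (x + h)) ≤ sInf (S x) + ‖h‖ * ∫ s in (0 : ℝ)..1, σ (x + s * h) := by
    intro x h
    rw [← sub_le_iff_le_add]
    refine le_csInf (hne x) ?_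
    rintro _ ⟨n, c, hr, rfl⟩
    rw [sub_le_iff_le_add]
    refine csInf_le (hbdd _) ⟨n, _, hr.trans hσ (reach_segment x h), by ring⟩
  refine ⟨fun x => sInf (S x), fun x => ?_, fun x h => ?_⟩
  · have hS : S (x + τ) = (fun y => y + 1) '' S x := by
      ext y
      constructor
      · rintro ⟨n, c, hr, rfl⟩
        have e := hr.shift (periodic_zsmul hper (-1))
        refine ⟨c + (n - 1 : ℤ), ⟨n - 1, c, ?_, rfl⟩, by push_cast; ring⟩
        convert e using 1 <;> push_cast <;> ring
      · rintro ⟨_, ⟨n, c, hr, rfl⟩, rfl⟩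
        have e := hr.shift hper
        refine ⟨n + 1, c, ?_, by push_cast; ring⟩
        convert e using 1; push_cast; ring
    simp only [hS]
    exact ((OrderIso.addRight (1 : ℝ)).map_csInf' (hne x) (hbdd x)).symm
  · rw [abs_le]
    have h1 := hle x h
    have h2 := hle (x + h) (-h)
    rw [add_neg_cancel_right, norm_neg] at h2
    have h3 : ∫ s in (0 : ℝ)..1, σ (x + h + s * -h) = ∫ s in (0 : ℝ)..1, σ (x + s * h) := by
      have := intervalIntegral.integral_comp_sub_left (a := 0) (b := 1)
        (fun s : ℝ => σ (x + s * h)) 1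
      simp only [sub_self, sub_zero] at this
      rw [← this]
      congr 1; ext s; congr 1; push_cast; ring
    rw [h3] at h2
    constructor <;> linarith

end Periodic

end Calibration

/-! ### Pointwise Lipschitz bounds -/

section Slopes

open Filter Topology

/-- The pointwise Lipschitz constant of `u` at `w` is at most `k`. -/
def SlopeLE (u : ℂ → ℝ) (k : ℝ) (w : ℂ) : Prop :=
  ∀ c > k, ∀ᶠ w' in 𝓝 w, |u w' - u w| ≤ c * ‖w' - w‖

lemma HasFDerivAt.slopeLE {u : ℂ → ℝ} {u' : ℂ →L[ℝ] ℝ} {w : ℂ} (h : HasFDerivAt u u' w) :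
    SlopeLE u ‖u'‖ w := fun c hc => by
  have := h.isLittleO.def (sub_pos.2 hc)
  filter_upwards [this] with w' hw'
  rw [Real.norm_eq_abs] at hw'
  have h1 : |u w' - u w| ≤ |u w' - u w - u' (w' - w)| + |u' (w' - w)| := by
    simpa using abs_add_le (u w' - u w - u' (w' - w)) (u' (w' - w))
  have h2 : |u' (w' - w)| ≤ ‖u'‖ * ‖w' - w‖ := u'.le_opNorm _
  calc _ ≤ (c - ‖u'‖) * ‖w' - w‖ + ‖u'‖ * ‖w' - w‖ := h1.trans (add_le_add hw' h2)
    _ = c * ‖w' - w‖ := by ring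

lemma SlopeLE.comp {u : ℂ → ℝ} {k : ℝ} (hk : 0 ≤ k) {f : ℂ → ℂ} {f' z : ℂ}
    (hu : SlopeLE u k (f z)) (hf : HasDerivAt f f' z) :
    SlopeLE (fun x => u (f x)) (k * ‖f'‖) z := fun c hc => by
  obtain ⟨δ, hδ, hδc⟩ : ∃ δ > 0, (k + δ) * (‖f'‖ + δ) < c := by
    have hcont : ContinuousAt (fun δ : ℝ => (k + δ) * (‖f'‖ + δ)) 0 := by fun_prop
    have h2 : ∀ᶠ δ in 𝓝[>] (0 : ℝ), (k + δ) * (‖f'‖ + δ) < c :=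
      nhdsWithin_le_nhds (hcont.eventually_lt continuousAt_const (by simpa using hc))
    obtain ⟨δ, h3, h4⟩ := (h2.and self_mem_nhdsWithin).exists
    exact ⟨δ, h4, h3⟩
  have h1 := hf.continuousAt.eventually (hu (k + δ) (by linarith))
  have h2 := hf.hasFDerivAt.isLittleO.def hδ
  filter_upwards [h1, h2] with x hx1 hx2
  have h3 : ‖f x - f z‖ ≤ (‖f'‖ + δ) * ‖x - z‖ := by
    have := norm_add_le (f x - f z - (x - z) * f') ((x - z) * f')
    simp only [sub_add_cancel, norm_mul] at this
    simp only [ContinuousLinearMap.toSpanSingleton_apply, smul_eq_mul] at hx2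
    linarith
  calc |u (f x) - u (f z)| ≤ (k + δ) * ‖f x - f z‖ := hx1
    _ ≤ (k + δ) * ((‖f'‖ + δ) * ‖x - z‖) := by gcongr
    _ = ((k + δ) * (‖f'‖ + δ)) * ‖x - z‖ := by ring
    _ ≤ c * ‖x - z‖ := by gcongr

lemma SlopeLE.continuousAt {u : ℂ → ℝ} {k : ℝ} {w : ℂ} (h : SlopeLE u k w) :
    ContinuousAt u w := by
  rw [ContinuousAt, tendsto_iff_dist_tendsto_zero]
  have hlim : Tendsto (fun w' => (|k| + 1) * ‖w' - w‖) (𝓝 w) (𝓝 0) := by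
    have : Continuous fun w' => (|k| + 1) * ‖w' - w‖ := by fun_prop
    simpa using this.tendsto w
  refine squeeze_zero' (Eventually.of_forall fun _ => dist_nonneg) ?_ hlim
  filter_upwards [h (|k| + 1) (by linarith [le_abs_self k])] with w' hw'
  rwa [Real.dist_eq]

/-- Integrating a pointwise Lipschitz bound along a segment. -/
lemma ofReal_abs_sub_le_of_slopeLE {u η : ℂ → ℝ} {p h : ℂ} (hη0 : ∀ z, 0 ≤ η z)
    (hs : ∀ s ∈ Icc (0 : ℝ) 1, ContinuousAt η (p + s * h) ∧ SlopeLE u (η (p + s * h)) (p + s * h)) :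
    ENNReal.ofReal |u (p + h) - u p| ≤
      ENNReal.ofReal ‖h‖ * ∫⁻ s in Icc (0 : ℝ) 1, ENNReal.ofReal (η (p + s * h)) := by
  set ψ : ℝ → ℝ := fun s => ‖h‖ * η (p + s * h) with hψ
  have hline : Continuous fun s : ℝ => p + s * h := by fun_prop
  have hη : ContinuousOn (fun s : ℝ => η (p + s * h)) (Icc 0 1) := fun s hs' =>
    ((hs s hs').1.comp (f := fun s : ℝ => p + s * h) hline.continuousAt).continuousWithinAt
  have hψc : ContinuousOn ψ (Icc 0 1) := continuousOn_const.mul hη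
  have huc : ContinuousOn (fun s : ℝ => u (p + s * h)) (Icc 0 1) := fun s hs' =>
    ((hs s hs').2.continuousAt.comp (f := fun s : ℝ => p + s * h)
      hline.continuousAt).continuousWithinAt
  -- the increment from the initial point is compared with the primitive of `ψ`
  have hint : IntervalIntegrable ψ volume 0 1 :=
    (hψc.mono (by rw [uIcc_of_le zero_le_one])).intervalIntegrable
  have key := image_le_of_liminf_slope_right_le_deriv_boundary
    (f := fun s : ℝ => |u (p + s * h) - u p|) (a := 0) (b := 1)
    (B := fun x => ∫ s in (0 : ℝ)..x, ψ s) (B' := ψ)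
    ((huc.sub continuousOn_const).abs) (by simp)
    (by
      have := intervalIntegral.continuousOn_primitive_interval (μ := volume) (a := 0) (b := 1) (f := ψ)
        (by rw [uIcc_of_le zero_le_one]; exact hψc.integrableOn_Icc)
      rwa [uIcc_of_le zero_le_one] at this)
    (fun x hx => by
      have hx' : x ∈ Icc (0 : ℝ) 1 := ⟨hx.1, hx.2.le⟩
      refine intervalIntegral.integral_hasDerivWithinAt_right
        (hint.mono_set (by
          rw [uIcc_of_le hx.1, uIcc_of_le zero_le_one]; exact Icc_subset_Icc le_rfl hx.2.le))
        (s := Ici x) (t := Ioi x) ?_ ?_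
      · refine ⟨Icc x 1, Icc_mem_nhdsGT hx.2, ?_⟩
        exact ((hψc.mono (Icc_subset_Icc hx.1 le_rfl)).aestronglyMeasurable measurableSet_Icc)
      · exact ((hψc x hx').mono_of_mem_nhdsWithin
          (mem_of_superset (Icc_mem_nhdsGT hx.2) (Icc_subset_Icc hx.1 le_rfl))))
    (fun x hx r hr => by
      have hx' : x ∈ Icc (0 : ℝ) 1 := ⟨hx.1, hx.2.le⟩
      refine Eventually.frequently ?_
      rcases eq_or_ne h 0 with rfl | hh
      · have hr0 : 0 < r := by simpa [hψ] using hr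
        refine Eventually.of_forall fun z => ?_
        simpa [slope_def_field] using hr0
      have hhn : 0 < ‖h‖ := norm_pos_iff.2 hh
      obtain ⟨r', hr1, hr2⟩ := exists_between hr
      have hc : η (p + x * h) < r' / ‖h‖ := by
        rw [lt_div_iff₀ hhn, mul_comm]; exact hr1
      have hev := (hline.tendsto x).eventually ((hs x hx').2 (r' / ‖h‖) hc)
      have hev' := hev.filter_mono (nhdsWithin_le_nhds (s := Ioi x))
      filter_upwards [hev', self_mem_nhdsWithin] with z hz hzx
      have hzx' : 0 < z - x := sub_pos.2 hzx
      rw [slope_def_field, div_lt_iff₀ hzx']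
      have e1 : ‖p + z * h - (p + x * h)‖ = (z - x) * ‖h‖ := by
        rw [add_sub_add_left_eq_sub, ← sub_mul, norm_mul, ← Complex.ofReal_sub, Complex.norm_real,
          Real.norm_eq_abs, abs_of_pos hzx']
      rw [e1] at hz
      have e2 : r' / ‖h‖ * ((z - x) * ‖h‖) = r' * (z - x) := by field_simp
      rw [e2] at hz
      have e3 := abs_sub_abs_le_abs_sub (u (p + z * h) - u p) (u (p + x * h) - u p)
      rw [sub_sub_sub_cancel_right] at e3
      nlinarith)
    (right_mem_Icc.2 zero_le_one)
  simp only [Complex.ofReal_one, one_mul] at key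
  calc ENNReal.ofReal |u (p + h) - u p| ≤ ENNReal.ofReal (∫ s in (0 : ℝ)..1, ψ s) :=
        ENNReal.ofReal_le_ofReal key
    _ = ENNReal.ofReal ‖h‖ * ENNReal.ofReal (∫ s in Icc (0 : ℝ) 1, η (p + s * h)) := by
        rw [intervalIntegral.integral_of_le zero_le_one, ← integral_Icc_eq_integral_Ioc, hψ,
          integral_const_mul, ENNReal.ofReal_mul (norm_nonneg _)]
    _ = _ := by
        rw [ofReal_integral_eq_lintegral_ofReal hη.integrableOn_Icc
          (Eventually.of_forall fun s => hη0 _)]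

lemma ae_segment_avoids {S : Set ℂ} (hS : S.Countable) (h : ℂ) :
    ∀ᵐ p : ℂ, ∀ s : ℝ, p + s * h ∉ S := by
  have hW : (Submodule.span ℝ {h} : Submodule ℝ ℂ) ≠ ⊤ := by
    intro htop
    have h1 := (finrank_span_le_card (R := ℝ) ({h} : Set ℂ)).trans_eq (Set.toFinset_card _)
    rw [Fintype.card_unique] at h1
    rw [htop, finrank_top, Complex.finrank_real_complex] at h1
    omega
  have h0 := Measure.addHaar_submodule (volume : Measure ℂ) _ hW
  have hq : ∀ q ∈ S, ∀ᵐ p : ℂ, q - p ∉ (Submodule.span ℝ {h} : Submodule ℝ ℂ) := fun q _ =>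
    (Measure.measurePreserving_sub_left (volume : Measure ℂ) q).quasiMeasurePreserving.ae
      (measure_eq_zero_iff_ae_notMem.1 h0)
  filter_upwards [(ae_ball_iff hS).2 hq] with p hp s hps
  refine hp _ hps ?_
  rw [add_sub_cancel_left, ← Complex.real_smul]
  exact Submodule.smul_mem _ _ (Submodule.mem_span_singleton_self h)

end Slopes

/-! ### Periodic functions in the logarithmic plane -/

section Strip

open Filter Topology

/-- Change of variables for an injective holomorphic map. -/
lemma lintegral_image_of_hasDerivAt {s : Set ℂ} (hs : MeasurableSet s) {f f' : ℂ → ℂ}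
    (hf : ∀ z ∈ s, HasDerivAt f (f' z) z) (hinj : InjOn f s) (F : ℂ → ℝ≥0∞) :
    ∫⁻ w in f '' s, F w = ∫⁻ z in s, ENNReal.ofReal (‖f' z‖ ^ 2) * F (f z) := by
  rw [lintegral_image_eq_lintegral_abs_det_fderiv_mul volume hs
    (fun z hz => ((hf z hz).hasFDerivAt.restrictScalars ℝ).hasFDerivWithinAt) hinj]
  refine setLIntegral_congr_fun hs fun z _ => ?_
  congr 2
  have : (ContinuousLinearMap.restrictScalars ℝ
      (ContinuousLinearMap.toSpanSingleton ℂ (f' z))).det = ‖f' z‖ ^ 2 := by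
    rw [ContinuousLinearMap.det]
    have := LinearMap.det_restrictScalars (R := ℝ)
      (f := ((ContinuousLinearMap.toSpanSingleton ℂ (f' z) : ℂ →L[ℂ] ℂ) : ℂ →ₗ[ℂ] ℂ))
    rw [Algebra.norm_complex_apply, LinearMap.det_ring] at this
    simpa [Complex.normSq_eq_norm_sq] using this
  rw [this, abs_of_nonneg (by positivity)]

/-- The period of the complex exponential. -/
noncomputable def expPeriod : ℂ := 2 * Real.pi * Complex.I

/-- A fundamental strip for the complex exponential. -/
def strip : Set ℂ := {ζ | ζ.im ∈ Ioc (-Real.pi) Real.pi}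

lemma measurableSet_strip : MeasurableSet strip := Complex.measurable_im measurableSet_Ioc

lemma expPeriod_ne_zero : expPeriod ≠ 0 := by simp [expPeriod, Real.pi_ne_zero]

lemma exp_add_expPeriod (ζ : ℂ) : Complex.exp (ζ + expPeriod) = Complex.exp ζ :=
  Complex.exp_periodic ζ

lemma lintegral_strip {F : ℂ → ℝ≥0∞} (hF : Measurable F) :
    ∫⁻ ζ in strip, F ζ = ∫⁻ x : ℝ, ∫⁻ y in Ioc (-Real.pi) Real.pi, F (x + y * Complex.I) := by
  have h := Complex.volume_preserving_equiv_real_prod.symm.setLIntegral_comp_preimage_emb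
    (Complex.measurableEquivRealProd.symm.measurableEmbedding) F strip
  have hs : Complex.measurableEquivRealProd.symm ⁻¹' strip = univ ×ˢ Ioc (-Real.pi) Real.pi := by
    ext p; simp [strip]
  rw [← h, hs, Measure.volume_eq_prod, setLIntegral_prod, Measure.restrict_univ]
  · simp only [Complex.measurableEquivRealProd_symm_apply, Complex.mk_eq_add_mul_I]
  · exact (hF.comp Complex.measurableEquivRealProd.symm.measurable).aemeasurable

lemma periodic_lintegral_add {F : ℝ → ℝ≥0∞} (hper : Function.Periodic F (2 * Real.pi)) (b : ℝ) :
    ∫⁻ y in Ioc (-Real.pi) Real.pi, F (y + b) = ∫⁻ y in Ioc (-Real.pi) Real.pi, F y := by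
  have h1 : ∫⁻ y in Ioc (-Real.pi) Real.pi, F (y + b) =
      ∫⁻ y in Ioc (-Real.pi + b) (-Real.pi + b + 2 * Real.pi), F y := by
    have := (measurePreserving_add_right (volume : Measure ℝ) b).setLIntegral_comp_preimage_emb
      (measurableEmbedding_addRight b) F (Ioc (-Real.pi + b) (-Real.pi + b + 2 * Real.pi))
    rw [← this]
    congr 2
    ext y; simp only [mem_Ioc, mem_preimage]; constructor <;> rintro ⟨_, _⟩ <;> constructor <;> linarith
  rw [h1, show Ioc (-Real.pi) Real.pi = Ioc (-Real.pi) (-Real.pi + 2 * Real.pi) by congr 1; ring]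
  refine (isAddFundamentalDomain_Ioc Real.two_pi_pos _).setLIntegral_eq
    (isAddFundamentalDomain_Ioc Real.two_pi_pos _) F ?_
  rintro ⟨g, hg⟩ x
  obtain ⟨n, rfl⟩ := AddSubgroup.mem_zmultiples_iff.1 hg
  have := hper.zsmul n x
  rw [add_comm] at this
  exact this

lemma lintegral_strip_translate {F : ℂ → ℝ≥0∞} (hF : Measurable F)
    (hper : ∀ x, F (x + expPeriod) = F x) (t : ℂ) :
    ∫⁻ ζ in strip, F (ζ + t) = ∫⁻ ζ in strip, F ζ := by
  rw [lintegral_strip hF, lintegral_strip (F := fun ζ => F (ζ + t)) (by fun_prop),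
    ← lintegral_add_right_eq_self (fun x : ℝ => ∫⁻ y in Ioc (-Real.pi) Real.pi,
      F (x + y * Complex.I)) t.re]
  congr 1; ext x
  rw [← periodic_lintegral_add (F := fun y : ℝ => F (↑(x + t.re) + y * Complex.I)) (b := t.im)]
  · congr 1; ext y
    congr 1
    apply Complex.ext <;> simp
  · intro y
    simp only
    rw [← hper (↑(x + t.re) + y * Complex.I)]
    congr 1
    simp [expPeriod]; ring

lemma lintegral_ball_le_strip {F : ℂ → ℝ≥0∞} (hF : Measurable F)
    (hper : ∀ x, F (x + expPeriod) = F x) (x : ℂ) :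
    ∫⁻ ζ in Metric.ball x 1, F ζ ≤ ∫⁻ ζ in strip, F ζ := by
  have h1 : ∫⁻ ζ in Metric.ball x 1, F ζ = ∫⁻ ζ in Metric.ball 0 1, F (ζ + x) := by
    have := (measurePreserving_add_right (volume : Measure ℂ) x).setLIntegral_comp_preimage_emb
      (measurableEmbedding_addRight x) F (Metric.ball x 1)
    rw [← this]
    congr 2
    ext y; simp [dist_eq_norm]
  rw [h1, ← lintegral_strip_translate hF hper x]
  refine lintegral_mono_set fun ζ hζ => ?_
  have h2 : |ζ.im| < 1 := (Complex.abs_im_le_norm ζ).trans_lt (by simpa using hζ)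
  have := abs_lt.1 h2
  have := Real.pi_gt_three
  exact ⟨by linarith, by linarith⟩

lemma locallyIntegrable_of_strip {f : ℂ → ℝ} (hf : Measurable f)
    (hper : ∀ x, f (x + expPeriod) = f x) (hfin : ∫⁻ ζ in strip, ENNReal.ofReal (|f ζ|) ^ 2 ≠ ∞) :
    LocallyIntegrable f := by
  intro x
  refine ⟨Metric.ball x 1, Metric.ball_mem_nhds x one_pos, ?_⟩
  have h1 := lintegral_ball_le_strip (F := fun ζ => ENNReal.ofReal (|f ζ|) ^ 2) (by fun_prop)
    (by intro x; simp only [hper]) x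
  have h2 : MemLp f 2 (volume.restrict (Metric.ball x 1)) := by
    refine ⟨hf.aestronglyMeasurable, ?_⟩
    rw [eLpNorm_lt_top_iff_lintegral_rpow_enorm_lt_top (by norm_num) (by norm_num)]
    refine lt_of_le_of_lt ?_ (h1.trans_lt hfin.lt_top)
    refine lintegral_mono fun ζ => ?_
    simp [Real.enorm_eq_ofReal_abs]
  have : IsFiniteMeasure (volume.restrict (Metric.ball x 1)) :=
    ⟨by simp⟩
  exact h2.integrable (by norm_num)

lemma ae_of_ae_strip {P : ℂ → Prop} (hP : MeasurableSet {ζ | P ζ})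
    (hper : ∀ x, P (x + expPeriod) ↔ P x) (h : ∀ᵐ ζ ∂(volume.restrict strip), P ζ) :
    ∀ᵐ ζ, P ζ := by
  refine measure_null_of_locally_null _ fun x _ => ⟨Metric.ball x 1 ∩ {ζ | P ζ}ᶜ,
    inter_mem (mem_nhdsWithin_of_mem_nhds (Metric.ball_mem_nhds x one_pos)) self_mem_nhdsWithin, ?_⟩
  have h1 := lintegral_ball_le_strip (F := {ζ | P ζ}ᶜ.indicator 1)
    (measurable_one.indicator hP.compl) (fun x => by
      by_cases hx : P x
      · simp [hx, hper]
      · simp [hx, hper]) x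
  rw [lintegral_indicator_one hP.compl, lintegral_indicator_one hP.compl,
    Measure.restrict_apply hP.compl] at h1
  rw [inter_comm]
  exact le_antisymm (h1.trans_eq h) zero_le

/-- Change of variables in the strip. -/
lemma lintegral_strip_exp_le (z₀ : ℂ) (F : ℂ → ℝ≥0∞) :
    ∫⁻ ζ in strip, ENNReal.ofReal (‖Complex.exp ζ‖ ^ 2) * F (z₀ + Complex.exp ζ) ≤ ∫⁻ w, F w := by
  rw [← lintegral_image_of_hasDerivAt (f := fun ζ => z₀ + Complex.exp ζ) (f' := Complex.exp)
    measurableSet_strip (fun z _ => (Complex.hasDerivAt_exp z).const_add z₀)]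
  · exact setLIntegral_le_lintegral _ _
  · intro x hx y hy hxy
    exact Complex.exp_inj_of_neg_pi_lt_of_le_pi hx.1 hx.2 hy.1 hy.2 (add_left_cancel hxy)

lemma sq_apply_one_add_sq_apply_I_le (f : ℂ →L[ℝ] ℝ) : f 1 ^ 2 + f Complex.I ^ 2 ≤ ‖f‖ ^ 2 := by
  have h := f.le_opNorm (⟨f 1, f Complex.I⟩ : ℂ)
  have e : f (⟨f 1, f Complex.I⟩ : ℂ) = f 1 ^ 2 + f Complex.I ^ 2 := by
    have : (⟨f 1, f Complex.I⟩ : ℂ) = f 1 • (1 : ℂ) + f Complex.I • Complex.I := by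
      apply Complex.ext <;> simp
    rw [this, map_add, map_smul, map_smul]
    simp; ring
  have hn : ‖(⟨f 1, f Complex.I⟩ : ℂ)‖ ^ 2 = f 1 ^ 2 + f Complex.I ^ 2 := by
    rw [← Complex.normSq_eq_norm_sq, Complex.normSq_mk]; ring
  rw [e, ← hn, Real.norm_eq_abs, abs_of_nonneg (by positivity)] at h
  rw [← hn]
  rcases (norm_nonneg (⟨f 1, f Complex.I⟩ : ℂ)).eq_or_lt with h0 | h0
  · rw [← h0, zero_pow two_ne_zero]; positivity
  · have : ‖(⟨f 1, f Complex.I⟩ : ℂ)‖ ≤ ‖f‖ := by nlinarith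
    gcongr

lemma abs_det_le_norm_mul_norm (f g : ℂ →L[ℝ] ℝ) :
    |f 1 * g Complex.I - f Complex.I * g 1| ≤ ‖f‖ * ‖g‖ := by
  refine abs_le_of_sq_le_sq ?_ (by positivity)
  have h1 := sq_apply_one_add_sq_apply_I_le f
  have h2 := sq_apply_one_add_sq_apply_I_le g
  calc (f 1 * g Complex.I - f Complex.I * g 1) ^ 2
      ≤ (f 1 ^ 2 + f Complex.I ^ 2) * (g 1 ^ 2 + g Complex.I ^ 2) := by
        nlinarith [sq_nonneg (f 1 * g 1 + f Complex.I * g Complex.I)]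
    _ ≤ ‖f‖ ^ 2 * ‖g‖ ^ 2 := by gcongr
    _ = (‖f‖ * ‖g‖) ^ 2 := by ring

/-- Stokes' theorem for `da ∧ db` in a period strip, where `a` decreases from one to zero from left
to right and `b` increases by one under the period. -/
lemma stokes_strip {a b : ℂ → ℝ} (ha : ContDiff ℝ 1 a) (hb : ContDiff ℝ 2 b)
    (hap : ∀ x, a (x + expPeriod) = a x) (hbp : ∀ x, b (x + expPeriod) = b x + 1) {R : ℝ}
    (hR : 0 ≤ R) (hl : ∀ ζ : ℂ, ζ.re ≤ -R → a ζ = 1) (hr : ∀ ζ : ℂ, R ≤ ζ.re → a ζ = 0) :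
    1 ≤ ∫⁻ ζ in strip, ENNReal.ofReal ‖fderiv ℝ a ζ‖ * ENNReal.ofReal ‖fderiv ℝ b ζ‖ := by
  have hda : Continuous (fderiv ℝ a) := ha.continuous_fderiv (by simp)
  have hdb1 : ContDiff ℝ 1 (fderiv ℝ b) := hb.fderiv_right (by norm_num)
  have hdb : Continuous (fderiv ℝ b) := hdb1.continuous
  have hbper : ∀ ζ, fderiv ℝ b (ζ + expPeriod) = fderiv ℝ b ζ := fun ζ => by
    rw [← fderiv_comp_add_right]
    have : (fun x => b (x + expPeriod)) = fun x => b x + 1 := funext hbp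
    rw [this, fderiv_add_const]
  -- the components of the primitive `a db`
  let A : ℂ → ℂ → ℝ := fun v ζ => a ζ * fderiv ℝ b ζ v
  have hA : ∀ v, ContDiff ℝ 1 (A v) := fun v => ha.mul (hdb1.clm_apply contDiff_const)
  have hAd : ∀ v w ζ, fderiv ℝ (A v) ζ w =
      fderiv ℝ a ζ w * fderiv ℝ b ζ v + a ζ * fderiv ℝ (fderiv ℝ b) ζ w v := by
    intro v w ζ
    have h1 : DifferentiableAt ℝ a ζ := ha.differentiable (by simp) ζ
    have h2 : DifferentiableAt ℝ (fderiv ℝ b) ζ := hdb1.differentiable (by simp) ζ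
    have h3 : HasFDerivAt (A v) _ ζ := h1.hasFDerivAt.mul (h2.hasFDerivAt.clm_apply
      (hasFDerivAt_const v ζ))
    rw [h3.fderiv]
    simp
    ring
  have hsymm : ∀ ζ, fderiv ℝ (fderiv ℝ b) ζ 1 Complex.I = fderiv ℝ (fderiv ℝ b) ζ Complex.I 1 :=
    fun ζ => (hb.contDiffAt.isSymmSndFDerivAt (by simp)) 1 Complex.I
  let ι : ℝ × ℝ →L[ℝ] ℂ := Complex.equivRealProdCLM.symm
  have hι : ∀ x y : ℝ, ι (x, y) = x + y * Complex.I := fun x y => by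
    simp [ι, Complex.equivRealProdCLM_symm_apply]
  have hAι : ∀ v p, HasFDerivAt (fun q => A v (ι q)) ((fderiv ℝ (A v) (ι p)).comp ι) p := fun v p =>
    ((hA v).differentiable (by simp) (ι p)).hasFDerivAt.comp p ι.hasFDerivAt
  have hAc : ∀ v, Continuous fun p => A v (ι p) := fun v => (hA v).continuous.comp ι.continuous
  let J : ℂ → ℝ := fun ζ =>
    fderiv ℝ a ζ 1 * fderiv ℝ b ζ Complex.I - fderiv ℝ a ζ Complex.I * fderiv ℝ b ζ 1
  have hJc : Continuous J := by fun_prop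
  have hdiv : ∀ p : ℝ × ℝ, ((fderiv ℝ (A Complex.I) (ι p)).comp ι) (1, 0) +
      (-((fderiv ℝ (A 1) (ι p)).comp ι)) (0, 1) = J (ι p) := by
    intro p
    have e1 : ι (1, 0) = 1 := by rw [hι]; simp
    have e2 : ι (0, 1) = Complex.I := by rw [hι]; simp
    simp only [ContinuousLinearMap.comp_apply, neg_apply, e1, e2, hAd, hsymm, J]
    ring
  have hmain := integral2_divergence_prod_of_hasFDerivAt_off_countable
    (fun p => A Complex.I (ι p)) (fun p => - A 1 (ι p))
    (fun p => (fderiv ℝ (A Complex.I) (ι p)).comp ι) (fun p => -((fderiv ℝ (A 1) (ι p)).comp ι))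
    (-R) (-Real.pi) R Real.pi ∅ countable_empty (hAc _).continuousOn (hAc _).neg.continuousOn
    (fun p _ => hAι _ p) (fun p _ => (hAι _ p).neg) (by
      simp only [hdiv]
      exact (hJc.comp ι.continuous).continuousOn.integrableOn_compact
        (isCompact_uIcc.prod isCompact_uIcc))
  simp only [hdiv] at hmain
  have hpi : ∀ x : ℝ, ι (x, Real.pi) = ι (x, -Real.pi) + expPeriod := fun x => by
    rw [hι, hι, expPeriod]; push_cast; ring
  have e1 : ∀ x : ℝ, A 1 (ι (x, Real.pi)) = A 1 (ι (x, -Real.pi)) := fun x => by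
    simp only [A, hpi, hap, hbper]
  have e2 : ∀ y : ℝ, A Complex.I (ι (R, y)) = 0 := fun y => by
    simp only [A]
    rw [hr _ (by simp [hι]), zero_mul]
  have e3 : ∫ y in (-Real.pi)..Real.pi, A Complex.I (ι (-R, y)) = 1 := by
    have hd : ∀ y : ℝ, HasDerivAt (fun y : ℝ => b (ι (-R, y))) (A Complex.I (ι (-R, y))) y := by
      intro y
      have h1 : HasDerivAt (fun y : ℝ => ι (-R, y)) Complex.I y := by
        simp only [hι]
        simpa using ((Complex.ofRealCLM.hasDerivAt (x := y)).mul_const Complex.I).const_add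
          (((-R : ℝ) : ℂ))
      have h2 := (hb.differentiable (by simp) (ι (-R, y))).hasFDerivAt.comp_hasDerivAt y h1
      simp only [A]
      rw [hl _ (by simp [hι]), one_mul]
      exact h2
    rw [intervalIntegral.integral_eq_sub_of_hasDerivAt (fun y _ => hd y)]
    · rw [hpi, hbp]; ring
    · exact ((hAc Complex.I).comp (by fun_prop : Continuous fun y : ℝ => (-R, y))).intervalIntegrable
        _ _
  simp only [e1, e2, e3, sub_self, intervalIntegral.integral_zero, zero_add, zero_sub] at hmain
  have hJle : ∀ ζ, ‖J ζ‖ₑ ≤ ENNReal.ofReal ‖fderiv ℝ a ζ‖ * ENNReal.ofReal ‖fderiv ℝ b ζ‖ := by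
    intro ζ
    rw [Real.enorm_eq_ofReal_abs, ← ENNReal.ofReal_mul (norm_nonneg _)]
    exact ENNReal.ofReal_le_ofReal (abs_det_le_norm_mul_norm _ _)
  calc (1 : ℝ≥0∞) = ‖∫ x in (-R)..R, ∫ y in (-Real.pi)..Real.pi, J (ι (x, y))‖ₑ := by
        rw [hmain]; simp
    _ ≤ ∫⁻ x in Ioc (-R) R, ∫⁻ y in Ioc (-Real.pi) Real.pi, ‖J (ι (x, y))‖ₑ := by
        rw [intervalIntegral.integral_of_le (by linarith)]
        refine (enorm_integral_le_lintegral_enorm _).trans (lintegral_mono fun x => ?_)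
        rw [intervalIntegral.integral_of_le (by linarith [Real.pi_pos])]
        exact enorm_integral_le_lintegral_enorm _
    _ ≤ ∫⁻ x, ∫⁻ y in Ioc (-Real.pi) Real.pi, ‖J (ι (x, y))‖ₑ := setLIntegral_le_lintegral _ _
    _ ≤ ∫⁻ x : ℝ, ∫⁻ y in Ioc (-Real.pi) Real.pi,
          ENNReal.ofReal ‖fderiv ℝ a (x + y * Complex.I)‖ *
          ENNReal.ofReal ‖fderiv ℝ b (x + y * Complex.I)‖ := by
        refine lintegral_mono fun x => lintegral_mono fun y => ?_
        rw [← hι]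
        exact hJle _
    _ = _ := by
        rw [lintegral_strip]
        have h1 := hda.measurable
        have h2 := hdb.measurable
        fun_prop

end Strip

/-! ### Potentials bound the modulus from below -/

section LowerBound

open Filter Topology

/-- `u` is a competitor for the capacity of the ring `U \ closure V`: it is one near `closure V`,
vanishes off a compact subset of `U`, and off the countable exceptional set `S` its pointwise
Lipschitz constant is at most `η`, which is continuous there. -/
structure IsPotential (U V : Set ℂ) (u η : ℂ → ℝ) (S : Set ℂ) : Prop where
  measurable_fun : Measurable u
  measurable_slope : Measurable η
  nonneg : ∀ z, 0 ≤ u z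
  le_one : ∀ z, u z ≤ 1
  slope_nonneg : ∀ z, 0 ≤ η z
  exists_one : ∃ N, IsOpen N ∧ closure V ⊆ N ∧ ∀ z ∈ N, u z = 1
  exists_zero : ∃ C, IsCompact C ∧ C ⊆ U ∧ ∀ z ∉ C, u z = 0
  countable : S.Countable
  continuousAt : ∀ z ∉ S, ContinuousAt η z
  slopeLE : ∀ z ∉ S, SlopeLE u (η z) z

lemma dist_exp_le {x y : ℂ} {C : ℝ} (hx : ‖Complex.exp x‖ ≤ C) (hy : ‖Complex.exp y‖ ≤ C) :
    dist (Complex.exp x) (Complex.exp y) ≤ C * dist x y := by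
  have hC : 0 < C := (norm_pos_iff.2 (Complex.exp_ne_zero x)).trans_le hx
  have hconv : Convex ℝ {z : ℂ | z.re ≤ Real.log C} := convex_halfSpace_re_le _
  have hre : ∀ z : ℂ, ‖Complex.exp z‖ ≤ C ↔ z ∈ {z : ℂ | z.re ≤ Real.log C} := fun z => by
    rw [Complex.norm_exp, mem_ofPred_eq, Real.le_log_iff_exp_le hC]
  rw [dist_eq_norm, dist_eq_norm]
  exact hconv.norm_image_sub_le_of_norm_deriv_le (𝕜 := ℂ)
    (fun z _ => Complex.differentiable_exp z)
    (fun z hz => by rw [Complex.deriv_exp]; exact (hre z).2 hz) ((hre y).1 hy) ((hre x).1 hx)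

/-- An admissible density gives length at least one to the exponential of each path that increases
by the period. -/
lemma one_le_lintegral_path {U V : Set ℂ} (hU : IsOpen U) (hUc : IsSimplyConnected U)
    (hV : IsPreconnected V) {z₀ : ℂ} (hz₀ : z₀ ∈ V) {ρ : ℂ → ℝ≥0∞}
    (hρ : IsAdmissible ρ (separatingCurves U V)) {α : ℝ → ℂ} {L : ℝ} (hα : LipschitzWith 1 α)
    (hL : 0 ≤ L) (hper : α L = α 0 + expPeriod)
    (hmaps : ∀ t ∈ Icc 0 L, z₀ + Complex.exp (α t) ∈ U \ closure V) :
    1 ≤ ∫⁻ t in Icc 0 L, ENNReal.ofReal ‖Complex.exp (α t)‖ * ρ (z₀ + Complex.exp (α t)) := by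
  have hL0 : 0 < L := by
    rcases hL.eq_or_lt with rfl | h
    · exact absurd (left_eq_add.1 hper) expPeriod_ne_zero
    · exact h
  have hβ : ∀ t ∈ Icc (0 : ℝ) 1, L * t ∈ Icc 0 L := fun t ht =>
    ⟨mul_nonneg hL ht.1, mul_le_of_le_one_right hL ht.2⟩
  have hαc := hα.continuous
  have hmem := mem_separatingCurves_of_winding hU hUc hV hz₀ (α := fun t => α (L * t))
    (by fun_prop) (fun t ht => hmaps _ (hβ t ht)) (by simp [hper, exp_add_expPeriod])
    (by simp [hper, expPeriod_ne_zero])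
  obtain ⟨hbv, hle⟩ := arcLengthIntegral_le (γ := fun t => z₀ + Complex.exp (α (L * t)))
    (m := fun t => L * ‖Complex.exp (α (L * t))‖) (by fun_prop) (fun t => by positivity)
    (fun a b C ha hb hC x hx y hy => by
      have h1 : ∀ t ∈ Icc a b, ‖Complex.exp (α (L * t))‖ ≤ C / L := fun t ht => by
        rw [le_div_iff₀ hL0, mul_comm]; exact hC t ht
      have hCL : 0 ≤ C / L := (norm_nonneg _).trans (h1 x hx)
      rw [dist_add_left]
      refine (dist_exp_le (h1 x hx) (h1 y hy)).trans ?_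
      have h2 : dist (α (L * x)) (α (L * y)) ≤ L * dist x y := by
        have := hα.dist_le_mul (L * x) (L * y)
        rwa [NNReal.coe_one, one_mul, Real.dist_eq, ← mul_sub, abs_mul, abs_of_pos hL0,
          ← Real.dist_eq] at this
      calc C / L * dist (α (L * x)) (α (L * y)) ≤ C / L * (L * dist x y) := by gcongr
        _ = C * dist x y := by field_simp) ρ
  refine (hρ.2 _ hmem hbv).trans (hle.trans_eq ?_)
  have himg : (fun t : ℝ => L * t) '' Icc 0 1 = Icc 0 L := by
    rw [image_mul_left_Icc hL zero_le_one]; simp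
  rw [← himg, lintegral_image_eq_lintegral_deriv_mul_of_monotoneOn (f' := fun _ => L)
    measurableSet_Icc (fun t _ => by
      simpa using ((hasDerivAt_id t).const_mul L).hasDerivWithinAt)
    (fun x _ y _ hxy => mul_le_mul_of_nonneg_left hxy hL)]
  congr 1; ext t
  rw [ENNReal.ofReal_mul hL, mul_assoc]

lemma one_le_lintegral_lmoll_path (φ : ContDiffBump (0 : ℂ)) {F : ℂ → ℝ≥0∞} (hF : Measurable F)
    {α : ℝ → ℂ} (hα : Continuous α) {L : ℝ}
    (h : ∀ v : ℂ, ‖v‖ < φ.rOut → 1 ≤ ∫⁻ t in Icc 0 L, F (α t - v)) :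
    1 ≤ ∫⁻ t in Icc 0 L, lmoll φ F (α t) := by
  have hαm := hα.measurable
  unfold lmoll
  rw [lintegral_lintegral_swap (by fun_prop), ← lintegral_bumpWeight φ]
  refine lintegral_mono fun v => ?_
  rw [lintegral_const_mul _ (by fun_prop)]
  rcases le_or_gt φ.rOut ‖v‖ with hv | hv
  · simp [bumpWeight, normed_eq_zero_of_rOut_le φ hv]
  · exact le_mul_of_one_le_right' (h v hv)

/-- Adding a large multiple of a function that is one at distance at least `3 ε` from `T` makes all
loops at least as long as those that stay within distance `4 ε` of `T`. -/
lemma one_le_of_reach_add {f : ℂ → ℝ} (hf : Continuous f) (hf0 : ∀ x, 0 ≤ f x) {T : Set ℂ} {ε : ℝ}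
    (hε : 0 < ε) {τ : ℂ} (hτ : 2 * ε ≤ ‖τ‖) {χ : ℂ → ℝ} (hχ : Continuous χ) (hχ0 : ∀ x, 0 ≤ χ x)
    (hχ1 : ∀ x, 3 * ε ≤ Metric.infDist x T → χ x = 1)
    (hloop : ∀ (α : ℝ → ℂ) (L : ℝ), LipschitzWith 1 α → 0 ≤ L → α L = α 0 + τ →
      (∀ t ∈ Icc 0 L, Metric.infDist (α t) T < 4 * ε) → 1 ≤ ∫ t in (0 : ℝ)..L, f (α t))
    {p : ℂ} {c : ℝ} (h : Reach (fun x => f x + ε⁻¹ * χ x) p (p + τ) c) : 1 ≤ c := by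
  obtain ⟨α, L, hα, hL, h0, h1, rfl⟩ := h
  have hαc := hα.continuous
  have hεi : 0 < ε⁻¹ := inv_pos.2 hε
  have hint : ∀ {k : ℂ → ℝ}, Continuous k → ∀ a b, IntervalIntegrable (fun t => k (α t)) volume a b :=
    fun hk a b => (hk.comp hαc).intervalIntegrable a b
  have hsum : Continuous fun x => f x + ε⁻¹ * χ x := by fun_prop
  by_cases hA : ∀ t ∈ Icc 0 L, Metric.infDist (α t) T < 4 * ε
  · refine (hloop α L hα hL (by rw [h1, h0]) hA).trans ?_
    refine intervalIntegral.integral_mono_on hL (hint hf _ _) (hint hsum _ _) fun t _ => ?_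
    have := hχ0 (α t)
    have : 0 ≤ ε⁻¹ * χ (α t) := by positivity
    linarith
  · push Not at hA
    obtain ⟨t', ht', hd⟩ := hA
    have hLτ : 2 * ε ≤ L := by
      have := hα.dist_le_mul L 0
      rw [h1, h0, dist_eq_norm, add_sub_cancel_left, NNReal.coe_one, one_mul, Real.dist_eq, sub_zero,
        abs_of_nonneg hL] at this
      linarith
    obtain ⟨a, ha0, haL, ha⟩ : ∃ a, 0 ≤ a ∧ a + ε ≤ L ∧ ∀ t ∈ Icc a (a + ε), |t - t'| ≤ ε := by
      rcases le_total (t' + ε) L with hle | hle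
      · exact ⟨t', ht'.1, hle, fun t ht => abs_le.2 ⟨by linarith [ht.1], by linarith [ht.2]⟩⟩
      · exact ⟨t' - ε, by linarith, by linarith [ht'.2],
          fun t ht => abs_le.2 ⟨by linarith [ht.1], by linarith [ht.2]⟩⟩
    have hone : ∀ t ∈ Icc a (a + ε), χ (α t) = 1 := fun t ht => hχ1 _ (by
      have h2 := (Metric.lipschitz_infDist_pt T).dist_le_mul (α t') (α t)
      have h3 := hα.dist_le_mul t' t
      rw [NNReal.coe_one, one_mul] at h2 h3
      rw [Real.dist_eq, abs_sub_comm t' t] at h3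
      have h4 := (abs_le.1 ((Real.dist_eq _ _).symm.le.trans (h2.trans (h3.trans (ha t ht))))).2
      linarith)
    calc (1 : ℝ) = ∫ t in a..(a + ε), ε⁻¹ := by simp [hε.ne']
      _ ≤ ∫ t in a..(a + ε), (f (α t) + ε⁻¹ * χ (α t)) := by
          refine intervalIntegral.integral_mono_on (by linarith) (by simp) (hint hsum _ _)
            fun t ht => ?_
          rw [hone t ht, mul_one]
          linarith [hf0 (α t)]
      _ ≤ ∫ t in (0 : ℝ)..L, (f (α t) + ε⁻¹ * χ (α t)) := by
          refine intervalIntegral.integral_mono_interval ha0 (by linarith) haL ?_ (hint hsum _ _)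
          refine Eventually.of_forall fun t => ?_
          have := hf0 (α t)
          have := hχ0 (α t)
          simp only [Pi.zero_apply]
          positivity

lemma lintegral_strip_lmoll_le (φ : ContDiffBump (0 : ℂ)) {F : ℂ → ℝ≥0∞} (hF : Measurable F)
    (hper : ∀ x, F (x + expPeriod) = F x) :
    ∫⁻ ζ in strip, lmoll φ F ζ ^ 2 ≤ ∫⁻ ζ in strip, F ζ ^ 2 := by
  refine lintegral_lmoll_sq_le φ hF fun t => ?_
  have := lintegral_strip_translate (F := fun ζ => F ζ ^ 2) (by fun_prop)
    (fun x => by simp only [hper]) (-t)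
  simp only [← sub_eq_add_neg] at this
  exact this.le

lemma lmoll_periodic (φ : ContDiffBump (0 : ℂ)) {F : ℂ → ℝ≥0∞} {τ : ℂ}
    (hper : ∀ x, F (x + τ) = F x) (x : ℂ) : lmoll φ F (x + τ) = lmoll φ F x := by
  unfold lmoll
  congr 1; ext t
  rw [add_sub_right_comm, hper]

lemma moll_periodic (φ : ContDiffBump (0 : ℂ)) {f : ℂ → ℝ} {τ : ℂ}
    (hper : ∀ x, f (x + τ) = f x) (x : ℂ) : moll φ f (x + τ) = moll φ f x := by
  unfold moll
  congr 1; ext t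
  rw [add_sub_right_comm, hper]

lemma moll_add_one (φ : ContDiffBump (0 : ℂ)) {f : ℂ → ℝ} (hf : LocallyIntegrable f) {τ : ℂ}
    (hper : ∀ x, f (x + τ) = f x + 1) (x : ℂ) : moll φ f (x + τ) = moll φ f x + 1 := by
  have : moll φ f (x + τ) = ∫ t, (φ.normed volume t * f (x - t) + φ.normed volume t) := by
    unfold moll
    congr 1; ext t
    rw [add_sub_right_comm, hper]; ring
  rw [this, integral_add (integrable_moll_integrand φ hf x) φ.integrable_normed, φ.integral_normed,
    moll]

lemma lintegral_mul_sq_le {X : Type*} [MeasurableSpace X] {μ : Measure X} {f g : X → ℝ≥0∞}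
    (hf : AEMeasurable f μ) (hg : AEMeasurable g μ) :
    (∫⁻ x, f x * g x ∂μ) ^ 2 ≤ (∫⁻ x, f x ^ 2 ∂μ) * ∫⁻ x, g x ^ 2 ∂μ := by
  have h := ENNReal.lintegral_mul_le_Lp_mul_Lq μ (p := 2) (q := 2)
    (by constructor <;> norm_num) hf hg
  have e : ∀ a : ℝ≥0∞, (a ^ (1 / 2 : ℝ)) ^ 2 = a := fun a => by
    rw [← ENNReal.rpow_natCast, ← ENNReal.rpow_mul]; norm_num
  calc _ ≤ ((∫⁻ x, f x ^ (2 : ℝ) ∂μ) ^ (1 / 2 : ℝ) * (∫⁻ x, g x ^ (2 : ℝ) ∂μ) ^ (1 / 2 : ℝ)) ^ 2 := by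
        gcongr; exact h
    _ = _ := by rw [mul_pow, e, e]; simp

end LowerBound

/-! ### The length-area inequality for potentials and admissible densities -/

section LengthArea

open Filter Topology

/-- In the logarithmic plane, the preimage of a compact set `T` has a neighbourhood of uniform width
that lies over a given neighbourhood of `T`. -/
lemma exists_tube {T A : Set ℂ} (hT : IsCompact T) (hA : IsOpen A) (hTA : T ⊆ A) (z₀ : ℂ) :
    ∃ ε > 0, ε ≤ 1 / 5 ∧ ∀ ζ ζ' : ℂ, z₀ + Complex.exp ζ ∈ T → ‖ζ' - ζ‖ ≤ 5 * ε →
      z₀ + Complex.exp ζ' ∈ A := by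
  obtain ⟨δ, hδ, hδA⟩ := hT.exists_cthickening_subset_open hA hTA
  obtain ⟨M, hM⟩ := hT.exists_bound_of_continuousOn (f := fun w => w - z₀) (by fun_prop)
  set M' := max M 1 with hM'
  have hM1 : 0 < M' := lt_max_of_lt_right one_pos
  refine ⟨min (1 / 5) (δ / (10 * M')), by positivity, min_le_left _ _, fun ζ ζ' hζ hd => hδA ?_⟩
  have h1 : ‖Complex.exp ζ‖ ≤ M' := by
    have := hM _ hζ
    rw [add_sub_cancel_left] at this
    exact this.trans (le_max_left _ _)
  have h2 : ‖ζ' - ζ‖ ≤ 1 := hd.trans (by linarith [min_le_left (1 / 5) (δ / (10 * M'))])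
  have h3 : ‖ζ' - ζ‖ ≤ δ / (2 * M') := by
    refine hd.trans ?_
    calc 5 * min (1 / 5) (δ / (10 * M')) ≤ 5 * (δ / (10 * M')) := by gcongr; exact min_le_right _ _
      _ = δ / (2 * M') := by field_simp; ring
  refine Metric.mem_cthickening_of_dist_le _ _ _ _ hζ ?_
  rw [dist_add_left, dist_eq_norm]
  have e : Complex.exp ζ' - Complex.exp ζ = Complex.exp ζ * (Complex.exp (ζ' - ζ) - 1) := by
    rw [mul_sub, ← Complex.exp_add, mul_one]; congr 2; ring
  rw [e, norm_mul]
  calc ‖Complex.exp ζ‖ * ‖Complex.exp (ζ' - ζ) - 1‖ ≤ M' * (2 * (δ / (2 * M'))) := by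
        gcongr
        exact (Complex.norm_exp_sub_one_le h2).trans (by gcongr)
    _ = δ := by field_simp

lemma countable_preimage_exp {S : Set ℂ} (hS : S.Countable) (z₀ : ℂ) :
    ((fun ζ => z₀ + Complex.exp ζ) ⁻¹' S).Countable := by
  have : (fun ζ => z₀ + Complex.exp ζ) ⁻¹' S = ⋃ w ∈ S, {ζ | z₀ + Complex.exp ζ = w} := by
    ext; simp
  rw [this]
  refine hS.biUnion fun w _ => ?_
  rcases eq_empty_or_nonempty {ζ : ℂ | z₀ + Complex.exp ζ = w} with h | ⟨ζ₀, h₀⟩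
  · rw [h]; exact countable_empty
  · refine (countable_range fun n : ℤ => ζ₀ + n * (2 * Real.pi * Complex.I)).mono fun ζ hζ => ?_
    have : Complex.exp ζ = Complex.exp ζ₀ := add_left_cancel (a := z₀) (hζ.trans h₀.symm)
    obtain ⟨n, hn⟩ := Complex.exp_eq_exp_iff_exists_int.1 this
    exact ⟨n, hn.symm⟩

lemma measurable_comp_exp {F : ℂ → ℝ≥0∞} (hF : Measurable F) (z₀ : ℂ) :
    Measurable fun ζ => ENNReal.ofReal ‖Complex.exp ζ‖ * F (z₀ + Complex.exp ζ) := by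
  have : Measurable fun ζ => z₀ + Complex.exp ζ :=
    (continuous_const.add Complex.continuous_exp).measurable
  have h2 := hF.comp this
  exact (Complex.continuous_exp.norm.measurable.ennreal_ofReal).mul h2

lemma lintegral_strip_sq_exp_le (z₀ : ℂ) (F : ℂ → ℝ≥0∞) :
    ∫⁻ ζ in strip, (ENNReal.ofReal ‖Complex.exp ζ‖ * F (z₀ + Complex.exp ζ)) ^ 2 ≤
      ∫⁻ w, F w ^ 2 := by
  refine le_trans (le_of_eq ?_) (lintegral_strip_exp_le z₀ fun w => F w ^ 2)
  congr 1; ext ζ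
  rw [mul_pow, ENNReal.ofReal_pow (norm_nonneg _)]

/-- A periodic square integrable density is locally integrable, and its mollification can be
computed in `ℝ`. -/
lemma locallyIntegrable_toReal_and_ofReal_moll {F : ℂ → ℝ≥0∞} (hF : Measurable F)
    (hper : ∀ x, F (x + expPeriod) = F x) (hfin : ∫⁻ ζ in strip, F ζ ^ 2 ≠ ∞) :
    LocallyIntegrable (fun ζ => (F ζ).toReal) ∧ ∀ (φ : ContDiffBump (0 : ℂ)) x,
      ENNReal.ofReal (moll φ (fun ζ => (F ζ).toReal) x) = lmoll φ F x := by
  have hae : ∀ᵐ ζ, F ζ < ∞ := by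
    refine ae_of_ae_strip (measurableSet_lt hF measurable_const) (fun x => by rw [hper]) ?_
    filter_upwards [ae_lt_top (hF.pow_const 2) hfin] with ζ hζ
    exact (ENNReal.pow_lt_top_iff (n := 2)).1 hζ |>.resolve_right (by norm_num)
  have hli : LocallyIntegrable (fun ζ => (F ζ).toReal) := by
    refine locallyIntegrable_of_strip hF.ennreal_toReal (fun x => by simp only [hper]) ?_
    refine ne_top_of_le_ne_top hfin (lintegral_mono fun ζ => ?_)
    rw [abs_of_nonneg ENNReal.toReal_nonneg]
    gcongr
    exact ENNReal.ofReal_toReal_le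
  refine ⟨hli, fun φ x => ?_⟩
  rw [ofReal_moll φ hli (fun _ => ENNReal.toReal_nonneg)]
  refine lintegral_congr_ae ?_
  filter_upwards [(Measure.measurePreserving_sub_left (volume : Measure ℂ)
    x).quasiMeasurePreserving.ae hae] with t ht
  rw [ENNReal.ofReal_toReal ht.ne]

/-- A function that is one on `N` and zero off `C` is constant on the balls whose image misses
`C \ N`. -/
lemma eqOn_ball_of_disjoint {u : ℂ → ℝ} {N C : Set ℂ} (hN : IsOpen N) (hC : IsCompact C)
    (h1 : ∀ z ∈ N, u z = 1) (h0 : ∀ z ∉ C, u z = 0) {e : ℂ → ℂ} (he : Continuous e) {ζ : ℂ} {r : ℝ}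
    (hd : ∀ x ∈ Metric.ball ζ r, e x ∉ C \ N) : ∃ c, ∀ x ∈ Metric.ball ζ r, u (e x) = c := by
  have hconn : IsPreconnected (e '' Metric.ball ζ r) :=
    (convex_ball ζ r).isPreconnected.image e he.continuousOn
  have hdisj : Disjoint N Cᶜ := Set.disjoint_left.2 fun z hz hz' => by
    have := h1 z hz; rw [h0 z hz'] at this; exact one_ne_zero this.symm
  rcases hconn.subset_or_subset hN hC.isClosed.isOpen_compl hdisj (by
    rintro _ ⟨x, hx, rfl⟩
    by_cases hN' : e x ∈ N
    · exact Or.inl hN'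
    · exact Or.inr fun hC' => hd x hx ⟨hC', hN'⟩) with h | h
  · exact ⟨1, fun x hx => h1 _ (h (mem_image_of_mem e hx))⟩
  · exact ⟨0, fun x hx => h0 _ (h (mem_image_of_mem e hx))⟩

lemma continuous_of_abs_sub_le_segment {v σ : ℂ → ℝ} (hσ : Continuous σ)
    (h : ∀ x y, |v (x + y) - v x| ≤ ‖y‖ * ∫ s in (0 : ℝ)..1, σ (x + s * y)) : Continuous v := by
  refine continuous_iff_continuousAt.2 fun x => ?_
  rw [ContinuousAt, tendsto_iff_dist_tendsto_zero]
  have hc : Continuous fun x' : ℂ => ‖x' - x‖ * ∫ s in (0 : ℝ)..1, σ (x + s * (x' - x)) := by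
    refine Continuous.mul (by fun_prop) ?_
    exact intervalIntegral.continuous_parametric_intervalIntegral_of_continuous' (by fun_prop) _ _
  refine squeeze_zero (fun _ => dist_nonneg) (fun x' => ?_) (by simpa using hc.tendsto x)
  have := h x (x' - x)
  rwa [add_sub_cancel, ← Real.dist_eq] at this

/-- The increments of a potential in the logarithmic plane, along almost every translate of a
segment. -/
lemma IsPotential.ofReal_abs_sub_le {U V : Set ℂ} {u η : ℂ → ℝ} {S : Set ℂ}
    (hu : IsPotential U V u η S) (z₀ h : ℂ) :
    ∀ᵐ p : ℂ, ENNReal.ofReal |u (z₀ + Complex.exp (p + h)) - u (z₀ + Complex.exp p)| ≤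
      ENNReal.ofReal ‖h‖ * ∫⁻ s in Icc (0 : ℝ) 1,
        ENNReal.ofReal (η (z₀ + Complex.exp (p + s * h)) * ‖Complex.exp (p + s * h)‖) := by
  filter_upwards [ae_segment_avoids (countable_preimage_exp hu.countable z₀) h] with p hp
  refine ofReal_abs_sub_le_of_slopeLE (u := fun ζ => u (z₀ + Complex.exp ζ))
    (η := fun ζ => η (z₀ + Complex.exp ζ) * ‖Complex.exp ζ‖)
    (fun z => mul_nonneg (hu.slope_nonneg _) (norm_nonneg _)) fun s _ => ⟨?_, ?_⟩
  · refine ContinuousAt.mul ?_ Complex.continuous_exp.norm.continuousAt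
    exact (hu.continuousAt _ (hp s)).comp (f := fun ζ => z₀ + Complex.exp ζ)
      (continuous_const.add Complex.continuous_exp).continuousAt
  · exact SlopeLE.comp (f := fun ζ => z₀ + Complex.exp ζ) (hu.slope_nonneg _)
      (hu.slopeLE _ (hp s)) ((Complex.hasDerivAt_exp _).const_add z₀)

/-- The set where a potential may vary lies in a compact subset of the ring, is disjoint from
`closure V`, and is not empty. -/
lemma IsPotential.exists_sets {U V : Set ℂ} {u η : ℂ → ℝ} {S : Set ℂ}
    (hu : IsPotential U V u η S) {z₀ : ℂ} (hz₀ : z₀ ∈ V) :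
    ∃ N C : Set ℂ, IsOpen N ∧ IsCompact C ∧ (∀ z ∈ N, u z = 1) ∧ (∀ z ∉ C, u z = 0) ∧ z₀ ∈ N ∧
      IsCompact (C \ N) ∧ C \ N ⊆ U \ closure V ∧ (C \ N).Nonempty := by
  obtain ⟨N, hN, hVN, h1⟩ := hu.exists_one
  obtain ⟨C, hC, hCU, h0⟩ := hu.exists_zero
  have hz₀N : z₀ ∈ N := hVN (subset_closure hz₀)
  refine ⟨N, C, hN, hC, h1, h0, hz₀N, hC.diff hN, fun z hz => ⟨hCU hz.1, fun h => hz.2 (hVN h)⟩, ?_⟩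
  by_contra hemp
  rw [not_nonempty_iff_eq_empty] at hemp
  obtain ⟨M, hM⟩ := hC.isBounded.subset_ball z₀
  have hM0 : z₀ + ((|M| + 1 : ℝ) : ℂ) ∉ C := fun h => by
    have := hM h
    rw [Metric.mem_ball, dist_self_add_left, Complex.norm_real, Real.norm_eq_abs,
      abs_of_nonneg (by positivity)] at this
    linarith [le_abs_self M]
  obtain ⟨c, hc⟩ := eqOn_ball_of_disjoint (e := id) (ζ := z₀) (r := |M| + 2) hN hC h1 h0
    continuous_id (fun x _ h => by rw [id, hemp] at h; exact h)
  have e1 := hc z₀ (Metric.mem_ball_self (by positivity))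
  have e2 := hc (z₀ + ((|M| + 1 : ℝ) : ℂ)) (by
    rw [Metric.mem_ball, dist_self_add_left, Complex.norm_real, Real.norm_eq_abs,
      abs_of_nonneg (by positivity)]; linarith)
  rw [id, h1 _ hz₀N] at e1
  rw [id, h0 _ hM0] at e2
  linarith

/-- The mollified potential in the logarithmic plane. -/
lemma IsPotential.moll_exp {U V : Set ℂ} {u η : ℂ → ℝ} {S : Set ℂ}
    (hu : IsPotential U V u η S) (hfin : ∫⁻ z, ENNReal.ofReal (η z) ^ 2 ≠ ∞) {z₀ : ℂ}
    {N C : Set ℂ} (hN : IsOpen N) (hC : IsCompact C) (h1 : ∀ z ∈ N, u z = 1)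
    (h0 : ∀ z ∉ C, u z = 0) (hz₀ : z₀ ∈ N) (φ : ContDiffBump (0 : ℂ)) (hφ : φ.rOut ≤ 1) :
    ∃ a : ℂ → ℝ, ContDiff ℝ 1 a ∧ (∀ x, a (x + expPeriod) = a x) ∧
      (∃ R, 0 ≤ R ∧ (∀ ζ : ℂ, ζ.re ≤ -R → a ζ = 1) ∧ ∀ ζ : ℂ, R ≤ ζ.re → a ζ = 0) ∧
      (∀ ζ, ENNReal.ofReal ‖fderiv ℝ a ζ‖ ≤ lmoll φ (fun ζ =>
        ENNReal.ofReal ‖Complex.exp ζ‖ * ENNReal.ofReal (η (z₀ + Complex.exp ζ))) ζ) ∧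
      ∀ ζ, φ.rOut < Metric.infDist ζ {ζ | z₀ + Complex.exp ζ ∈ C \ N} → fderiv ℝ a ζ = 0 := by
  set e : ℂ → ℂ := fun ζ => z₀ + Complex.exp ζ with he
  have hec : Continuous e := continuous_const.add Complex.continuous_exp
  have hep : ∀ x, e (x + expPeriod) = e x := fun x => by simp only [he, exp_add_expPeriod]
  have huli : LocallyIntegrable fun ζ => u (e ζ) := by
    refine (locallyIntegrable_const (1 : ℝ)).mono
      (hu.measurable_fun.comp hec.measurable).aestronglyMeasurable
      (Eventually.of_forall fun x => ?_)
    rw [Real.norm_eq_abs, abs_of_nonneg (hu.nonneg _)]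
    simpa using hu.le_one _
  set G : ℂ → ℝ := fun ζ => η (e ζ) * ‖Complex.exp ζ‖ with hG
  have hG0 : ∀ x, 0 ≤ G x := fun x => mul_nonneg (hu.slope_nonneg _) (norm_nonneg _)
  have hGm : Measurable G :=
    (hu.measurable_slope.comp hec.measurable).mul Complex.continuous_exp.norm.measurable
  have hGe : ∀ ζ, ENNReal.ofReal (G ζ) =
      ENNReal.ofReal ‖Complex.exp ζ‖ * ENNReal.ofReal (η (z₀ + Complex.exp ζ)) := fun ζ => by
    simp only [hG, he]
    rw [mul_comm, ENNReal.ofReal_mul (norm_nonneg _)]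
  have hGli : LocallyIntegrable G := by
    refine locallyIntegrable_of_strip hGm (fun x => by simp only [hG, hep, exp_add_expPeriod]) ?_
    refine ne_top_of_le_ne_top hfin ?_
    simp only [abs_of_nonneg (hG0 _), hGe]
    exact lintegral_strip_sq_exp_le z₀ _
  refine ⟨moll φ fun ζ => u (e ζ), contDiff_moll φ huli 1, moll_periodic φ fun x => by rw [hep], ?_,
    fun ζ => ?_, fun ζ hζ => ?_⟩
  · obtain ⟨d, hd, hdN⟩ := Metric.isOpen_iff.1 hN z₀ hz₀
    obtain ⟨M, hM⟩ := hC.isBounded.subset_ball z₀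
    have hr : ∀ ζ y : ℂ, ‖ζ - y‖ < φ.rOut → |ζ.re - y.re| < 1 := fun ζ y h =>
      (Complex.abs_re_le_norm (ζ - y)).trans_lt (h.trans_le hφ)
    refine ⟨|Real.log d| + |Real.log (max M 1)| + 1, by positivity, fun ζ hζ => ?_, fun ζ hζ => ?_⟩
    · rw [moll_congr φ (g := fun _ => 1), moll_const]
      intro y hy
      refine h1 _ (hdN ?_)
      simp only [he]
      rw [Metric.mem_ball, dist_self_add_left, Complex.norm_exp, ← Real.lt_log_iff_exp_lt hd]
      have := abs_lt.1 (hr ζ y hy)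
      have := neg_abs_le (Real.log d)
      have := abs_nonneg (Real.log (max M 1))
      linarith
    · rw [moll_congr φ (g := fun _ => 0), moll_const]
      intro y hy
      refine h0 _ fun h => ?_
      have h2 := hM h
      simp only [he] at h2
      rw [Metric.mem_ball, dist_self_add_left, Complex.norm_exp] at h2
      replace h2 := h2.trans_le (le_max_left M 1)
      rw [← Real.lt_log_iff_exp_lt (by positivity)] at h2
      have := abs_lt.1 (hr ζ y hy)
      have := le_abs_self (Real.log (max M 1))
      have := abs_nonneg (Real.log d)
      linarith
  · rw [← funext hGe, ← ofReal_moll φ hGli hG0]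
    exact ENNReal.ofReal_le_ofReal
      (norm_fderiv_moll_le φ huli hGli hGm hG0 (hu.ofReal_abs_sub_le z₀) ζ)
  · have hdisj := Metric.disjoint_ball_infDist (x := ζ) (s := {ζ | z₀ + Complex.exp ζ ∈ C \ N})
    obtain ⟨c, hc⟩ := eqOn_ball_of_disjoint hN hC h1 h0 hec
      (fun x hx h => Set.disjoint_left.1 hdisj hx h)
    have : moll φ (fun ζ => u (e ζ)) =ᶠ[𝓝 ζ] fun _ => c := by
      filter_upwards [Metric.ball_mem_nhds ζ (sub_pos.2 hζ)] with x hx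
      rw [moll_congr φ (g := fun _ => c), moll_const]
      intro y hy
      refine hc y ?_
      rw [Metric.mem_ball] at hx ⊢
      have := dist_triangle y x ζ
      rw [dist_comm y x, dist_eq_norm x y] at this
      linarith
    rw [this.fderiv_eq]
    simp

/-- The mollified admissible density is calibrated, near the preimage of a compact set `T`, by a
smooth function in the logarithmic plane that increases by one under the period. -/
lemma exists_smooth_calibration {U V : Set ℂ} (hU : IsOpen U) (hUc : IsSimplyConnected U)
    (hV : IsPreconnected V) {z₀ : ℂ} (hz₀ : z₀ ∈ V) {ρ : ℂ → ℝ≥0∞}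
    (hρ : IsAdmissible ρ (separatingCurves U V)) (hfin : ∫⁻ z, ρ z ^ 2 ≠ ∞) {T : Set ℂ}
    (hT : IsCompact T) (hTU : T ⊆ U \ closure V) (hTne : T.Nonempty) :
    ∃ (φ : ContDiffBump (0 : ℂ)) (b : ℂ → ℝ), φ.rOut ≤ 1 ∧ ContDiff ℝ 2 b ∧
      (∀ x, b (x + expPeriod) = b x + 1) ∧
      ∀ ζ, Metric.infDist ζ {ζ | z₀ + Complex.exp ζ ∈ T} ≤ φ.rOut →
        ENNReal.ofReal ‖fderiv ℝ b ζ‖ ≤ lmoll φ (lmoll φ fun ζ =>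
          ENNReal.ofReal ‖Complex.exp ζ‖ * ρ (z₀ + Complex.exp ζ)) ζ := by
  obtain ⟨ε, hε, hε1, htube⟩ := exists_tube hT (hU.sdiff isClosed_closure) hTU z₀
  set T' : Set ℂ := {ζ | z₀ + Complex.exp ζ ∈ T} with hT'
  have hT'ne : T'.Nonempty := by
    obtain ⟨w, hw⟩ := hTne
    have : w - z₀ ≠ 0 := sub_ne_zero.2 fun h => (hTU hw).2 (h ▸ subset_closure hz₀)
    exact ⟨Complex.log (w - z₀), by simpa [hT', Complex.exp_log this] using hw⟩
  have hT'per : ∀ ζ, Metric.infDist (ζ + expPeriod) T' = Metric.infDist ζ T' := fun ζ => by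
    have himg : (fun x => x + expPeriod) '' T' = T' := by
      ext x
      constructor
      · rintro ⟨y, hy, rfl⟩
        simpa [hT', exp_add_expPeriod] using hy
      · intro hx
        refine ⟨x - expPeriod, ?_, by simp⟩
        have := exp_add_expPeriod (x - expPeriod)
        rw [sub_add_cancel] at this
        simpa [hT', ← this] using hx
    conv_lhs => rw [← himg]
    exact Metric.infDist_image (isometry_add_right expPeriod)
  let φ : ContDiffBump (0 : ℂ) := ⟨ε / 2, ε, by positivity, by linarith⟩
  have hφ : φ.rOut = ε := rfl
  set F : ℂ → ℝ≥0∞ := fun ζ => ENNReal.ofReal ‖Complex.exp ζ‖ * ρ (z₀ + Complex.exp ζ) with hF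
  have hFm : Measurable F := measurable_comp_exp hρ.1 z₀
  have hFper : ∀ x, F (x + expPeriod) = F x := fun x => by simp only [hF, exp_add_expPeriod]
  have hFfin : ∫⁻ ζ in strip, F ζ ^ 2 ≠ ∞ :=
    ne_top_of_le_ne_top hfin (lintegral_strip_sq_exp_le z₀ ρ)
  obtain ⟨hfli, hfm⟩ := locallyIntegrable_toReal_and_ofReal_moll hFm hFper hFfin
  set f : ℂ → ℝ := moll φ fun ζ => (F ζ).toReal with hf
  have hf0 : ∀ x, 0 ≤ f x := moll_nonneg φ fun _ => ENNReal.toReal_nonneg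
  have hfc : Continuous f := (contDiff_moll φ hfli 0).continuous
  have hfper : ∀ x, f (x + expPeriod) = f x := moll_periodic φ fun x => by rw [hFper]
  -- a cut-off that vanishes within distance `2 ε` of `T'` and is one beyond distance `3 ε`
  set χ : ℂ → ℝ := fun ζ => min 1 (max 0 (Metric.infDist ζ T' / ε - 2)) with hχ
  have hχc : Continuous χ := by
    have := Metric.continuous_infDist_pt T'
    fun_prop
  have hχ0 : ∀ x, 0 ≤ χ x := fun x => le_min zero_le_one (le_max_left _ _)
  have hχ1 : ∀ x, 3 * ε ≤ Metric.infDist x T' → χ x = 1 := fun x hx => by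
    have : 3 ≤ Metric.infDist x T' / ε := (le_div_iff₀ hε).2 hx
    exact min_eq_left (le_max_of_le_right (by linarith))
  have hχ2 : ∀ x, Metric.infDist x T' ≤ 2 * ε → χ x = 0 := fun x hx => by
    have : Metric.infDist x T' / ε ≤ 2 := (div_le_iff₀ hε).2 hx
    simp only [hχ]
    rw [max_eq_left (by linarith), min_eq_right zero_le_one]
  have hεp : 2 * ε ≤ ‖expPeriod‖ := by
    have : ‖expPeriod‖ = 2 * Real.pi := by simp [expPeriod, abs_of_pos Real.pi_pos]
    rw [this]; linarith [Real.pi_gt_three]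
  set σ : ℂ → ℝ := fun x => f x + ε⁻¹ * χ x with hσ
  have hσc : Continuous σ := by fun_prop
  have hσ0 : ∀ x, 0 ≤ σ x := fun x =>
    add_nonneg (hf0 x) (mul_nonneg (inv_nonneg.2 hε.le) (hχ0 x))
  have hloop : ∀ (α : ℝ → ℂ) (L : ℝ), LipschitzWith 1 α → 0 ≤ L → α L = α 0 + expPeriod →
      (∀ t ∈ Icc 0 L, Metric.infDist (α t) T' < 4 * ε) → 1 ≤ ∫ t in (0 : ℝ)..L, f (α t) := by
    intro α L hα hL hend hnear
    have hαc := hα.continuous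
    have h := one_le_lintegral_lmoll_path φ hFm hαc (L := L) fun v hv => by
      refine one_le_lintegral_path hU hUc hV hz₀ hρ (α := fun t => α t - v) (L := L) ?_ hL
        (by rw [hend]; ring) fun t ht => ?_
      · exact LipschitzWith.of_dist_le_mul fun x y => by
          rw [dist_sub_right]; exact hα.dist_le_mul x y
      · obtain ⟨ζ, hζ, hd⟩ := (Metric.infDist_lt_iff hT'ne).1 (hnear t ht)
        refine htube ζ _ hζ ?_
        have := norm_sub_le (α t - ζ) v
        rw [hφ] at hv
        rw [dist_eq_norm] at hd
        rw [sub_right_comm]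
        linarith
    rw [intervalIntegral.integral_of_le hL, ← integral_Icc_eq_integral_Ioc,
      ← ENNReal.ofReal_le_ofReal_iff (integral_nonneg fun t => hf0 _), ENNReal.ofReal_one,
      ofReal_integral_eq_lintegral_ofReal
        (f := fun t => f (α t)) (hfc.comp hαc).continuousOn.integrableOn_Icc
        (Eventually.of_forall fun t => hf0 _)]
    simpa only [hf, hfm] using h
  obtain ⟨v, hvper, hv⟩ := exists_calibration expPeriod_ne_zero hσc hσ0
    (fun x => by simp only [hσ, hχ, hfper, hT'per])
    (fun p c => one_le_of_reach_add hfc hf0 hε hεp hχc hχ0 hχ1 hloop)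
  have hvc : Continuous v := continuous_of_abs_sub_le_segment hσc hv
  refine ⟨φ, moll φ v, by rw [hφ]; linarith, contDiff_moll φ hvc.locallyIntegrable 2,
    moll_add_one φ hvc.locallyIntegrable hvper, fun ζ hζ => ?_⟩
  have h1 : ‖fderiv ℝ (moll φ v) ζ‖ ≤ moll φ σ ζ := by
    refine norm_fderiv_moll_le φ hvc.locallyIntegrable hσc.locallyIntegrable hσc.measurable hσ0
      (fun h => Eventually.of_forall fun p => ?_) ζ
    have hc : Continuous fun s : ℝ => σ (p + s * h) := by fun_prop
    rw [← ofReal_integral_eq_lintegral_ofReal hc.continuousOn.integrableOn_Icc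
        (Eventually.of_forall fun t => hσ0 _), ← ENNReal.ofReal_mul (norm_nonneg _),
        integral_Icc_eq_integral_Ioc, ← intervalIntegral.integral_of_le zero_le_one]
    exact ENNReal.ofReal_le_ofReal (hv p h)
  have h2 : moll φ σ ζ = moll φ f ζ := moll_congr φ fun y hy => by
    have := Metric.infDist_le_infDist_add_dist (s := T') (x := y) (y := ζ)
    rw [dist_comm, dist_eq_norm] at this
    rw [hφ] at hζ hy
    simp only [hσ]
    rw [hχ2 y (by linarith), mul_zero, add_zero]
  refine (ENNReal.ofReal_le_ofReal (h1.trans_eq h2)).trans_eq ?_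
  rw [ofReal_moll φ hfc.locallyIntegrable hf0]
  congr 1
  exact funext (hfm φ)

/-- A potential bounds the energy of every admissible density from below. -/
theorem IsPotential.one_le_mul {U V : Set ℂ} (hU : IsOpen U) (hUc : IsSimplyConnected U)
    (hV : IsPreconnected V) (hVne : V.Nonempty) {ρ : ℂ → ℝ≥0∞}
    (hρ : IsAdmissible ρ (separatingCurves U V)) (hρfin : ∫⁻ z, ρ z ^ 2 ≠ ∞)
    {u η : ℂ → ℝ} {S : Set ℂ} (hu : IsPotential U V u η S)
    (hηfin : ∫⁻ z, ENNReal.ofReal (η z) ^ 2 ≠ ∞) :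
    1 ≤ (∫⁻ z, ρ z ^ 2) * ∫⁻ z, ENNReal.ofReal (η z) ^ 2 := by
  obtain ⟨z₀, hz₀⟩ := hVne
  obtain ⟨N, C, hN, hC, h1, h0, hz₀N, hT, hTU, hTne⟩ := hu.exists_sets hz₀
  obtain ⟨φ, b, hφ, hb, hbp, hbd⟩ := exists_smooth_calibration hU hUc hV hz₀ hρ hρfin hT hTU hTne
  obtain ⟨a, ha, hap, ⟨R, hR, hl, hr⟩, had, ha0⟩ := hu.moll_exp hηfin hN hC h1 h0 hz₀N φ hφ
  set A : ℂ → ℝ≥0∞ := fun ζ =>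
    ENNReal.ofReal ‖Complex.exp ζ‖ * ENNReal.ofReal (η (z₀ + Complex.exp ζ)) with hA
  set B : ℂ → ℝ≥0∞ := fun ζ => ENNReal.ofReal ‖Complex.exp ζ‖ * ρ (z₀ + Complex.exp ζ) with hB
  have hAm : Measurable A :=
    measurable_comp_exp (F := fun w => ENNReal.ofReal (η w)) hu.measurable_slope.ennreal_ofReal z₀
  have hBm : Measurable B := measurable_comp_exp hρ.1 z₀
  have hBp : ∀ x, B (x + expPeriod) = B x := fun x => by simp only [hB, exp_add_expPeriod]
  have hAB : 1 ≤ ∫⁻ ζ in strip, lmoll φ A ζ * lmoll φ (lmoll φ B) ζ := by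
    refine (stokes_strip ha hb hap hbp hR hl hr).trans (lintegral_mono fun ζ => ?_)
    rcases le_or_gt (Metric.infDist ζ {ζ | z₀ + Complex.exp ζ ∈ C \ N}) φ.rOut with hζ | hζ
    · exact mul_le_mul' (had ζ) (hbd ζ hζ)
    · simp [ha0 ζ hζ]
  have hBm1 := measurable_lmoll φ hBm
  calc (1 : ℝ≥0∞) ≤ (∫⁻ ζ in strip, lmoll φ A ζ * lmoll φ (lmoll φ B) ζ) ^ 2 := one_le_pow₀ hAB
    _ ≤ (∫⁻ ζ in strip, lmoll φ A ζ ^ 2) * ∫⁻ ζ in strip, lmoll φ (lmoll φ B) ζ ^ 2 :=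
        lintegral_mul_sq_le (measurable_lmoll φ hAm).aemeasurable
          (measurable_lmoll φ hBm1).aemeasurable
    _ ≤ (∫⁻ ζ in strip, A ζ ^ 2) * ∫⁻ ζ in strip, B ζ ^ 2 := by
        exact mul_le_mul'
          (lintegral_strip_lmoll_le φ hAm fun x => by simp only [hA, exp_add_expPeriod])
          ((lintegral_strip_lmoll_le φ hBm1 (lmoll_periodic φ hBp)).trans
            (lintegral_strip_lmoll_le φ hBm hBp))
    _ ≤ (∫⁻ z, ENNReal.ofReal (η z) ^ 2) * ∫⁻ z, ρ z ^ 2 := by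
        exact mul_le_mul' (lintegral_strip_sq_exp_le z₀ fun w => ENNReal.ofReal (η w))
          (lintegral_strip_sq_exp_le z₀ ρ)
    _ = _ := mul_comm _ _

end LengthArea

/-! ### The gradient of a mollified indicator function -/

section Sweeping

open Filter Topology

lemma locallyIntegrable_indicator_one {W : Set ℂ} (hW : MeasurableSet W) :
    LocallyIntegrable (W.indicator (1 : ℂ → ℝ)) := by
  refine (locallyIntegrable_const (1 : ℝ)).mono
    ((measurable_one.indicator hW).aestronglyMeasurable) (Eventually.of_forall fun y => ?_)
  by_cases hy : y ∈ W <;> simp [hy]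

/-- The area of the `r`-neighbourhood of a segment. -/
lemma volume_segment_thickening_le (h : ℂ) {r : ℝ} (hr : 0 ≤ r) :
    volume {w : ℂ | ∃ σ ∈ Icc (0 : ℝ) 1, ‖w + σ * h‖ ≤ r} ≤
      ENNReal.ofReal ((‖h‖ + 2 * r) * (2 * r)) := by
  set c : Circle := Circle.exp h.arg
  have hc : h = ‖h‖ * c := by
    rw [Circle.coe_exp, Complex.norm_mul_exp_arg_mul_I]
  have hrot := (rotation c).measurePreserving
  have hrect := Complex.volume_preserving_equiv_real_prod
  set B : Set (ℝ × ℝ) := Icc (-‖h‖ - r) r ×ˢ Icc (-r) r with hB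
  have hBm : MeasurableSet B := measurableSet_Icc.prod measurableSet_Icc
  have hsub : {w : ℂ | ∃ σ ∈ Icc (0 : ℝ) 1, ‖w + σ * h‖ ≤ r} ⊆
      (rotation c).symm ⁻¹' (Complex.measurableEquivRealProd ⁻¹' B) := by
    rintro w ⟨σ, hσ, hw⟩
    set w' := (rotation c).symm w with hw'
    have e : w + σ * h = rotation c (w' + σ * ‖h‖) := by
      rw [map_add, hw', LinearIsometryEquiv.apply_symm_apply, rotation_apply]
      conv_lhs => rw [hc]
      ring
    rw [e, LinearIsometryEquiv.norm_map] at hw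
    have h1 := abs_le.1 ((Complex.abs_re_le_norm _).trans hw)
    have h2 := abs_le.1 ((Complex.abs_im_le_norm _).trans hw)
    simp only [Complex.add_re, Complex.add_im, ← Complex.ofReal_mul, Complex.ofReal_re,
      Complex.ofReal_im, add_zero] at h1 h2
    have h3 : 0 ≤ σ * ‖h‖ := mul_nonneg hσ.1 (norm_nonneg _)
    have h4 : σ * ‖h‖ ≤ ‖h‖ := mul_le_of_le_one_left (norm_nonneg _) hσ.2
    show Complex.measurableEquivRealProd w' ∈ B
    rw [Complex.measurableEquivRealProd_apply]
    exact ⟨⟨by linarith, by linarith⟩, h2⟩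
  refine (measure_mono hsub).trans_eq ?_
  rw [((rotation c).symm.measurePreserving).measure_preimage
      (hrect.measurable hBm).nullMeasurableSet,
    hrect.measure_preimage hBm.nullMeasurableSet, hB, Measure.volume_eq_prod, Measure.prod_prod,
    Real.volume_Icc, Real.volume_Icc, ← ENNReal.ofReal_mul (by linarith [norm_nonneg h])]
  congr 1; ring

/-- The mollified increment of the indicator function of `W` along `h` is controlled by the area
that a neighbourhood of the segment `[0, -h]` sweeps out when it moves along a path `α` containing
the boundary of `W`. -/
lemma abs_moll_indicator_sub_le (φ : ContDiffBump (0 : ℂ)) {α : ℝ → ℂ} (hα : LipschitzWith 1 α)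
    {L : ℝ} (hL : 0 ≤ L) {W : Set ℂ} (hW : MeasurableSet W)
    (hcross : ∀ y h : ℂ, ¬(y ∈ W ↔ y + h ∈ W) →
      ∃ s ∈ Icc (0 : ℝ) L, ∃ σ ∈ Icc (0 : ℝ) 1, y + σ * h = α s)
    {K : NNReal} (hK : LipschitzWith K (φ.normed volume)) (x h : ℂ) {r : ℝ} (hr : 0 < r) :
    |moll φ (W.indicator 1) (x + h) - moll φ (W.indicator 1) x| ≤ (‖h‖ + 2 * r) *
      ∫ s in (-r)..(L + r), (φ.normed volume (x - α s) + K * (‖h‖ + r)) := by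
  have hαc := hα.continuous
  have hgc : Continuous fun s => φ.normed volume (x - α s) + K * (‖h‖ + r) := by
    have := φ.continuous_normed (μ := volume)
    fun_prop
  have hg0 : ∀ s, 0 ≤ φ.normed volume (x - α s) + K * (‖h‖ + r) := fun s =>
    add_nonneg (φ.nonneg_normed _) (by positivity)
  have hli := locallyIntegrable_indicator_one hW
  -- the points from which a step `h` crosses the boundary of `W`
  set E : Set ℂ := {y | ¬(y ∈ W ↔ y + h ∈ W)} with hE
  have hEm : MeasurableSet E := by
    have h1 : MeasurableSet ((fun y => y + h) ⁻¹' W) := (measurable_add_const h) hW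
    have : E = (W \ (fun y => y + h) ⁻¹' W) ∪ ((fun y => y + h) ⁻¹' W \ W) := by
      ext y; simp only [hE, mem_ofPred_eq, mem_union, Set.mem_sdiff, mem_preimage]; tauto
    rw [this]
    exact (hW.diff h1).union (h1.diff hW)
  set R : Set ℂ := {w : ℂ | ∃ σ ∈ Icc (0 : ℝ) 1, ‖w + σ * h‖ ≤ r} with hR
  have hRm : MeasurableSet R := by
    have : R = Prod.snd '' ({p : ℝ × ℂ | ‖p.2 + p.1 * h‖ ≤ r} ∩ (Icc (0 : ℝ) 1 ×ˢ univ)) := by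
      ext w; simp only [hR, mem_ofPred_eq, mem_image, mem_inter_iff, mem_prod, mem_univ, and_true,
        Prod.exists, exists_eq_right]
      exact exists_congr fun σ => and_comm
    have hcl : IsClosed {p : ℝ × ℂ | ‖p.2 + p.1 * h‖ ≤ r} :=
      isClosed_le (by fun_prop) continuous_const
    rw [this]
    have himg : Prod.snd '' ({p : ℝ × ℂ | ‖p.2 + p.1 * h‖ ≤ r} ∩ (Icc (0 : ℝ) 1 ×ˢ univ)) =
        Prod.snd '' ((fun p : Icc (0 : ℝ) 1 × ℂ => ((p.1 : ℝ), p.2)) '' 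
          {p : Icc (0 : ℝ) 1 × ℂ | ‖p.2 + (p.1 : ℝ) * h‖ ≤ r}) := by
      congr 1
      ext p
      constructor
      · rintro ⟨h1, h2, -⟩
        exact ⟨(⟨p.1, h2⟩, p.2), h1, rfl⟩
      · rintro ⟨q, hq, rfl⟩
        exact ⟨hq, q.1.2, mem_univ _⟩
    rw [himg, image_image]
    refine IsClosed.measurableSet (isClosedMap_snd_of_compactSpace _ ?_)
    exact isClosed_le (by fun_prop) continuous_const
  -- a crossing at time `s` is noticed during the whole time interval `[s - r, s + r]`
  have hsweep : ∀ y, E.indicator (1 : ℂ → ℝ≥0∞) y * ENNReal.ofReal (2 * r) ≤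
      ∫⁻ s in Icc (-r) (L + r), R.indicator (1 : ℂ → ℝ≥0∞) (y - α s) := by
    intro y
    by_cases hy : y ∈ E
    · obtain ⟨s, hs, σ, hσ, hys⟩ := hcross y h hy
      have hsub : Icc (s - r) (s + r) ⊆ Icc (-r) (L + r) :=
        Icc_subset_Icc (by linarith [hs.1]) (by linarith [hs.2])
      calc _ = ∫⁻ s' in Icc (s - r) (s + r), 1 := by
            rw [indicator_of_mem hy, Pi.one_apply, one_mul, setLIntegral_one, Real.volume_Icc]
            congr 1; ring
        _ ≤ ∫⁻ s' in Icc (s - r) (s + r), R.indicator (1 : ℂ → ℝ≥0∞) (y - α s') := by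
            refine setLIntegral_mono' measurableSet_Icc fun s' hs' => ?_
            rw [indicator_of_mem, Pi.one_apply]
            refine ⟨σ, hσ, ?_⟩
            rw [sub_add_eq_add_sub, hys, ← dist_eq_norm]
            have := hα.dist_le_mul s s'
            rw [NNReal.coe_one, one_mul, Real.dist_eq] at this
            exact this.trans (abs_le.2 ⟨by linarith [hs'.2], by linarith [hs'.1]⟩)
        _ ≤ _ := lintegral_mono_set hsub
    · simp [hy]
  have hball : ∀ s t, R.indicator (1 : ℂ → ℝ≥0∞) (x - t - α s) * bumpWeight φ t ≤
      R.indicator (1 : ℂ → ℝ≥0∞) (x - α s - t) *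
        ENNReal.ofReal (φ.normed volume (x - α s) + K * (‖h‖ + r)) := by
    intro s t
    rw [sub_right_comm]
    by_cases ht : x - α s - t ∈ R
    · gcongr
      refine ENNReal.ofReal_le_ofReal ?_
      obtain ⟨σ, hσ, hw⟩ := ht
      have h1 : ‖x - α s - t‖ ≤ ‖h‖ + r := by
        have := norm_sub_le (x - α s - t + σ * h) (σ * h)
        rw [add_sub_cancel_right, norm_mul, Complex.norm_real, Real.norm_eq_abs,
          abs_of_nonneg hσ.1] at this
        have := mul_le_of_le_one_left (norm_nonneg h) hσ.2
        linarith
      have h2 := (abs_le.1 ((Real.dist_eq _ _).symm.le.trans (hK.dist_le_mul t (x - α s)))).2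
      rw [dist_comm, dist_eq_norm] at h2
      have := mul_le_mul_of_nonneg_left h1 K.2
      have h3 : (K : ℝ) * ‖x - α s - t‖ ≤ K * (‖h‖ + r) := this
      linarith
    · simp [ht]
  have hinc : ENNReal.ofReal |moll φ (W.indicator 1) (x + h) - moll φ (W.indicator 1) x| ≤
      ∫⁻ t, bumpWeight φ t * E.indicator 1 (x - t) := by
    rw [moll, moll, ← integral_sub (integrable_moll_integrand φ hli _)
      (integrable_moll_integrand φ hli _), ← Real.enorm_eq_ofReal_abs]
    refine (enorm_integral_le_lintegral_enorm _).trans (lintegral_mono fun t => ?_)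
    rw [← mul_sub, enorm_mul, Real.enorm_eq_ofReal (φ.nonneg_normed t)]
    refine mul_le_mul' le_rfl ?_
    rw [add_sub_right_comm]
    by_cases h1 : x - t ∈ W <;> by_cases h2 : x - t + h ∈ W <;> simp [hE, h1, h2]
  have hαm := hαc.measurable
  have hRi : Measurable (R.indicator (1 : ℂ → ℝ≥0∞)) := measurable_one.indicator hRm
  have hmain : ENNReal.ofReal (2 * r) *
      ENNReal.ofReal |moll φ (W.indicator 1) (x + h) - moll φ (W.indicator 1) x| ≤
      ENNReal.ofReal ((‖h‖ + 2 * r) * (2 * r)) * ENNReal.ofReal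
        (∫ s in Icc (-r) (L + r), (φ.normed volume (x - α s) + K * (‖h‖ + r))) := by
    calc _ ≤ ENNReal.ofReal (2 * r) * ∫⁻ t, bumpWeight φ t * E.indicator 1 (x - t) := by gcongr
      _ = ∫⁻ t, bumpWeight φ t * (E.indicator 1 (x - t) * ENNReal.ofReal (2 * r)) := by
          rw [mul_comm, ← lintegral_mul_const' _ _ ENNReal.ofReal_ne_top]
          simp only [mul_assoc]
      _ ≤ ∫⁻ t, bumpWeight φ t * ∫⁻ s in Icc (-r) (L + r), R.indicator 1 (x - t - α s) := by
          gcongr with t; exact hsweep _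
      _ = ∫⁻ t, ∫⁻ s in Icc (-r) (L + r), R.indicator 1 (x - t - α s) * bumpWeight φ t := by
          congr 1; ext t
          rw [mul_comm, lintegral_mul_const' (bumpWeight φ t) _ ENNReal.ofReal_ne_top]
      _ = ∫⁻ s in Icc (-r) (L + r), ∫⁻ t, R.indicator 1 (x - t - α s) * bumpWeight φ t :=
          lintegral_lintegral_swap (by fun_prop)
      _ ≤ ∫⁻ s in Icc (-r) (L + r), ∫⁻ t, R.indicator 1 (x - α s - t) *
            ENNReal.ofReal (φ.normed volume (x - α s) + K * (‖h‖ + r)) :=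
          lintegral_mono fun s => lintegral_mono fun t => hball s t
      _ = ∫⁻ s in Icc (-r) (L + r), volume R *
            ENNReal.ofReal (φ.normed volume (x - α s) + K * (‖h‖ + r)) := by
          congr 1; ext s
          rw [lintegral_mul_const' _ _ ENNReal.ofReal_ne_top,
            lintegral_sub_left_eq_self (fun w => R.indicator (1 : ℂ → ℝ≥0∞) w) (x - α s),
            lintegral_indicator_one hRm]
      _ = volume R * ∫⁻ s in Icc (-r) (L + r),
            ENNReal.ofReal (φ.normed volume (x - α s) + K * (‖h‖ + r)) :=
          lintegral_const_mul _ hgc.measurable.ennreal_ofReal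
      _ ≤ _ := by
          rw [ofReal_integral_eq_lintegral_ofReal hgc.continuousOn.integrableOn_Icc
            (Eventually.of_forall hg0)]
          gcongr
          exact volume_segment_thickening_le h hr.le
  rw [intervalIntegral.integral_of_le (by linarith), ← integral_Icc_eq_integral_Ioc]
  rw [← ENNReal.ofReal_mul (by positivity), ← ENNReal.ofReal_mul (by positivity),
    ENNReal.ofReal_le_ofReal_iff (mul_nonneg (by positivity) (integral_nonneg hg0))] at hmain
  have h2r : 0 < 2 * r := by positivity
  refine le_of_mul_le_mul_left (hmain.trans_eq ?_) h2r
  ring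

/-- If a path `α` of speed at most one meets every segment that connects `W` with its complement,
then the gradient of the mollified indicator function of `W` is at most the mollified arc length of
`α`. -/
lemma norm_fderiv_moll_indicator_le (φ : ContDiffBump (0 : ℂ)) {α : ℝ → ℂ}
    (hα : LipschitzWith 1 α) {L : ℝ} (hL : 0 ≤ L) {W : Set ℂ} (hW : MeasurableSet W)
    (hcross : ∀ y h : ℂ, ¬(y ∈ W ↔ y + h ∈ W) →
      ∃ s ∈ Icc (0 : ℝ) L, ∃ σ ∈ Icc (0 : ℝ) 1, y + σ * h = α s) (x : ℂ) :
    ‖fderiv ℝ (moll φ (W.indicator 1)) x‖ ≤ ∫ s in Icc 0 L, φ.normed volume (x - α s) := by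
  obtain ⟨K, hK⟩ := φ.contDiff_normed (n := 1).lipschitzWith_of_hasCompactSupport
    (φ.hasCompactSupport_normed (μ := volume)) (by simp)
  have hli := locallyIntegrable_indicator_one hW
  have hαc := hα.continuous
  have hφc := φ.continuous_normed (μ := volume)
  rw [integral_Icc_eq_integral_Ioc, ← intervalIntegral.integral_of_le hL]
  set I := ∫ s in (0 : ℝ)..L, φ.normed volume (x - α s) with hI
  have hI0 : 0 ≤ I := intervalIntegral.integral_nonneg hL fun s _ => φ.nonneg_normed _
  -- let the width of the swept neighbourhood tend to zero
  have key : ∀ h : ℂ, |moll φ (W.indicator 1) (x + h) - moll φ (W.indicator 1) x| ≤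
      ‖h‖ * (I + K * ‖h‖ * L) := by
    intro h
    have hci : Continuous fun s => φ.normed volume (x - α s) := by fun_prop
    have hcont : ContinuousAt (fun r : ℝ => (‖h‖ + 2 * r) *
        ∫ s in (-r)..(L + r), (φ.normed volume (x - α s) + K * (‖h‖ + r))) 0 := by
      have e : (fun r : ℝ => (‖h‖ + 2 * r) *
          ∫ s in (-r)..(L + r), (φ.normed volume (x - α s) + K * (‖h‖ + r))) =
          fun r => (‖h‖ + 2 * r) * ((∫ s in (0 : ℝ)..(L + r), φ.normed volume (x - α s)) -
            (∫ s in (0 : ℝ)..(-r), φ.normed volume (x - α s)) +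
              (L + 2 * r) * (K * (‖h‖ + r))) := by
        ext r
        rw [intervalIntegral.integral_add (hci.intervalIntegrable _ _) (by simp),
          intervalIntegral.integral_const, intervalIntegral.integral_interval_sub_left
            (hci.intervalIntegrable _ _) (hci.intervalIntegrable _ _), smul_eq_mul]
        congr 3; ring
      rw [e]
      have hp : Continuous fun b => ∫ s in (0 : ℝ)..b, φ.normed volume (x - α s) :=
        intervalIntegral.continuous_primitive (fun a b => hci.intervalIntegrable a b) 0
      have h1 : Continuous fun r : ℝ => ∫ s in (0 : ℝ)..(L + r), φ.normed volume (x - α s) :=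
        hp.comp (by fun_prop)
      have h2 : Continuous fun r : ℝ => ∫ s in (0 : ℝ)..(-r), φ.normed volume (x - α s) :=
        hp.comp (by fun_prop)
      exact Continuous.continuousAt (by fun_prop)
    have hlim : Tendsto (fun r : ℝ => (‖h‖ + 2 * r) *
        ∫ s in (-r)..(L + r), (φ.normed volume (x - α s) + K * (‖h‖ + r))) (𝓝[>] 0)
        (𝓝 (‖h‖ * (I + K * ‖h‖ * L))) := by
      have := hcont.tendsto.mono_left (nhdsWithin_le_nhds (s := Ioi 0))
      simp only [mul_zero, add_zero, neg_zero] at this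
      rw [intervalIntegral.integral_add (hci.intervalIntegrable _ _) (by simp),
        intervalIntegral.integral_const, smul_eq_mul, sub_zero, ← hI] at this
      convert this using 3
      ring
    refine ge_of_tendsto hlim ?_
    filter_upwards [self_mem_nhdsWithin] with r hr
    exact abs_moll_indicator_sub_le φ hα hL hW hcross hK x h hr
  have hd : HasFDerivAt (moll φ (W.indicator 1)) (fderiv ℝ (moll φ (W.indicator 1)) x) x :=
    ((contDiff_moll φ hli 1).differentiable (by simp) x).hasFDerivAt
  refine le_of_forall_pos_le_add fun ε hε => hd.le_of_lip' (by positivity) ?_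
  have hsmall : ∀ᶠ y in 𝓝 x, K * ‖y - x‖ * L < ε := by
    have : Continuous fun y : ℂ => K * ‖y - x‖ * L := by fun_prop
    exact (this.tendsto x).eventually (gt_mem_nhds (by simpa using hε))
  filter_upwards [hsmall] with y hy
  have := key (y - x)
  rw [add_sub_cancel] at this
  rw [Real.norm_eq_abs]
  refine this.trans ?_
  rw [mul_comm]
  gcongr

end Sweeping

/-! ### Potentials of small energy -/

section UpperBound

open Filter Topology

/-- A continuously differentiable competitor for the capacity of the ring `U \ closure V`. -/
structure IsSmoothPotential (U V : Set ℂ) (u : ℂ → ℝ) : Prop where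
  contDiff : ContDiff ℝ 1 u
  nonneg : ∀ z, 0 ≤ u z
  le_one : ∀ z, u z ≤ 1
  exists_one : ∃ N, IsOpen N ∧ closure V ⊆ N ∧ ∀ z ∈ N, u z = 1
  exists_zero : ∃ C, IsCompact C ∧ C ⊆ U ∧ ∀ z ∉ C, u z = 0

variable {U V : Set ℂ}

lemma IsSmoothPotential.continuous_norm_fderiv {u : ℂ → ℝ} (hu : IsSmoothPotential U V u) :
    Continuous fun z => ‖fderiv ℝ u z‖ :=
  (hu.contDiff.continuous_fderiv (by simp)).norm

lemma IsSmoothPotential.slopeLE {u : ℂ → ℝ} (hu : IsSmoothPotential U V u) (z : ℂ) :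
    SlopeLE u ‖fderiv ℝ u z‖ z :=
  (hu.contDiff.differentiable (by simp) z).hasFDerivAt.slopeLE

lemma IsSmoothPotential.convex_combination {u v : ℂ → ℝ} (hu : IsSmoothPotential U V u)
    (hv : IsSmoothPotential U V v) {a b : ℝ} (ha : 0 ≤ a) (hb : 0 ≤ b) (hab : a + b = 1) :
    IsSmoothPotential U V (fun z => a * u z + b * v z) where
  contDiff := (contDiff_const.mul hu.contDiff).add (contDiff_const.mul hv.contDiff)
  nonneg z := add_nonneg (mul_nonneg ha (hu.nonneg z)) (mul_nonneg hb (hv.nonneg z))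
  le_one z := by
    have h1 := mul_le_mul_of_nonneg_left (hu.le_one z) ha
    have h2 := mul_le_mul_of_nonneg_left (hv.le_one z) hb
    linarith
  exists_one := by
    obtain ⟨N, hN, hVN, h1⟩ := hu.exists_one
    obtain ⟨N', hN', hVN', h1'⟩ := hv.exists_one
    exact ⟨N ∩ N', hN.inter hN', subset_inter hVN hVN', fun z hz => by
      rw [h1 z hz.1, h1' z hz.2, mul_one, mul_one, hab]⟩
  exists_zero := by
    obtain ⟨C, hC, hCU, h0⟩ := hu.exists_zero
    obtain ⟨C', hC', hCU', h0'⟩ := hv.exists_zero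
    exact ⟨C ∪ C', hC.union hC', union_subset hCU hCU', fun z hz => by
      rw [h0 z fun h => hz (Or.inl h), h0' z fun h => hz (Or.inr h), mul_zero, mul_zero, add_zero]⟩

/-- The mollified indicator function of the component enclosed by a separating curve is a
potential. -/
lemma exists_isSmoothPotential_of_mem_separatingCurves (hU : IsOpen U) (hV : IsPreconnected V)
    {z₀ : ℂ} (hz₀ : z₀ ∈ V) {γ : ℝ → ℂ} (hγ : γ ∈ separatingCurves U V)
    (hbv : BoundedVariationOn γ (Icc 0 1)) :
    ∃ (α : ℝ → ℂ) (L : ℝ), LipschitzWith 1 α ∧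
      (∀ ρ, arcLengthIntegral ρ γ = ∫⁻ s in Icc 0 L, ρ (α s)) ∧
      ∃ δ > 0, ∀ φ : ContDiffBump (0 : ℂ), φ.rOut ≤ δ → ∃ u, IsSmoothPotential U V u ∧
        ∀ x, ‖fderiv ℝ u x‖ ≤ ∫ s in Icc 0 L, φ.normed volume (x - α s) := by
  obtain ⟨hγc, hγm, hγs⟩ := hγ
  obtain ⟨hWb, hWU⟩ := hγs z₀ hz₀
  set Γ : Set ℂ := γ '' Icc 0 1 with hΓ
  have hΓc : IsClosed Γ := (isCompact_Icc.image_of_continuousOn hγc).isClosed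
  set W := connectedComponentIn Γᶜ z₀ with hW
  have hVΓ : closure V ⊆ Γᶜ := by
    rintro z hz ⟨t, ht, rfl⟩
    exact (hγm ht).2 hz
  have hVW : closure V ⊆ W :=
    hV.closure.subset_connectedComponentIn (subset_closure hz₀) hVΓ
  have hWo : IsOpen W := hΓc.isOpen_compl.connectedComponentIn
  have hΓU : Γ ⊆ U := by
    rintro z ⟨t, ht, rfl⟩
    exact (hγm ht).1
  have hWcl : closure W ⊆ U := fun z hz => by
    by_cases hzΓ : z ∈ Γ
    · exact hΓU hzΓ
    · have hopen : IsOpen (connectedComponentIn Γᶜ z) := hΓc.isOpen_compl.connectedComponentIn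
      obtain ⟨y, hy, hyW⟩ := mem_closure_iff.1 hz _ hopen (mem_connectedComponentIn hzΓ)
      refine hWU ?_
      show z ∈ W
      rw [hW, connectedComponentIn_eq hyW, ← connectedComponentIn_eq hy]
      exact mem_connectedComponentIn hzΓ
  have hWclc : IsCompact (closure W) := hWb.isCompact_closure
  have hVc : IsCompact (closure V) :=
    hWclc.of_isClosed_subset isClosed_closure (hVW.trans subset_closure)
  set L := (eVariationOn γ (Icc 0 1)).toReal with hL
  have hL0 : 0 ≤ L := ENNReal.toReal_nonneg
  set α : ℝ → ℂ := fun s => naturalParameterization γ (Icc 0 1) 0 (projIcc 0 L hL0 s) with hα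
  have hαl : LipschitzWith 1 α := by
    have h1 := (lipschitzOnWith_naturalParameterization hbv hγc)
    refine LipschitzWith.of_dist_le_mul fun x y => ?_
    refine (h1.dist_le_mul _ (projIcc 0 L hL0 x).2 _ (projIcc 0 L hL0 y).2).trans ?_
    rw [NNReal.coe_one, one_mul, one_mul]
    have := (LipschitzWith.projIcc hL0).dist_le_mul x y
    rwa [NNReal.coe_one, one_mul, Subtype.dist_eq] at this
  have hαe : ∀ s ∈ Icc 0 L, α s = naturalParameterization γ (Icc 0 1) 0 s := fun s hs => by
    simp only [hα]; rw [projIcc_of_mem hL0 hs]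
  have hαΓ : α '' Icc 0 L = Γ := by
    rw [hΓ, ← naturalParameterization_image hbv hγc]
    exact image_congr hαe
  obtain ⟨δ₁, hδ₁, h1⟩ := hVc.exists_thickening_subset_open hWo hVW
  obtain ⟨δ₂, hδ₂, h2⟩ := hWclc.exists_cthickening_subset_open hU hWcl
  refine ⟨α, L, hαl, fun ρ => setLIntegral_congr_fun measurableSet_Icc fun s hs => by
    simp only [hαe s hs], min (δ₁ / 2) δ₂, lt_min (half_pos hδ₁) hδ₂, fun φ hφ =>
    ⟨moll φ (W.indicator 1), ?_, ?_⟩⟩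
  · have hi0 : ∀ z, 0 ≤ W.indicator (1 : ℂ → ℝ) z := fun z =>
      indicator_nonneg (fun _ _ => zero_le_one) z
    have hi1 : ∀ z, W.indicator (1 : ℂ → ℝ) z ≤ 1 := fun z =>
      indicator_le_self' (s := W) (f := (1 : ℂ → ℝ)) (fun _ _ => zero_le_one) z
    have hli := locallyIntegrable_indicator_one hWo.measurableSet
    refine ⟨contDiff_moll φ hli 1, moll_nonneg φ hi0, fun z => ?_, ?_, ?_⟩
    · rw [← moll_const φ 1 z]
      refine integral_mono (integrable_moll_integrand φ hli z)
        (integrable_moll_integrand φ (locallyIntegrable_const 1) z) fun t => ?_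
      exact mul_le_mul_of_nonneg_left (hi1 _) (φ.nonneg_normed t)
    · refine ⟨Metric.thickening (δ₁ / 2) (closure V), Metric.isOpen_thickening,
        Metric.self_subset_thickening (half_pos hδ₁) _, fun z hz => ?_⟩
      rw [moll_congr φ (g := fun _ => 1), moll_const]
      intro y hy
      rw [indicator_of_mem, Pi.one_apply]
      refine h1 ?_
      obtain ⟨x, hx, hzx⟩ := Metric.mem_thickening_iff.1 hz
      refine Metric.mem_thickening_iff.2 ⟨x, hx, ?_⟩
      have := dist_triangle y z x
      rw [dist_comm y z, dist_eq_norm z y] at this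
      have := min_le_left (δ₁ / 2) δ₂
      linarith
    · refine ⟨Metric.cthickening δ₂ (closure W), hWclc.cthickening, h2, fun z hz => ?_⟩
      rw [moll_congr φ (g := fun _ => 0), moll_const]
      intro y hy
      refine indicator_of_notMem (fun hyW => hz ?_) _
      refine Metric.mem_cthickening_of_dist_le _ _ _ _ (subset_closure hyW) ?_
      rw [dist_eq_norm]
      exact (hy.trans_le (hφ.trans (min_le_right _ _))).le
  · refine norm_fderiv_moll_indicator_le φ hαl hL0 hWo.measurableSet fun y h hyh => ?_
    -- a segment that misses the curve lies in one component of its complement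
    by_contra hno
    push Not at hno
    refine hyh ?_
    set J : Set ℂ := (fun σ : ℝ => y + σ * h) '' Icc (0 : ℝ) 1 with hJ
    have hJc : IsPreconnected J := isPreconnected_Icc.image _ (by fun_prop)
    have hJΓ : J ⊆ Γᶜ := by
      rintro _ ⟨σ, hσ, rfl⟩ hmem
      rw [← hαΓ] at hmem
      obtain ⟨s, hs, he⟩ := hmem
      exact hno s hs σ hσ he.symm
    have hyJ : y ∈ J := ⟨0, by simp, by simp⟩
    have hyhJ : y + h ∈ J := ⟨1, by simp, by simp⟩
    constructor <;> intro hm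
    · rw [hW, connectedComponentIn_eq hm]
      exact hJc.subset_connectedComponentIn hyJ hJΓ hyhJ
    · rw [hW, connectedComponentIn_eq hm]
      exact hJc.subset_connectedComponentIn hyhJ hJΓ hyJ

/-- If no potential has energy below `1 / T`, then projecting the origin to the closed convex set of
square integrable upper gradients of potentials gives a density `f` of energy at most `T` whose
product with each of these upper gradients has integral at least one. -/
lemma exists_dual_density {T : ℝ} (hT : 0 < T) (hne : ∃ u, IsSmoothPotential U V u)
    (hno : ∀ u, IsSmoothPotential U V u →
      ¬ ∫⁻ z, ENNReal.ofReal ‖fderiv ℝ u z‖ ^ 2 ≤ ENNReal.ofReal T⁻¹) :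
    ∃ f : ℂ → ℝ, Measurable f ∧ (∀ z, 0 ≤ f z) ∧ MemLp f 2 ∧
      ∫⁻ z, ENNReal.ofReal (f z) ^ 2 ≤ ENNReal.ofReal T ∧
      ∀ u, IsSmoothPotential U V u → ∀ h : ℂ → ℝ, MemLp h 2 → (∀ z, ‖fderiv ℝ u z‖ ≤ h z) →
        1 ≤ ∫⁻ z, ENNReal.ofReal (f z) * ENNReal.ofReal (h z) := by
  let Q : Set (Lp ℝ 2 (volume : Measure ℂ)) :=
    {w | ∃ u, IsSmoothPotential U V u ∧ ∀ᵐ z, ‖fderiv ℝ u z‖ ≤ w z}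
  have hnormsq : ∀ w : Lp ℝ 2 (volume : Measure ℂ),
      ∫⁻ z, ‖w z‖ₑ ^ 2 = ENNReal.ofReal (‖w‖ ^ 2) := fun w => by
    rw [← eLpNorm_two_sq, ENNReal.ofReal_pow (norm_nonneg _), Lp.norm_def,
      ENNReal.ofReal_toReal (Lp.eLpNorm_ne_top w)]
  have hQne : Q.Nonempty := by
    obtain ⟨u, hu⟩ := hne
    obtain ⟨C, hC, hCU, h0⟩ := hu.exists_zero
    have hcs : HasCompactSupport fun z => ‖fderiv ℝ u z‖ :=
      ((HasCompactSupport.intro hC h0).fderiv (𝕜 := ℝ)).norm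
    have hm : MemLp (fun z => ‖fderiv ℝ u z‖) 2 :=
      hu.continuous_norm_fderiv.memLp_of_hasCompactSupport hcs
    exact ⟨hm.toLp _, u, hu, hm.coeFn_toLp.mono fun z hz => hz.ge⟩
  have hQc : Convex ℝ Q := by
    rintro w ⟨u, hu, hw⟩ w' ⟨u', hu', hw'⟩ a b ha hb hab
    refine ⟨_, hu.convex_combination hu' ha hb hab, ?_⟩
    filter_upwards [hw, hw', Lp.coeFn_add (a • w) (b • w'), Lp.coeFn_smul a w,
      Lp.coeFn_smul b w'] with z h1 h2 h3 h4 h5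
    rw [h3, Pi.add_apply, h4, h5, Pi.smul_apply, Pi.smul_apply, smul_eq_mul, smul_eq_mul]
    have hd := hu.contDiff.differentiable (by simp) z
    have hd' := hu'.contDiff.differentiable (by simp) z
    have he : fderiv ℝ (fun z => a * u z + b * u' z) z = a • fderiv ℝ u z + b • fderiv ℝ u' z :=
      ((hd.hasFDerivAt.const_mul a).add (hd'.hasFDerivAt.const_mul b)).fderiv
    rw [he]
    refine (norm_add_le _ _).trans ?_
    rw [norm_smul, norm_smul, Real.norm_eq_abs, Real.norm_eq_abs, abs_of_nonneg ha,
      abs_of_nonneg hb]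
    gcongr
  obtain ⟨v, hv, hvmin⟩ := exists_norm_eq_iInf_of_complete_convex hQne.closure
    isClosed_closure.isComplete hQc.closure 0
  have hvi : ∀ w ∈ Q, ‖v‖ ^ 2 ≤ inner ℝ v w := fun w hw => by
    have := (norm_eq_iInf_iff_real_inner_le_zero hQc.closure hv).1 hvmin w (subset_closure hw)
    rw [zero_sub, inner_neg_left, inner_sub_right, real_inner_self_eq_norm_sq] at this
    linarith
  have hvT : T⁻¹ ≤ ‖v‖ ^ 2 := by
    by_contra! hlt
    have hopen : IsOpen {w : Lp ℝ 2 (volume : Measure ℂ) | ‖w‖ ^ 2 < T⁻¹} :=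
      isOpen_lt (by fun_prop) continuous_const
    obtain ⟨w, hw, u, hu, hwu⟩ := mem_closure_iff.1 hv _ hopen hlt
    refine hno u hu ?_
    calc ∫⁻ z, ENNReal.ofReal ‖fderiv ℝ u z‖ ^ 2 ≤ ∫⁻ z, ‖w z‖ₑ ^ 2 := by
          refine lintegral_mono_ae (hwu.mono fun z hz => ?_)
          rw [Real.enorm_eq_ofReal_abs]
          gcongr
          exact hz.trans (le_abs_self _)
      _ = ENNReal.ofReal (‖w‖ ^ 2) := hnormsq w
      _ ≤ _ := ENNReal.ofReal_le_ofReal (le_of_lt hw)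
  have hv0 : 0 < ‖v‖ ^ 2 := (inv_pos.2 hT).trans_le hvT
  have hvm : Measurable fun z => v z := (Lp.stronglyMeasurable v).measurable
  have hfm : MemLp (fun z => |v z| / ‖v‖ ^ 2) 2 := by
    have h : MemLp (fun z => |v z|) 2 volume := (Lp.memLp v).abs
    simpa only [div_eq_mul_inv] using h.mul_const (‖v‖ ^ 2)⁻¹
  refine ⟨fun z => |v z| / ‖v‖ ^ 2, by fun_prop, fun z => by positivity, hfm, ?_, ?_⟩
  · calc ∫⁻ z, ENNReal.ofReal (|v z| / ‖v‖ ^ 2) ^ 2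
        = ∫⁻ z, ENNReal.ofReal ((‖v‖ ^ 2)⁻¹ ^ 2) * ‖v z‖ₑ ^ 2 := by
          congr 1; ext z
          rw [Real.enorm_eq_ofReal_abs, ENNReal.ofReal_pow (by positivity), ← mul_pow,
            ← ENNReal.ofReal_mul (by positivity), div_eq_inv_mul]
      _ = ENNReal.ofReal ((‖v‖ ^ 2)⁻¹ ^ 2) * ENNReal.ofReal (‖v‖ ^ 2) := by
          rw [lintegral_const_mul' _ _ ENNReal.ofReal_ne_top, hnormsq]
      _ = ENNReal.ofReal (‖v‖ ^ 2)⁻¹ := by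
          rw [← ENNReal.ofReal_mul (by positivity)]
          congr 1; field_simp
      _ ≤ ENNReal.ofReal T := ENNReal.ofReal_le_ofReal (inv_le_of_inv_le₀ hT hvT)
  · intro u hu h hh hle
    have hh0 : ∀ z, 0 ≤ h z := fun z => (norm_nonneg _).trans (hle z)
    have h1 := hvi (hh.toLp h) ⟨u, hu, hh.coeFn_toLp.mono fun z hz => by rw [hz]; exact hle z⟩
    have h2 : inner ℝ v (hh.toLp h) ≤ ∫ z, |v z| * h z := by
      rw [L2.inner_def]
      refine integral_mono_ae (L2.integrable_inner v _) ?_ ?_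
      · exact (Lp.memLp v).abs.integrable_mul hh
      · filter_upwards [hh.coeFn_toLp] with z hz
        rw [hz, real_inner_comm, RCLike.inner_apply, conj_trivial]
        exact mul_le_mul_of_nonneg_right (le_abs_self _) (hh0 z)
    have h3 : 1 ≤ ∫ z, |v z| / ‖v‖ ^ 2 * h z := by
      have : ∀ z, |v z| / ‖v‖ ^ 2 * h z = |v z| * h z / ‖v‖ ^ 2 := fun z => by ring
      simp only [this]
      rw [integral_div, le_div_iff₀ hv0, one_mul]
      exact h1.trans h2
    rw [← ENNReal.ofReal_one]
    refine (ENNReal.ofReal_le_ofReal h3).trans_eq ?_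
    rw [ofReal_integral_eq_lintegral_ofReal (f := fun z => |v z| / ‖v‖ ^ 2 * h z)
      (hfm.integrable_mul hh)
      (Eventually.of_forall fun z => mul_nonneg (by positivity) (hh0 z))]
    congr 1; ext z
    rw [ENNReal.ofReal_mul (by positivity)]

/-- The supremum of a rapidly converging sequence of mollifications of `f` has almost the same
energy as `f`. -/
lemma exists_iSup_lmoll_energy_lt {f : ℂ → ℝ} (hfm : Measurable f) (hf0 : ∀ z, 0 ≤ f z)
    (hf : MemLp f 2) {c : ℝ≥0∞} (hc : ∫⁻ z, ENNReal.ofReal (f z) ^ 2 < c) :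
    ∃ φ : ℕ → ContDiffBump (0 : ℂ), (∀ k, (φ k).rOut ≤ 1 / ((k : ℝ) + 1)) ∧
      ∫⁻ z, (⨆ k, lmoll (φ k) (fun y => ENNReal.ofReal (f y)) z) ^ 2 < c := by
  set F : ℂ → ℝ≥0∞ := fun y => ENNReal.ofReal (f y) with hF
  have hFm : Measurable F := hfm.ennreal_ofReal
  have hfl : LocallyIntegrable f := hf.locallyIntegrable (by norm_num)
  have hroot : ∀ {a b : ℝ≥0∞}, a < b → a ^ (1 / 2 : ℝ) < b ^ (1 / 2 : ℝ) := fun h =>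
    ENNReal.rpow_lt_rpow h (by norm_num)
  obtain ⟨r, hr0, hr⟩ := ENNReal.lt_iff_exists_add_pos_lt.1 (hroot hc)
  obtain ⟨ε, hε0, hε⟩ := ENNReal.exists_pos_sum_of_countable
    (ε := (r : ℝ≥0∞) ^ 2) (by simpa using hr0.ne') ℕ
  have hch : ∀ k : ℕ, ∃ φ : ContDiffBump (0 : ℂ), φ.rOut ≤ 1 / ((k : ℝ) + 1) ∧
      ∫⁻ x, ‖moll φ f x - f x‖ₑ ^ 2 ≤ ε k := by
    intro k
    have hk : ((ε k : ℝ≥0∞) ^ (1 / 2 : ℝ)) ≠ 0 := by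
      simpa using (hε0 k).ne'
    obtain ⟨s, hs, hs'⟩ := exists_eLpNorm_moll_sub_le hfm hf hk
    have hmin : 0 < min s (1 / ((k : ℝ) + 1)) := lt_min hs (by positivity)
    refine ⟨⟨min s (1 / ((k : ℝ) + 1)) / 2, min s (1 / ((k : ℝ) + 1)), by positivity, by linarith⟩,
      min_le_right _ _, ?_⟩
    rw [← eLpNorm_two_sq]
    refine (pow_le_pow_left' (hs' _ (min_le_left _ _)) 2).trans_eq ?_
    rw [← ENNReal.rpow_natCast, ← ENNReal.rpow_mul]; norm_num
  choose φ hφr hφ using hch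
  refine ⟨φ, hφr, ?_⟩
  set g : ℂ → ℝ≥0∞ := fun x => (∑' k, ‖moll (φ k) f x - f x‖ₑ ^ 2) ^ (1 / 2 : ℝ) with hg
  have hmm : ∀ k, Measurable fun x => ‖moll (φ k) f x - f x‖ₑ ^ 2 := fun k => by
    have := (contDiff_moll (φ k) hfl 0).continuous.measurable
    fun_prop
  have hgm : Measurable g := (Measurable.tsum hmm).pow_const _
  have hgsq : ∀ x, g x ^ (2 : ℝ) = ∑' k, ‖moll (φ k) f x - f x‖ₑ ^ 2 := fun x => by
    rw [hg, ← ENNReal.rpow_mul]; norm_num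
  have hgi : ∫⁻ x, g x ^ (2 : ℝ) ≤ (r : ℝ≥0∞) ^ 2 := by
    simp only [hgsq]
    rw [lintegral_tsum fun k => (hmm k).aemeasurable]
    exact (ENNReal.tsum_le_tsum hφ).trans hε.le
  have hsup : ∀ x, ⨆ k, lmoll (φ k) F x ≤ (F + g) x := fun x => by
    refine iSup_le fun k => ?_
    rw [hF, ← ofReal_moll (φ k) hfl hf0]
    have h1 : ENNReal.ofReal (moll (φ k) f x) ≤
        ENNReal.ofReal (f x) + ‖moll (φ k) f x - f x‖ₑ := by
      rw [Real.enorm_eq_ofReal_abs, ← ENNReal.ofReal_add (hf0 x) (abs_nonneg _)]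
      exact ENNReal.ofReal_le_ofReal (by linarith [le_abs_self (moll (φ k) f x - f x)])
    refine h1.trans (add_le_add le_rfl ?_)
    calc ‖moll (φ k) f x - f x‖ₑ = (‖moll (φ k) f x - f x‖ₑ ^ 2) ^ (1 / 2 : ℝ) := by
          rw [← ENNReal.rpow_natCast, ← ENNReal.rpow_mul]; norm_num
      _ ≤ g x := ENNReal.rpow_le_rpow (ENNReal.le_tsum k) (by norm_num)
  have hmink := ENNReal.lintegral_Lp_add_le (μ := volume) (p := 2) hFm.aemeasurable
    hgm.aemeasurable (by norm_num)
  have h2 : (∫⁻ x, (F + g) x ^ (2 : ℝ)) ^ (1 / 2 : ℝ) < c ^ (1 / 2 : ℝ) := by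
    refine hmink.trans_lt (lt_of_le_of_lt (add_le_add (le_of_eq ?_) ?_) hr)
    · simp only [ENNReal.rpow_two]; rfl
    · refine (ENNReal.rpow_le_rpow hgi (by norm_num)).trans_eq ?_
      rw [← ENNReal.rpow_natCast, ← ENNReal.rpow_mul]; norm_num
  have h3 := (ENNReal.rpow_lt_rpow_iff (by norm_num)).1 h2
  refine lt_of_le_of_lt (lintegral_mono fun x => ?_) h3
  rw [ENNReal.rpow_two]
  gcongr
  exact hsup x

/-- There are potentials whose energy is at most the reciprocal of any number below the modulus. -/
theorem exists_isSmoothPotential_energy_le (hU : IsOpen U) (hV : IsPreconnected V)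
    (hVne : V.Nonempty) {T : ℝ} (hT : 0 < T) (hTm : ENNReal.ofReal T < ringModulus U V) :
    ∃ u, IsSmoothPotential U V u ∧
      ∫⁻ z, ENNReal.ofReal ‖fderiv ℝ u z‖ ^ 2 ≤ ENNReal.ofReal T⁻¹ := by
  obtain ⟨z₀, hz₀⟩ := hVne
  by_contra hno
  push Not at hno
  have hno' : ∀ u, IsSmoothPotential U V u →
      ¬ ∫⁻ z, ENNReal.ofReal ‖fderiv ℝ u z‖ ^ 2 ≤ ENNReal.ofReal T⁻¹ := fun u hu =>
    not_le.2 (hno u hu)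
  have hmod : ∀ ρ, IsAdmissible ρ (separatingCurves U V) → ringModulus U V ≤ ∫⁻ z, ρ z ^ 2 :=
    fun ρ hρ => iInf₂_le ρ hρ
  -- if there is no rectifiable separating curve, then the zero density is admissible
  have hne : ∃ u, IsSmoothPotential U V u := by
    by_contra hemp
    have h0 : IsAdmissible (fun _ => 0) (separatingCurves U V) := by
      refine ⟨measurable_const, fun γ hγ hbv => absurd ?_ hemp⟩
      obtain ⟨α, L, -, -, δ, hδ, h⟩ :=
        exists_isSmoothPotential_of_mem_separatingCurves hU hV hz₀ hγ hbv
      obtain ⟨u, hu, -⟩ := h ⟨δ / 2, δ, by positivity, by linarith⟩ le_rfl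
      exact ⟨u, hu⟩
    have := hmod _ h0
    simp only [ne_eq, OfNat.ofNat_ne_zero, not_false_eq_true, zero_pow, lintegral_zero] at this
    exact absurd (hTm.trans_le this) not_lt_zero
  obtain ⟨f, hfm, hf0, hf2, hfT, hdual⟩ := exists_dual_density hT hne hno'
  obtain ⟨φ, hφr, hφ⟩ := exists_iSup_lmoll_energy_lt hfm hf0 hf2 (hfT.trans_lt hTm)
  have hFm : Measurable fun y => ENNReal.ofReal (f y) := hfm.ennreal_ofReal
  refine absurd (hmod _ ⟨Measurable.iSup fun k => measurable_lmoll (φ k) hFm,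
    fun γ hγ hbv => ?_⟩) (not_le.2 hφ)
  obtain ⟨α, L, hα, hint, δ, hδ, h⟩ :=
    exists_isSmoothPotential_of_mem_separatingCurves hU hV hz₀ hγ hbv
  obtain ⟨k, hk⟩ := exists_nat_one_div_lt hδ
  obtain ⟨u, hu, hgrad⟩ := h (φ k) ((hφr k).trans hk.le)
  have hαc := hα.continuous
  have hnc := (φ k).continuous_normed (μ := volume)
  have hhc : Continuous fun x => ∫ s in Icc 0 L, (φ k).normed volume (x - α s) :=
    continuous_parametric_integral_of_continuous
      (f := fun x s => (φ k).normed volume (x - α s)) (by fun_prop) isCompact_Icc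
  have hhs : HasCompactSupport fun x => ∫ s in Icc 0 L, (φ k).normed volume (x - α s) := by
    refine HasCompactSupport.intro (K := Metric.cthickening (φ k).rOut (α '' Icc 0 L))
      (isCompact_Icc.image hαc).cthickening fun x hx => ?_
    refine (setIntegral_congr_fun measurableSet_Icc fun s hs => ?_).trans (integral_zero _ _)
    refine normed_eq_zero_of_rOut_le (φ k) (le_of_not_gt fun hlt => hx ?_)
    refine Metric.mem_cthickening_of_dist_le _ _ _ _ (mem_image_of_mem α hs) ?_
    rw [dist_eq_norm]; exact hlt.le
  have h1 := hdual u hu _ (hhc.memLp_of_hasCompactSupport hhs) hgrad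
  rw [hint]
  have hbw := measurable_bumpWeight (φ k)
  have hαm := hαc.measurable
  calc (1 : ℝ≥0∞) ≤ ∫⁻ z, ENNReal.ofReal (f z) *
        ENNReal.ofReal (∫ s in Icc 0 L, (φ k).normed volume (z - α s)) := h1
    _ = ∫⁻ z, ∫⁻ s in Icc 0 L, ENNReal.ofReal (f z) * bumpWeight (φ k) (z - α s) := by
        congr 1; ext z
        have hc : Continuous fun s => (φ k).normed volume (z - α s) := by fun_prop
        rw [ofReal_integral_eq_lintegral_ofReal hc.continuousOn.integrableOn_Icc
          (Eventually.of_forall fun s => (φ k).nonneg_normed _),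
          lintegral_const_mul' _ _ ENNReal.ofReal_ne_top]
        rfl
    _ = ∫⁻ s in Icc 0 L, ∫⁻ z, ENNReal.ofReal (f z) * bumpWeight (φ k) (z - α s) :=
        lintegral_lintegral_swap (by fun_prop)
    _ = ∫⁻ s in Icc 0 L, lmoll (φ k) (fun y => ENNReal.ofReal (f y)) (α s) := by
        congr 1; ext s
        rw [lmoll, ← lintegral_sub_left_eq_self _ (α s)]
        congr 1; ext t
        rw [mul_comm, sub_sub_cancel_left, bumpWeight, (φ k).normed_neg, bumpWeight]
    _ ≤ _ := lintegral_mono fun s => le_iSup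
        (fun k => lmoll (φ k) (fun y => ENNReal.ofReal (f y)) (α s)) k

end UpperBound

/-! ### Fibres of holomorphic maps -/

section Fibres

open Filter Topology

variable {g : ℂ → ℂ} {U U' : Set ℂ}

lemma hasStrictDerivAt_of_differentiableOn (hU : IsOpen U) (hg : DifferentiableOn ℂ g U) {z : ℂ}
    (hz : z ∈ U) : HasStrictDerivAt g (deriv g z) z :=
  (hg.analyticAt (hU.mem_nhds hz)).hasStrictDerivAt

/-- The set of regular points is a countable disjoint union of measurable sets on which the map is
injective. -/
lemma exists_partition_injOn (hU : IsOpen U) (hg : DifferentiableOn ℂ g U) :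
    ∃ E : ℕ → Set ℂ, (∀ n, MeasurableSet (E n)) ∧ Pairwise (Function.onFun Disjoint E) ∧
      (∀ n, InjOn g (E n)) ∧ ⋃ n, E n = {z | z ∈ U ∧ deriv g z ≠ 0} := by
  set R : Set ℂ := {z | z ∈ U ∧ deriv g z ≠ 0} with hR
  have hRm : MeasurableSet R :=
    hU.measurableSet.inter ((measurable_deriv g) (measurableSet_singleton 0)).compl
  have hloc : ∀ z ∈ R, ∃ B, IsOpen B ∧ z ∈ B ∧ InjOn g B := fun z hz => by
    have h := ((hasStrictDerivAt_of_differentiableOn hU hg hz.1).hasStrictFDerivAt_equiv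
      hz.2).eventually_left_inverse
    obtain ⟨B, hB, hBo, hzB⟩ := eventually_nhds_iff.1 h
    exact ⟨B, hBo, hzB, LeftInvOn.injOn (f₁' := HasStrictFDerivAt.localInverse _ _ _ _) hB⟩
  choose! B hBo hBz hBi using hloc
  obtain ⟨t, htR, htc, hcov⟩ := TopologicalSpace.countable_cover_nhdsWithin
    fun z hz => mem_nhdsWithin_of_mem_nhds ((hBo z hz).mem_nhds (hBz z hz))
  rcases t.eq_empty_or_nonempty with rfl | hne
  · refine ⟨fun _ => ∅, fun _ => MeasurableSet.empty, fun _ _ _ => disjoint_bot_left,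
      fun _ => injOn_empty _, ?_⟩
    have : R ⊆ ∅ := hcov.trans (by simp)
    rw [subset_empty_iff.1 this, iUnion_empty]
  obtain ⟨e, he⟩ := htc.exists_eq_range hne
  have heR : ∀ n, e n ∈ R := fun n => htR (he ▸ mem_range_self n)
  refine ⟨disjointed fun n => B (e n) ∩ R, fun n => MeasurableSet.disjointed (fun k =>
    (hBo _ (heR k)).measurableSet.inter hRm) n, disjoint_disjointed _, fun n =>
    ((hBi _ (heR n)).mono inter_subset_left).mono (disjointed_subset _ n), ?_⟩
  rw [iUnion_disjointed, ← iUnion_inter]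
  refine inter_eq_right.2 (hcov.trans ?_)
  rw [he, biUnion_range]

/-- Change of variables with multiplicity. -/
lemma lintegral_tsum_fibre (hU : IsOpen U) (hg : DifferentiableOn ℂ g U) {H : ℂ → ℝ≥0∞}
    (hH : Measurable H) :
    ∫⁻ w, ∑' z : {z | (z ∈ U ∧ deriv g z ≠ 0) ∧ g z = w}, H z =
      ∫⁻ z in U, ENNReal.ofReal (‖deriv g z‖ ^ 2) * H z := by
  obtain ⟨E, hEm, hEd, hEi, hEU⟩ := exists_partition_injOn hU hg
  have hEsub : ∀ n, ∀ z ∈ E n, z ∈ U ∧ deriv g z ≠ 0 := fun n z hz =>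
    (hEU ▸ mem_iUnion_of_mem n hz : z ∈ {z | z ∈ U ∧ deriv g z ≠ 0})
  have hemb : ∀ n, MeasurableEmbedding ((E n).domRestrict g) := fun n =>
    ContinuousOn.measurableEmbedding (hEm n)
      (hg.continuousOn.mono fun z hz => (hEsub n z hz).1) (hEi n)
  -- the transplant of `H` from `E n` to its image
  let A : ℕ → ℂ → ℝ≥0∞ := fun n =>
    Function.extend ((E n).domRestrict g) (fun z => H z) fun _ => 0
  have hAm : ∀ n, Measurable (A n) := fun n =>
    (hemb n).measurable_extend (hH.comp measurable_subtype_coe) measurable_const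
  have hA1 : ∀ n, ∀ z ∈ E n, A n (g z) = H z := fun n z hz =>
    (hemb n).injective.extend_apply (fun z : E n => H z) (fun _ => 0) ⟨z, hz⟩
  have hA0 : ∀ n, ∀ w ∉ g '' E n, A n w = 0 := fun n w hw =>
    Function.extend_apply' _ _ _ fun ⟨z, hz⟩ => hw ⟨z, z.2, hz⟩
  have hsum : ∀ w, ∑' z : {z | (z ∈ U ∧ deriv g z ≠ 0) ∧ g z = w}, H z = ∑' n, A n w := by
    intro w
    have h1 : ∀ z : {z | (z ∈ U ∧ deriv g z ≠ 0) ∧ g z = w},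
        H z = ∑' n, (E n).indicator H z := fun z => by
      have hz : (z : ℂ) ∈ ⋃ n, E n := hEU ▸ z.2.1
      obtain ⟨n, hn⟩ := mem_iUnion.1 hz
      rw [tsum_eq_single n, indicator_of_mem hn]
      exact fun m hm => indicator_of_notMem
        (fun hzm => Set.disjoint_left.1 (hEd hm) hzm hn) _
    simp only [h1]
    rw [ENNReal.tsum_comm]
    congr 1; ext n
    by_cases hw : w ∈ g '' E n
    · obtain ⟨z, hz, rfl⟩ := hw
      rw [hA1 n z hz, tsum_eq_single ⟨z, hEsub n z hz, rfl⟩, indicator_of_mem hz]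
      intro z' hz'
      refine indicator_of_notMem (fun hmem => hz' (Subtype.ext ?_)) _
      exact hEi n hmem hz z'.2.2
    · rw [hA0 n w hw]
      refine ENNReal.tsum_eq_zero.2 fun z => indicator_of_notMem (fun hmem => hw ?_) _
      exact ⟨z, hmem, z.2.2⟩
  simp only [hsum]
  rw [lintegral_tsum fun n => (hAm n).aemeasurable]
  have hn : ∀ n, ∫⁻ w, A n w = ∫⁻ z in E n, ENNReal.ofReal (‖deriv g z‖ ^ 2) * H z := fun n => by
    have himg : MeasurableSet (g '' E n) := (hEm n).image_of_continuousOn_injOn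
      (hg.continuousOn.mono fun z hz => (hEsub n z hz).1) (hEi n)
    rw [← setLIntegral_eq_of_support_subset (s := g '' E n) (fun w hw => by
      by_contra h; exact hw (hA0 n w h)),
      lintegral_image_of_hasDerivAt (hEm n) (fun z hz =>
        (hasStrictDerivAt_of_differentiableOn hU hg (hEsub n z hz).1).hasDerivAt) (hEi n)]
    exact setLIntegral_congr_fun (hEm n) fun z hz => by simp only [hA1 n z hz]
  simp only [hn]
  rw [← lintegral_iUnion hEm hEd, hEU]
  have hRm : MeasurableSet {z | z ∈ U ∧ deriv g z ≠ 0} := hEU ▸ MeasurableSet.iUnion hEm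
  rw [← lintegral_indicator hRm, ← lintegral_indicator hU.measurableSet]
  congr 1; ext z
  by_cases hz : z ∈ U
  · by_cases hd : deriv g z = 0 <;> simp [hz, hd]
  · simp [hz]

lemma not_eventually_eq_of_finite_fibres (hU : IsOpen U) (hUc : IsPreconnected U)
    (hg : DifferentiableOn ℂ g U) (hfin : ∀ w, (U ∩ g ⁻¹' {w}).Finite) {z : ℂ} (hz : z ∈ U) (w : ℂ) :
    ¬ ∀ᶠ y in 𝓝 z, g y = w := fun h => by
  have := (hg.analyticOnNhd hU).eqOn_of_preconnected_of_eventuallyEq analyticOnNhd_const hUc hz h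
  refine infinite_of_mem_nhds z (hU.mem_nhds hz) ((hfin w).subset fun y hy => ⟨hy, this hy⟩)

lemma countable_critical_points (hU : IsOpen U) (hUc : IsPreconnected U)
    (hg : DifferentiableOn ℂ g U) (hfin : ∀ w, (U ∩ g ⁻¹' {w}).Finite) :
    {z | z ∈ U ∧ deriv g z = 0}.Countable := by
  have hda : AnalyticOnNhd ℂ (deriv g) U := (hg.analyticOnNhd hU).deriv
  have hloc : ∀ z ∈ U, {y | y = z ∨ deriv g y ≠ 0} ∈ 𝓝[U] z := fun z hz => by
    refine mem_nhdsWithin_of_mem_nhds ?_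
    rcases (hda z hz).eventually_eq_zero_or_eventually_ne_zero with h | h
    · exfalso
      have h0 := hda.eqOn_zero_of_preconnected_of_eventuallyEq_zero hUc hz h
      refine not_eventually_eq_of_finite_fibres hU hUc hg hfin hz (g z) ?_
      filter_upwards [hU.mem_nhds hz] with y hy
      exact hU.is_const_of_deriv_eq_zero hUc hg h0 hy hz
    · rw [eventually_nhdsWithin_iff] at h
      filter_upwards [h] with y hy
      by_cases hyz : y = z
      · exact Or.inl hyz
      · exact Or.inr (hy hyz)
  obtain ⟨t, -, htc, hcov⟩ := TopologicalSpace.countable_cover_nhdsWithin hloc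
  refine htc.mono fun z hz => ?_
  obtain ⟨x, hx, hzx⟩ := mem_iUnion₂.1 (hcov hz.1)
  rcases hzx with rfl | h
  · exact hx
  · exact absurd hz.2 h

lemma HasDegree.finite_fibre {D : ℕ} (hD : HasDegree g U U' D) (hmaps : MapsTo g U U') (w : ℂ) :
    (U ∩ g ⁻¹' {w}).Finite := by
  by_cases hw : w ∈ U'
  · exact (hD w hw).1
  · convert finite_empty
    refine eq_empty_of_forall_notMem fun z hz => hw ?_
    rw [← show g z = w from hz.2]; exact hmaps hz.1

/-- A fibre has at most `D` points. -/
lemma HasDegree.encard_fibre_le {D : ℕ} (hD : HasDegree g U U' D) (hmaps : MapsTo g U U')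
    (hU : IsOpen U) (hUc : IsPreconnected U) (hg : DifferentiableOn ℂ g U) (w : ℂ) :
    (U ∩ g ⁻¹' {w}).encard ≤ D := by
  have hfin := hD.finite_fibre hmaps
  by_cases hw : w ∈ U'
  · have h := (hD w hw).2
    rw [finsum_mem_eq_finite_toFinset_sum _ (hfin w)] at h
    rw [(hfin w).encard_eq_coe_toFinset_card, ← h]
    norm_cast
    rw [Finset.card_eq_sum_ones]
    refine Finset.sum_le_sum fun z hz => ?_
    obtain ⟨hzU, hzw⟩ := (hfin w).mem_toFinset.1 hz
    have han : AnalyticAt ℂ (fun ζ => g ζ - w) z :=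
      (hg.analyticAt (hU.mem_nhds hzU)).sub analyticAt_const
    have h0 : analyticOrderAt (fun ζ => g ζ - w) z ≠ 0 :=
      han.analyticOrderAt_ne_zero.2 (sub_eq_zero.2 hzw)
    have htop : analyticOrderAt (fun ζ => g ζ - w) z ≠ ⊤ := fun h => by
      refine not_eventually_eq_of_finite_fibres hU hUc hg hfin hzU w ?_
      filter_upwards [analyticOrderAt_eq_top.1 h] with y hy
      exact sub_eq_zero.1 hy
    rw [Nat.one_le_iff_ne_zero, analyticOrderNatAt, Ne, ENat.toNat_eq_zero, not_or]
    exact ⟨h0, htop⟩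
  · have : U ∩ g ⁻¹' {w} = ∅ := eq_empty_of_forall_notMem fun z hz => hw (by
      rw [← show g z = w from hz.2]; exact hmaps hz.1)
    rw [this, encard_empty]
    exact zero_le

lemma isCompact_inter_preimage {hmaps : MapsTo g U U'} (hproper : IsProperMap (hmaps.restrict g U U'))
    {K : Set ℂ} (hK : IsCompact K) (hKU : K ⊆ U') : IsCompact (U ∩ g ⁻¹' K) := by
  have h1 : IsCompact ((↑) ⁻¹' K : Set U') :=
    Topology.IsInducing.subtypeVal.isCompact_preimage_iff
      (by rw [Subtype.range_coe]; exact hKU) |>.2 hK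
  have h2 := (hproper.isCompact_preimage h1).image continuous_subtype_val
  convert h2 using 1
  ext z
  constructor
  · rintro ⟨hz, hzK⟩
    exact ⟨⟨z, hz⟩, hzK, rfl⟩
  · rintro ⟨z, hz, rfl⟩
    exact ⟨z.2, hz⟩

/-- A neighbourhood of a fibre of a proper map contains the nearby fibres. -/
lemma eventually_fibre_subset {hmaps : MapsTo g U U'} (hproper : IsProperMap (hmaps.restrict g U U'))
    (hU' : IsOpen U') {w : ℂ} (hw : w ∈ U') {O : Set ℂ} (hO : IsOpen O)
    (hwO : U ∩ g ⁻¹' {w} ⊆ O) : ∀ᶠ w' in 𝓝 w, U ∩ g ⁻¹' {w'} ⊆ O := by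
  have hcl := hproper.isClosedMap ((↑) ⁻¹' Oᶜ) (hO.isClosed_compl.preimage continuous_subtype_val)
  have hopen := (hU'.isOpenMap_subtype_val _ hcl.isOpen_compl).mem_nhds
    (⟨⟨w, hw⟩, fun ⟨z, hz, hzw⟩ => hz (hwO ⟨z.2, congrArg Subtype.val hzw⟩), rfl⟩ :
      w ∈ Subtype.val '' (hmaps.restrict g U U' '' ((↑) ⁻¹' Oᶜ))ᶜ)
  filter_upwards [hopen] with w' hw' z hz
  obtain ⟨y, hy, rfl⟩ := hw'
  by_contra hzO
  exact hy ⟨⟨z, hz.1⟩, hzO, Subtype.ext hz.2⟩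

/-- Over a regular value, a proper holomorphic map has local sections through the points of the
fibre, whose values are exactly the points of the nearby fibres. -/
lemma exists_local_sections {hmaps : MapsTo g U U'} (hproper : IsProperMap (hmaps.restrict g U U'))
    (hU : IsOpen U) (hg : DifferentiableOn ℂ g U) (hfin : ∀ w, (U ∩ g ⁻¹' {w}).Finite)
    (hU' : IsOpen U') {w : ℂ} (hw : w ∈ U') (hreg : ∀ z ∈ U ∩ g ⁻¹' {w}, deriv g z ≠ 0) :
    ∃ h : ℂ → ℂ → ℂ,
      (∀ z ∈ U ∩ g ⁻¹' {w}, h z w = z ∧ HasDerivAt (h z) (deriv g z)⁻¹ w) ∧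
      ∀ᶠ w' in 𝓝 w, U ∩ g ⁻¹' {w'} = (fun z => h z w') '' (U ∩ g ⁻¹' {w}) ∧
        InjOn (fun z => h z w') (U ∩ g ⁻¹' {w}) := by
  set F := U ∩ g ⁻¹' {w} with hF
  have hloc : ∀ z ∈ F, ∃ h : ℂ → ℂ, (h w = z ∧ HasDerivAt h (deriv g z)⁻¹ w) ∧
      (∀ᶠ x in 𝓝 z, h (g x) = x) ∧ ∀ᶠ y in 𝓝 w, g (h y) = y := fun z hz => by
    have hd := hasStrictDerivAt_of_differentiableOn hU hg hz.1
    have hzw : g z = w := hz.2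
    have h1 := (hd.to_localInverse (hreg z hz)).hasDerivAt
    have h2 := (hd.hasStrictFDerivAt_equiv (hreg z hz)).eventually_left_inverse
    have h3 := (hd.hasStrictFDerivAt_equiv (hreg z hz)).eventually_right_inverse
    have h4 := (hd.hasStrictFDerivAt_equiv (hreg z hz)).localInverse_apply_image
    rw [hzw] at h1 h3 h4
    exact ⟨_, ⟨h4, h1⟩, h2, h3⟩
  choose! h hh hleft hright using hloc
  refine ⟨h, hh, ?_⟩
  have hcont : ∀ z ∈ F, Tendsto (h z) (𝓝 w) (𝓝 z) := fun z hz => by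
    have := (hh z hz).2.continuousAt.tendsto
    rwa [(hh z hz).1] at this
  have hsub : ∀ᶠ w' in 𝓝 w, U ∩ g ⁻¹' {w'} ⊆ ⋃ z ∈ F, interior {x | h z (g x) = x} :=
    eventually_fibre_subset hproper hU' hw (isOpen_biUnion fun z _ => isOpen_interior) fun z hz =>
      mem_iUnion₂.2 ⟨z, hz, mem_interior_iff_mem_nhds.2 (hleft z hz)⟩
  have h1 : ∀ᶠ w' in 𝓝 w, ∀ z ∈ F, h z w' ∈ U ∧ g (h z w') = w' :=
    (eventually_all_finite (hfin w)).2 fun z hz =>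
      ((hcont z hz).eventually (hU.mem_nhds hz.1)).and (hright z hz)
  have h2 : ∀ᶠ w' in 𝓝 w, ∀ z ∈ F, ∀ z' ∈ F, z ≠ z' → h z w' ≠ h z' w' :=
    (eventually_all_finite (hfin w)).2 fun z hz => (eventually_all_finite (hfin w)).2 fun z' hz' => by
      by_cases hne : z = z'
      · exact Eventually.of_forall fun _ h => absurd hne h
      · exact (((hcont z hz).sub (hcont z' hz')).eventually_ne (sub_ne_zero.2 hne)).mono
          fun _ h _ => sub_ne_zero.1 h
  filter_upwards [hsub, h1, h2] with w' hw1 hw2 hw3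
  refine ⟨Subset.antisymm (fun x hx => ?_) ?_, fun z hz z' hz' he => ?_⟩
  · obtain ⟨z, hz, hxz⟩ := mem_iUnion₂.1 (hw1 hx)
    refine ⟨z, hz, ?_⟩
    have := interior_subset hxz
    rw [mem_ofPred_eq, show g x = w' from hx.2] at this
    exact this
  · rintro _ ⟨z, hz, rfl⟩
    exact hw2 z hz
  · by_contra hne
    exact hw3 z hz z' hz' hne he

end Fibres

/-! ### Transport of potentials by proper holomorphic maps -/

section Transport

open Filter Topology

variable {g : ℂ → ℂ} {U U' : Set ℂ}

lemma measurable_of_continuousAt_compl_countable {f : ℂ → ℝ} {S : Set ℂ} (hS : S.Countable)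
    (h : ∀ z ∉ S, ContinuousAt f z) : Measurable f := by
  refine measurable_of_isOpen fun t ht => ?_
  obtain ⟨v, hv, hvt⟩ := continuousOn_iff'.1
    ((fun z hz => (h z hz).continuousWithinAt) : ContinuousOn f Sᶜ) t ht
  have : f ⁻¹' t = (v ∩ Sᶜ) ∪ (f ⁻¹' t ∩ S) := by
    rw [← hvt, ← inter_union_distrib_left, compl_union_self, inter_univ]
  rw [this]
  exact (hv.measurableSet.inter hS.measurableSet.compl).union
    (hS.mono inter_subset_right).measurableSet

lemma slopeLE_of_eventually_eq_const {u : ℂ → ℝ} {c : ℝ} {z : ℂ} (h : ∀ᶠ y in 𝓝 z, u y = c) :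
    SlopeLE u 0 z := fun c' hc' => by
  filter_upwards [h] with y hy
  rw [hy, h.self_of_nhds, sub_self, abs_zero]
  exact mul_nonneg (le_of_lt hc') (norm_nonneg _)

/-- The composition of a potential with a proper holomorphic map is a potential. -/
lemma IsSmoothPotential.pullback {hmaps : MapsTo g U U'}
    (hproper : IsProperMap (hmaps.restrict g U U')) (hU : IsOpen U) (hg : DifferentiableOn ℂ g U)
    {V V' : Set ℂ} (hV'c : IsCompact (closure V')) (hV' : closure V' ⊆ U')
    (hVV' : V ⊆ U ∩ g ⁻¹' V') {u : ℂ → ℝ} (hu : IsSmoothPotential U' V' u) :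
    IsPotential U V (U.indicator fun z => u (g z))
      (U.indicator fun z => ‖fderiv ℝ u (g z)‖ * ‖deriv g z‖) ∅ := by
  obtain ⟨N, hN, hVN, h1⟩ := hu.exists_one
  obtain ⟨C, hC, hCU, h0⟩ := hu.exists_zero
  have hK := isCompact_inter_preimage hproper hC hCU
  have hKV := isCompact_inter_preimage hproper hV'c hV'
  have hf0 : ∀ z ∉ C, fderiv ℝ u z = 0 := fun z hz => by
    have : u =ᶠ[𝓝 z] fun _ => 0 := by
      filter_upwards [hC.isClosed.isOpen_compl.mem_nhds hz] with y hy using h0 y hy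
    rw [this.fderiv_eq]; simp
  have hz0 : ∀ z ∉ U ∩ g ⁻¹' C, U.indicator (fun z => u (g z)) z = 0 ∧
      U.indicator (fun z => ‖fderiv ℝ u (g z)‖ * ‖deriv g z‖) z = 0 := fun z hz => by
    by_cases hzU : z ∈ U
    · have : g z ∉ C := fun h => hz ⟨hzU, h⟩
      simp [hzU, h0 _ this, hf0 _ this]
    · simp [hzU]
  have hd : ∀ z ∈ U, HasDerivAt g (deriv g z) z := fun z hz =>
    (hasStrictDerivAt_of_differentiableOn hU hg hz).hasDerivAt
  have hslope : ∀ z, ContinuousAt (U.indicator fun z => ‖fderiv ℝ u (g z)‖ * ‖deriv g z‖) z ∧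
      SlopeLE (U.indicator fun z => u (g z))
        (U.indicator (fun z => ‖fderiv ℝ u (g z)‖ * ‖deriv g z‖) z) z := by
    intro z
    by_cases hz : z ∈ U
    · have hev : ∀ {f : ℂ → ℝ}, U.indicator f =ᶠ[𝓝 z] f := fun {f} => by
        filter_upwards [hU.mem_nhds hz] with y hy using indicator_of_mem hy f
      constructor
      · refine ContinuousAt.congr ?_ hev.symm
        have hdg : ContinuousAt (deriv g) z :=
          (hg.deriv hU).continuousOn.continuousAt (hU.mem_nhds hz)
        exact (hu.continuous_norm_fderiv.continuousAt.comp (hd z hz).continuousAt).mul hdg.norm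
      · rw [indicator_of_mem hz]
        intro c hc
        filter_upwards [(hu.slopeLE (g z)).comp (norm_nonneg _) (hd z hz) c hc, hU.mem_nhds hz]
          with y hy hyU
        rwa [indicator_of_mem hyU, indicator_of_mem hz]
    · have hev : ∀ᶠ y in 𝓝 z, y ∉ U ∩ g ⁻¹' C :=
        hK.isClosed.isOpen_compl.mem_nhds fun h => hz h.1
      constructor
      · exact continuousAt_const.congr (hev.mono fun y hy => (hz0 y hy).2.symm)
      · rw [indicator_of_notMem hz]
        exact slopeLE_of_eventually_eq_const (hev.mono fun y hy => (hz0 y hy).1)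
  refine ⟨measurable_of_continuousAt_compl_countable countable_empty fun z _ =>
      (hslope z).2.continuousAt, measurable_of_continuousAt_compl_countable countable_empty
      fun z _ => (hslope z).1, fun z => indicator_nonneg (fun _ _ => hu.nonneg _) z,
    fun z => ?_, fun z => indicator_nonneg (fun _ _ => by positivity) z,
    ⟨U ∩ g ⁻¹' N, hg.continuousOn.isOpen_inter_preimage hU hN, ?_, fun z hz => ?_⟩,
    ⟨U ∩ g ⁻¹' C, hK, inter_subset_left, fun z hz => (hz0 z hz).1⟩, countable_empty,
    fun z _ => (hslope z).1, fun z _ => (hslope z).2⟩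
  · by_cases hz : z ∈ U <;> simp [hz, hu.le_one]
  · exact (closure_minimal (hVV'.trans (inter_subset_inter_right _
      (preimage_mono subset_closure))) hKV.isClosed).trans
      (inter_subset_inter_right _ (preimage_mono hVN))
  · rw [indicator_of_mem hz.1, h1 _ hz.2]

/-- A map of degree `D` multiplies the energy of a potential at most by `D`. -/
lemma energy_pullback_le {D : ℕ} (hD : HasDegree g U U' D) (hmaps : MapsTo g U U') (hU : IsOpen U)
    (hUc : IsPreconnected U) (hg : DifferentiableOn ℂ g U) {q : ℂ → ℝ} (hq : Measurable q) :
    ∫⁻ z, ENNReal.ofReal (U.indicator (fun z => q (g z) * ‖deriv g z‖) z) ^ 2 ≤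
      D * ∫⁻ w, ENNReal.ofReal (q w) ^ 2 := by
  classical
  set g' : ℂ → ℂ := U.indicator g with hg'
  have hg'm : Measurable g' := by
    rw [hg', ← piecewise_eq_indicator]
    exact hg.continuousOn.measurable_piecewise continuousOn_const hU.measurableSet
  have hH : Measurable fun z => ENNReal.ofReal (q (g' z)) ^ 2 := by fun_prop
  calc _ = ∫⁻ z in U, ENNReal.ofReal (‖deriv g z‖ ^ 2) * ENNReal.ofReal (q (g' z)) ^ 2 := by
        rw [← lintegral_indicator hU.measurableSet]
        congr 1; ext z
        by_cases hz : z ∈ U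
        · rw [indicator_of_mem hz, indicator_of_mem hz, hg', indicator_of_mem hz, mul_comm (q _),
            ENNReal.ofReal_mul (norm_nonneg _), mul_pow, ENNReal.ofReal_pow (norm_nonneg _)]
        · simp [hz]
    _ = ∫⁻ w, ∑' z : {z | (z ∈ U ∧ deriv g z ≠ 0) ∧ g z = w}, ENNReal.ofReal (q (g' z)) ^ 2 :=
        (lintegral_tsum_fibre hU hg hH).symm
    _ ≤ ∫⁻ w, D * ENNReal.ofReal (q w) ^ 2 := by
        refine lintegral_mono fun w => ?_
        have : ∀ z : {z | (z ∈ U ∧ deriv g z ≠ 0) ∧ g z = w},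
            ENNReal.ofReal (q (g' z)) ^ 2 = ENNReal.ofReal (q w) ^ 2 := fun z => by
          rw [hg', indicator_of_mem z.2.1.1, z.2.2]
        simp only [this]
        rw [ENNReal.tsum_set_const]
        gcongr
        have h1 : {z | (z ∈ U ∧ deriv g z ≠ 0) ∧ g z = w}.encard ≤ (D : ℕ∞) :=
          (encard_le_encard (t := U ∩ g ⁻¹' {w}) fun z hz => ⟨hz.1.1, hz.2⟩).trans
            (hD.encard_fibre_le hmaps hU hUc hg w)
        exact_mod_cast ENat.toENNReal_le.2 h1
    _ = _ := lintegral_const_mul _ (by fun_prop)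

/-- The supremum of `u` over the points of the fibre; it is zero if the fibre is empty. -/
noncomputable def fibreSup (g : ℂ → ℂ) (U : Set ℂ) (u : ℂ → ℝ) (w : ℂ) : ℝ :=
  sSup (u '' (U ∩ g ⁻¹' {w}))

/-- The Euclidean norm of the values of `q` at the points of the fibre. -/
noncomputable def fibreNorm (g : ℂ → ℂ) (U : Set ℂ) (q : ℂ → ℝ) (w : ℂ) : ℝ :=
  √(∑ᶠ z ∈ U ∩ g ⁻¹' {w}, q z ^ 2)

lemma abs_sSup_image_sub_le {F : Set ℂ} (hF : F.Finite) {a b : ℂ → ℝ} {ε : ℝ} (hε : 0 ≤ ε)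
    (h : ∀ z ∈ F, |a z - b z| ≤ ε) : |sSup (a '' F) - sSup (b '' F)| ≤ ε := by
  rcases F.eq_empty_or_nonempty with rfl | hne
  · simpa using hε
  have key : ∀ a b : ℂ → ℝ, (∀ z ∈ F, |a z - b z| ≤ ε) → sSup (a '' F) ≤ sSup (b '' F) + ε := by
    intro a b h
    refine csSup_le (hne.image a) ?_
    rintro _ ⟨z, hz, rfl⟩
    have := le_csSup (hF.image b).bddAbove (mem_image_of_mem b hz)
    have := (abs_le.1 (h z hz)).2
    linarith
  have h1 := key a b h
  have h2 := key b a fun z hz => by rw [abs_sub_comm]; exact h z hz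
  exact abs_le.2 ⟨by linarith, by linarith⟩

lemma le_fibreNorm {q : ℂ → ℝ} {w : ℂ} (hfin : (U ∩ g ⁻¹' {w}).Finite) {z : ℂ}
    (hz : z ∈ U ∩ g ⁻¹' {w}) : q z ≤ fibreNorm g U q w := by
  refine (le_abs_self _).trans ?_
  rw [← Real.sqrt_sq_eq_abs, fibreNorm, finsum_mem_eq_finite_toFinset_sum _ hfin]
  refine Real.sqrt_le_sqrt ?_
  exact Finset.single_le_sum (f := fun z => q z ^ 2) (fun _ _ => sq_nonneg _)
    (hfin.mem_toFinset.2 hz)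

/-- The image of a potential under a proper holomorphic map: its value at a point is the supremum
of the values over the fibre. -/
lemma IsSmoothPotential.pushforward {hmaps : MapsTo g U U'}
    (hproper : IsProperMap (hmaps.restrict g U U')) (hU : IsOpen U) (hUc : IsPreconnected U)
    (hg : DifferentiableOn ℂ g U) (hfin : ∀ w, (U ∩ g ⁻¹' {w}).Finite) (hU' : IsOpen U')
    {V : Set ℂ} (hVc : IsCompact (closure V)) (hV : closure V ⊆ U) {u : ℂ → ℝ}
    (hu : IsSmoothPotential U V u) :
    IsPotential U' (g '' V) (fibreSup g U u) (fibreNorm g U fun z => ‖fderiv ℝ u z‖ / ‖deriv g z‖)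
      (g '' {z | z ∈ U ∧ deriv g z = 0}) := by
  obtain ⟨N, hN, hVN, h1⟩ := hu.exists_one
  obtain ⟨C, hC, hCU, h0⟩ := hu.exists_zero
  set S := g '' {z | z ∈ U ∧ deriv g z = 0} with hS
  have hSc : S.Countable := (countable_critical_points hU hUc hg hfin).image g
  set q : ℂ → ℝ := fun z => ‖fderiv ℝ u z‖ / ‖deriv g z‖ with hq
  have hCg : IsCompact (g '' C) := hC.image_of_continuousOn (hg.continuousOn.mono hCU)
  have hf0 : ∀ z ∉ C, fderiv ℝ u z = 0 := fun z hz => by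
    have : u =ᶠ[𝓝 z] fun _ => 0 := by
      filter_upwards [hC.isClosed.isOpen_compl.mem_nhds hz] with y hy using h0 y hy
    rw [this.fderiv_eq]; simp
  have hoff : ∀ w ∉ g '' C, fibreSup g U u w = 0 ∧ fibreNorm g U q w = 0 := fun w hw => by
    have hzC : ∀ z ∈ U ∩ g ⁻¹' {w}, z ∉ C := fun z hz h => hw ⟨z, h, hz.2⟩
    constructor
    · refine le_antisymm (Real.sSup_le ?_ le_rfl) (Real.sSup_nonneg ?_)
      · rintro _ ⟨z, hz, rfl⟩; exact (h0 z (hzC z hz)).le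
      · rintro _ ⟨z, -, rfl⟩; exact hu.nonneg z
    · rw [fibreNorm, finsum_mem_congr rfl (g := fun _ => (0 : ℝ)) fun z hz => by
        simp [hq, hf0 z (hzC z hz)], finsum_mem_zero, Real.sqrt_zero]
  have hslope : ∀ w ∉ S, ContinuousAt (fibreNorm g U q) w ∧
      SlopeLE (fibreSup g U u) (fibreNorm g U q w) w := by
    intro w hwS
    by_cases hw : w ∈ g '' C
    · have hwU : w ∈ U' := by
        obtain ⟨z, hz, rfl⟩ := hw
        exact hmaps (hCU hz)
      have hreg : ∀ z ∈ U ∩ g ⁻¹' {w}, deriv g z ≠ 0 := fun z hz h => hwS ⟨z, ⟨hz.1, h⟩, hz.2⟩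
      obtain ⟨h, hh, hev⟩ := exists_local_sections hproper hU hg hfin hU' hwU hreg
      have hhc : ∀ z ∈ U ∩ g ⁻¹' {w}, ContinuousAt (h z) w := fun z hz => (hh z hz).2.continuousAt
      set F := U ∩ g ⁻¹' {w} with hF
      have hFf : F.Finite := hfin w
      constructor
      · have heq : fibreNorm g U q =ᶠ[𝓝 w] fun w' => √(∑ z ∈ hFf.toFinset, q (h z w') ^ 2) := by
          filter_upwards [hev] with w' hw'
          rw [fibreNorm, hw'.1, finsum_mem_image hw'.2, finsum_mem_eq_finite_toFinset_sum _ hFf]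
        refine ContinuousAt.congr ?_ heq.symm
        refine Real.continuous_sqrt.continuousAt.comp ?_
        refine tendsto_finsetSum _ fun z hz => ?_
        rw [hFf.mem_toFinset] at hz
        have hqc : ContinuousAt q z := by
          have hdg : ContinuousAt (deriv g) z :=
            (hg.deriv hU).continuousOn.continuousAt (hU.mem_nhds hz.1)
          exact hu.continuous_norm_fderiv.continuousAt.div hdg.norm
            (norm_ne_zero_iff.2 (hreg z hz))
        have hqc' : ContinuousAt q (h z w) := by rwa [(hh z hz).1]
        exact (hqc'.comp (hhc z hz)).pow 2
      · intro c hc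
        have hz : ∀ z ∈ F, ∀ᶠ w' in 𝓝 w, |u (h z w') - u (h z w)| ≤ c * ‖w' - w‖ := fun z hz => by
          have hs : SlopeLE u ‖fderiv ℝ u z‖ (h z w) := by
            rw [(hh z hz).1]; exact hu.slopeLE z
          refine hs.comp (norm_nonneg _) (hh z hz).2 c (lt_of_le_of_lt ?_ hc)
          rw [norm_inv, ← div_eq_mul_inv]
          exact le_fibreNorm (q := q) hFf hz
        filter_upwards [hev, (eventually_all_finite hFf).2 hz] with w' hw' hz'
        have hc0 : 0 ≤ c := (Real.sqrt_nonneg _).trans (le_of_lt hc)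
        have hu0 : u '' F = (fun z => u (h z w)) '' F :=
          image_congr fun z hz => by rw [(hh z hz).1]
        rw [fibreSup, fibreSup, hw'.1, ← hF, hu0, image_image]
        exact abs_sSup_image_sub_le hFf (by positivity) hz'
    · have hev : ∀ᶠ w' in 𝓝 w, w' ∉ g '' C := hCg.isClosed.isOpen_compl.mem_nhds hw
      refine ⟨continuousAt_const.congr (hev.mono fun y hy => (hoff y hy).2.symm), ?_⟩
      rw [(hoff w hw).2]
      exact slopeLE_of_eventually_eq_const (hev.mono fun y hy => (hoff y hy).1)
  have hle1 : ∀ w, fibreSup g U u w ≤ 1 := fun w => Real.sSup_le (by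
    rintro _ ⟨z, -, rfl⟩; exact hu.le_one z) zero_le_one
  refine ⟨measurable_of_continuousAt_compl_countable hSc fun w hw => (hslope w hw).2.continuousAt,
    measurable_of_continuousAt_compl_countable hSc fun w hw => (hslope w hw).1,
    fun w => Real.sSup_nonneg (by rintro _ ⟨z, -, rfl⟩; exact hu.nonneg z), hle1,
    fun w => Real.sqrt_nonneg _, ⟨g '' (N ∩ U), ?_, ?_, ?_⟩,
    ⟨g '' C, hCg, image_subset_iff.2 fun z hz => hmaps (hCU hz), fun w hw => (hoff w hw).1⟩, hSc,
    fun w hw => (hslope w hw).1, fun w hw => (hslope w hw).2⟩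
  · rcases (hg.analyticOnNhd hU).is_constant_or_isOpen hUc with ⟨w, hw⟩ | hopen
    · rcases (N ∩ U).eq_empty_or_nonempty with he | ⟨z, hz⟩
      · rw [he, image_empty]; exact isOpen_empty
      · refine absurd ?_ (not_eventually_eq_of_finite_fibres hU hUc hg hfin hz.2 w)
        filter_upwards [hU.mem_nhds hz.2] with y hy using hw y hy
    · exact hopen _ inter_subset_right (hN.inter hU)
  · have hcl : IsCompact (g '' closure V) := hVc.image_of_continuousOn (hg.continuousOn.mono hV)
    exact (closure_minimal (image_mono subset_closure) hcl.isClosed).trans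
      (image_mono (subset_inter hVN hV))
  · rintro _ ⟨z, hz, rfl⟩
    refine le_antisymm (hle1 _) ?_
    rw [← h1 z hz.1]
    exact le_csSup ((hfin _).image u).bddAbove (mem_image_of_mem u ⟨hz.2, rfl⟩)

/-- The image of a potential has at most the energy of the potential. -/
lemma energy_pushforward_le (hU : IsOpen U) (hUc : IsPreconnected U)
    (hg : DifferentiableOn ℂ g U) (hfin : ∀ w, (U ∩ g ⁻¹' {w}).Finite) {k : ℂ → ℝ}
    (hk : Measurable k) (hk0 : ∀ z, 0 ≤ k z) :
    ∫⁻ w, ENNReal.ofReal (fibreNorm g U (fun z => k z / ‖deriv g z‖) w) ^ 2 ≤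
      ∫⁻ z, ENNReal.ofReal (k z) ^ 2 := by
  have hdm := measurable_deriv g
  have hH : Measurable fun z => ENNReal.ofReal ((k z / ‖deriv g z‖) ^ 2) := by fun_prop
  have hSc : (g '' {z | z ∈ U ∧ deriv g z = 0}).Countable :=
    (countable_critical_points hU hUc hg hfin).image g
  calc _ = ∫⁻ w, ∑' z : {z | (z ∈ U ∧ deriv g z ≠ 0) ∧ g z = w},
        ENNReal.ofReal ((k z / ‖deriv g z‖) ^ 2) := by
        refine lintegral_congr_ae ?_
        filter_upwards [measure_eq_zero_iff_ae_notMem.1 (hSc.measure_zero volume)] with w hw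
        have hset : {z | (z ∈ U ∧ deriv g z ≠ 0) ∧ g z = w} = ((hfin w).toFinset : Set ℂ) := by
          ext z
          rw [Finite.coe_toFinset]
          exact ⟨fun h => ⟨h.1.1, h.2⟩, fun h =>
            ⟨⟨h.1, fun h' => hw ⟨z, ⟨h.1, h'⟩, h.2⟩⟩, h.2⟩⟩
        rw [tsum_congr_set_coe (fun z => ENNReal.ofReal ((k z / ‖deriv g z‖) ^ 2)) hset,
          Finset.tsum_subtype' _ fun z => ENNReal.ofReal ((k z / ‖deriv g z‖) ^ 2),
          ← ENNReal.ofReal_sum_of_nonneg fun _ _ => sq_nonneg _, fibreNorm,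
          finsum_mem_eq_finite_toFinset_sum _ (hfin w), ← ENNReal.ofReal_pow (Real.sqrt_nonneg _),
          Real.sq_sqrt (Finset.sum_nonneg fun _ _ => sq_nonneg _)]
    _ = ∫⁻ z in U, ENNReal.ofReal (‖deriv g z‖ ^ 2) * ENNReal.ofReal ((k z / ‖deriv g z‖) ^ 2) :=
        lintegral_tsum_fibre hU hg hH
    _ ≤ ∫⁻ z in U, ENNReal.ofReal (k z) ^ 2 := by
        refine lintegral_mono fun z => ?_
        rw [← ENNReal.ofReal_mul (sq_nonneg _), ← ENNReal.ofReal_pow (hk0 z), ← mul_pow]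
        refine ENNReal.ofReal_le_ofReal (pow_le_pow_left₀ (by have := hk0 z; positivity) ?_ 2)
        rcases eq_or_ne (deriv g z) 0 with h | h
        · simp [h, hk0 z]
        · rw [mul_div_cancel₀ _ (norm_ne_zero_iff.2 h)]
    _ ≤ _ := setLIntegral_le_lintegral _ _

end Transport

/-! ### Comparison of moduli -/

section Moduli

lemma IsJordanRegion.isPreconnected {V : Set ℂ} (h : IsJordanRegion V) : IsPreconnected V := by
  obtain ⟨c, -, -, z, -, rfl, -⟩ := h
  exact isPreconnected_connectedComponentIn

lemma IsJordanRegion.nonempty {V : Set ℂ} (h : IsJordanRegion V) : V.Nonempty := by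
  obtain ⟨c, -, -, z, hz, rfl, -⟩ := h
  exact ⟨z, mem_connectedComponentIn hz⟩

lemma IsJordanRegion.isCompact_closure {V : Set ℂ} (h : IsJordanRegion V) :
    IsCompact (closure V) := by
  obtain ⟨c, -, -, z, -, -, hb⟩ := h
  exact hb.isCompact_closure

/-- To compare two moduli it suffices to transport the potentials of the first ring to potentials of
the second, with control of the energy. -/
lemma ringModulus_le_mul {U V U' V' : Set ℂ} (hU : IsOpen U) (hV : IsPreconnected V)
    (hVne : V.Nonempty) (hU' : IsOpen U') (hUc' : IsSimplyConnected U') (hV' : IsPreconnected V')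
    (hVne' : V'.Nonempty) {D : ℕ} (hD : D ≠ 0)
    (h : ∀ u, IsSmoothPotential U V u → ∃ u' η' S', IsPotential U' V' u' η' S' ∧
      ∫⁻ z, ENNReal.ofReal (η' z) ^ 2 ≤ D * ∫⁻ z, ENNReal.ofReal ‖fderiv ℝ u z‖ ^ 2) :
    ringModulus U V ≤ D * ringModulus U' V' := by
  refine ENNReal.le_of_forall_nnreal_lt fun T hT => ?_
  rcases eq_or_ne T 0 with rfl | hT0
  · simp
  have hTpos : 0 < (T : ℝ) := NNReal.coe_pos.2 (pos_iff_ne_zero.2 hT0)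
  have hDe : (D : ℝ≥0∞) ≠ 0 := by exact_mod_cast hD
  obtain ⟨u, hu, huT⟩ := exists_isSmoothPotential_energy_le hU hV hVne hTpos
    (by rwa [ENNReal.ofReal_coe_nnreal])
  obtain ⟨u', η', S', hu', hη'⟩ := h u hu
  rw [ENNReal.ofReal_inv_of_pos hTpos, ENNReal.ofReal_coe_nnreal] at huT
  have hTe : (T : ℝ≥0∞) ≠ 0 := by exact_mod_cast hT0
  have hE : ∫⁻ z, ENNReal.ofReal (η' z) ^ 2 ≤ D * (T : ℝ≥0∞)⁻¹ := hη'.trans (by gcongr)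
  have hEfin : ∫⁻ z, ENNReal.ofReal (η' z) ^ 2 ≠ ∞ :=
    ne_top_of_le_ne_top (ENNReal.mul_ne_top (by simp) (ENNReal.inv_ne_top.2 hTe)) hE
  rw [mul_comm, ← ENNReal.div_le_iff_le_mul (Or.inl hDe) (Or.inl (by simp))]
  refine le_iInf₂ fun ρ hρ => ?_
  rw [ENNReal.div_le_iff_le_mul (Or.inl hDe) (Or.inl (by simp))]
  rcases eq_or_ne (∫⁻ z, ρ z ^ 2) ∞ with hinf | hfin
  · rw [hinf, ENNReal.top_mul hDe]; exact le_top
  have h1 := (hu'.one_le_mul hU' hUc' hV' hVne' hρ hfin hEfin).trans (mul_le_mul' le_rfl hE)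
  calc (T : ℝ≥0∞) = T * 1 := (mul_one _).symm
    _ ≤ T * ((∫⁻ z, ρ z ^ 2) * (D * (T : ℝ≥0∞)⁻¹)) := by gcongr
    _ = (∫⁻ z, ρ z ^ 2) * D * (T * (T : ℝ≥0∞)⁻¹) := by ring
    _ = (∫⁻ z, ρ z ^ 2) * D := by rw [ENNReal.mul_inv_cancel hTe ENNReal.coe_ne_top, mul_one]

end Moduli

theorem mainTheorem6 (U U' : Set ℂ)
    (hUo : IsOpen U) (hUc : IsSimplyConnected U)
    (hUo' : IsOpen U') (hUc' : IsSimplyConnected U')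
    (g : ℂ → ℂ) (hg : DifferentiableOn ℂ g U) (hmaps : MapsTo g U U')
    (hproper : IsProperMap (hmaps.restrict g U U'))
    (D : ℕ) (hD : HasDegree g U U' D) :
    (∀ V V' : Set ℂ, IsJordanRegion V' → closure V' ⊆ U' → IsComponentOf V (U ∩ g ⁻¹' V') →
      ringModulus U' V' ≤ D * ringModulus U V) ∧
    (∀ V : Set ℂ, IsJordanRegion V → closure V ⊆ U →
      ringModulus U V ≤ ringModulus U' (g '' V)) := by
  have hUp : IsPreconnected U := hUc.isPathConnected.isConnected.isPreconnected
  have hfin := hD.finite_fibre hmaps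
  refine ⟨fun V V' hV' hVU' hV => ?_, fun V hV hVU => ?_⟩
  · obtain ⟨z, hz, rfl⟩ := hV
    have hD0 : D ≠ 0 := fun h => by
      have h1 := hD.encard_fibre_le hmaps hUo hUp hg (g z)
      rw [h, Nat.cast_zero, nonpos_iff_eq_zero, encard_eq_zero] at h1
      exact notMem_empty z (h1 ▸ ⟨hz.1, rfl⟩)
    refine ringModulus_le_mul hUo' hV'.isPreconnected hV'.nonempty hUo hUc
      isPreconnected_connectedComponentIn ⟨z, mem_connectedComponentIn hz⟩ hD0 fun u hu =>
      ⟨_, _, _, hu.pullback hproper hUo hg hV'.isCompact_closure hVU'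
        (connectedComponentIn_subset _ _),
        energy_pullback_le hD hmaps hUo hUp hg hu.continuous_norm_fderiv.measurable⟩
  · have h := ringModulus_le_mul (D := 1) (V' := g '' V) hUo hV.isPreconnected hV.nonempty hUo' hUc'
      (hV.isPreconnected.image g (hg.continuousOn.mono (subset_closure.trans hVU)))
      (hV.nonempty.image g) one_ne_zero fun u hu =>
      ⟨_, _, _, hu.pushforward hproper hUo hUp hg hfin hUo' hV.isCompact_closure hVU, by
        rw [Nat.cast_one, one_mul]
        exact energy_pushforward_le hUo hUp hg hfin hu.continuous_norm_fderiv.measurable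
          fun z => norm_nonneg _⟩
    rwa [Nat.cast_one, one_mul] at h
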